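/- Let $k$ be a field of characteristic $0$, let $0\le r\le 3$ and $n\ge 3$, with $n=3$ if $r=3$. Let $C$ be a composition algebra over $k$ of dimension $2^r$ with norm form $\phi$ (a unital, not necessarily associative $k$-algebra with a non-degenerate multiplicative quadratic form $\phi$), with conjugation $\bar x=\phi(x,1)1-x$, where $\phi(x,y)=\phi(x+y)-\phi(x)-\phi(y)$, and let $b_1,\dots,b_n\in k^*$. For $m\le n$ put $$J_m=\mathrm{Sym}(M_m(C),\sigma)=\{x\in M_m(C)\mid \Gamma^{-1}\bar x^{t}\,\Gamma=x\},\qquad \Gamma=\mathrm{diag}(b_1,\dots,b_m),$$ with Jordan product $x\circ y=\frac12(xy+yx)$ and $U_xy=2x\circ(x\circ y)-(x\circ x)\circ y$. For $m\ge 3$ let $X(J_m)\subset\mathbb P(J_m)$ be the closed subscheme, with its reduced structure, whose points over an algebraic closure $\bar k$ are the traceless elements of rank one, i.e. the classes $[x]$ of $0\ne x\in J_m\otimes\bar k$ with trace $0$ and $U_x(J_m\otimes\bar k)\subseteq\bar k x$. For $m=2$ let $X(J_2)$ be the quadric in $\mathbb P(C\times k)$ defined by $\phi\otimes\langle b_1\rangle\perp\langle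 b_2\rangle$, that is, by $b_1\phi(c)+b_2t^2=0$. The Veronese map $v_2:[c_1,\dots,c_n]\mapsto[c_i\bar c_jb_j]$ restricts to a birational map from the quadric $Q(J,u)=\{b_1\phi(c_1)+\dots+b_{n-1}\phi(c_{n-1})+b_nc_n^2=0\}\subset\mathbb P(C^{n-1}\times k)$ to $X(J_n)$. Up to a linear automorphism of $\mathbb P(C^{n-1}\times k)$, its inverse is given by the linear system of the last row, $[x_{ij}]\mapsto[x_{n,1},\dots,x_{n,n}]$. Let $Z_2\subset X(J_n)$ be the scheme of base points of this linear system, i.e. the closed subscheme of $X(J_n)$ whose ideal sheaf is generated by the coordinates of $x_{n,1},\dots,x_{n,n}$. Then $Z_2$ is reduced and smooth over $k$, and it is isomorphic over $k$ to $X(J_{n-1})$; for $n=3$ this is the quadric $\phi\otimes\langle b_1\rangle\perp\langle b_2\rangle$. Moreover $Z_2$ is irreducible unless $r=0$ and $n=3$ (in that case it is the zero-dimensional quadric $b_1x^2+b_2y^2=0$ in $\mathbb P^1$, which may consist of two points). -/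

import Mathlib

open CategoryTheory AlgebraicGeometry
open scoped TensorProduct

noncomputable section

namespace JordanVeronese

universe u v

attribute [local instance] MvPolynomial.gradedAlgebra

/-! ### Projective schemes over a field -/

section Quotient

variable {k A : Type u} [Field k] [CommRing A] [Algebra k A]
  (𝒜 : ℕ → Submodule k A) [GradedAlgebra 𝒜] (I : HomogeneousIdeal 𝒜)

/-- The quotient grading on `A ⧸ I`, for a homogeneous ideal `I`: the degree `i` part is the image
of the degree `i` part of `A`. -/
def quotientGrading (i : ℕ) : Submodule k (A ⧸ I.toIdeal) :=
  (𝒜 i).map (Ideal.Quotient.mkₐ k I.toIdeal).toLinearMap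

/-- The projection of `𝒜 i` to the degree `i` part of the quotient. -/
def gradedProj (i : ℕ) : 𝒜 i →ₗ[k] quotientGrading 𝒜 I i :=
  (Ideal.Quotient.mkₐ k I.toIdeal).toLinearMap.submoduleMap (𝒜 i)

/-- Decomposition into homogeneous components, followed by projection to the quotient. -/
def preDecompose : A →ₗ[k] DirectSum ℕ (fun i => quotientGrading 𝒜 I i) :=
  (DirectSum.lmap (gradedProj 𝒜 I)) ∘ₗ (DirectSum.decomposeLinearEquiv 𝒜).toLinearMap

lemma preDecompose_apply (a : A) (i : ℕ) :
    (preDecompose 𝒜 I a i : A ⧸ I.toIdeal) =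
      Ideal.Quotient.mk I.toIdeal (DirectSum.decompose 𝒜 a i : A) := rfl

lemma preDecompose_eq_zero {a : A} (ha : a ∈ I.toIdeal) : preDecompose 𝒜 I a = 0 := by
  ext i
  rw [preDecompose_apply]
  exact Ideal.Quotient.eq_zero_iff_mem.mpr (I.isHomogeneous i ha)

/-- Decomposition into homogeneous components in the quotient. -/
def quotientDecompose : (A ⧸ I.toIdeal) →+ DirectSum ℕ (fun i => quotientGrading 𝒜 I i) :=
  QuotientAddGroup.lift I.toIdeal.toAddSubgroup (preDecompose 𝒜 I).toAddMonoidHom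
    (fun _ ha => preDecompose_eq_zero 𝒜 I ha)

lemma quotientDecompose_mk (a : A) :
    quotientDecompose 𝒜 I (Ideal.Quotient.mk I.toIdeal a) = preDecompose 𝒜 I a := rfl

instance quotientGradedMonoid : SetLike.GradedMonoid (quotientGrading 𝒜 I) where
  one_mem := ⟨1, SetLike.GradedOne.one_mem, map_one (Ideal.Quotient.mk I.toIdeal)⟩
  mul_mem := by
    rintro i j _ _ ⟨a, ha, rfl⟩ ⟨b, hb, rfl⟩
    exact ⟨a * b, SetLike.GradedMul.mul_mem ha hb, map_mul (Ideal.Quotient.mk I.toIdeal) a b⟩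

lemma quotientDecompose_left (x : A ⧸ I.toIdeal) :
    DirectSum.coeAddMonoidHom (quotientGrading 𝒜 I) (quotientDecompose 𝒜 I x) = x := by
  obtain ⟨a, rfl⟩ := Ideal.Quotient.mk_surjective x
  rw [quotientDecompose_mk]
  induction a using DirectSum.Decomposition.inductionOn 𝒜 with
  | zero => simp
  | homogeneous m =>
    rename_i i
    have : preDecompose 𝒜 I (m : A) = DirectSum.of (fun i => quotientGrading 𝒜 I i) i
        (gradedProj 𝒜 I i m) := by
      simp only [preDecompose, LinearMap.coe_comp, LinearEquiv.coe_coe, Function.comp_apply,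
        DirectSum.decomposeLinearEquiv_apply, DirectSum.decompose_coe]
      exact DirectSum.lmap_of _ _ _
    rw [this, DirectSum.coeAddMonoidHom_of]
    rfl
  | add a b ha hb => rw [map_add, map_add, ha, hb, map_add]

lemma quotientDecompose_right (x : DirectSum ℕ (fun i => quotientGrading 𝒜 I i)) :
    quotientDecompose 𝒜 I (DirectSum.coeAddMonoidHom (quotientGrading 𝒜 I) x) = x := by
  induction x using DirectSum.induction_on with
  | zero => simp
  | of i y =>
    obtain ⟨_, a, ha, rfl⟩ := y
    rw [DirectSum.coeAddMonoidHom_of]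
    have h : quotientDecompose 𝒜 I (Ideal.Quotient.mk I.toIdeal a) =
        DirectSum.of (fun i => quotientGrading 𝒜 I i) i (gradedProj 𝒜 I i ⟨a, ha⟩) := by
      rw [quotientDecompose_mk]
      simp only [preDecompose, LinearMap.coe_comp, LinearEquiv.coe_coe, Function.comp_apply,
        DirectSum.decomposeLinearEquiv_apply, DirectSum.decompose_of_mem 𝒜 ha]
      exact DirectSum.lmap_of _ _ _
    exact h
  | add x y hx hy => rw [map_add, map_add, hx, hy]

instance quotientGradedAlgebra : GradedAlgebra (quotientGrading 𝒜 I) where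
  toDecomposition :=
    { decompose' := quotientDecompose 𝒜 I
      left_inv := quotientDecompose_left 𝒜 I
      right_inv := quotientDecompose_right 𝒜 I }

/-- The projective `k`-scheme `Proj (A ⧸ I)`, i.e. the closed subscheme of `Proj A` defined by the
homogeneous ideal `I`, with its structure morphism to `Spec k`. -/
def projScheme : Over (Spec (CommRingCat.of k)) :=
  Over.mk (Proj.toSpecZero (quotientGrading 𝒜 I) ≫
    Spec.map (CommRingCat.ofHom (algebraMap k (quotientGrading 𝒜 I 0))))

end Quotient

/-! ### Projective space of a vector space -/

section ProjectiveSpace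

variable (k : Type u) [Field k] (V : Type v) [AddCommGroup V] [Module k V] [Module.Finite k V]

/-- The ring of polynomial functions on the finite-dimensional space `V`, in the coordinates of a
fixed basis; `Proj` of it is the projective space `ℙ(V)` of lines in `V`. -/
abbrev CoordRing : Type u := MvPolynomial (Fin (Module.finrank k V)) k

/-- The standard grading of the polynomial ring by degree. -/
abbrev coordGrading : ℕ → Submodule k (CoordRing k V) :=
  MvPolynomial.homogeneousSubmodule (Fin (Module.finrank k V)) k

variable {k V}

/-- A linear form on `V`, as a polynomial of degree one. -/
def linForm (ℓ : Module.Dual k V) : CoordRing k V :=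
  ∑ i, MvPolynomial.C (ℓ (Module.finBasis k V i)) * MvPolynomial.X i

lemma linForm_mem (ℓ : Module.Dual k V) : linForm ℓ ∈ coordGrading k V 1 :=
  Submodule.sum_mem _ fun i _ => MvPolynomial.isHomogeneous_C_mul_X _ i

/-- A quadratic form `q` on `V`, as a polynomial of degree two (in characteristic not two),
through `q(x) = B(x, x) / 2` for the polar form `B` of `q`. -/
def quadForm (q : QuadraticForm k V) : CoordRing k V :=
  ∑ i, ∑ j, MvPolynomial.C
    (2⁻¹ * QuadraticMap.polar q (Module.finBasis k V i) (Module.finBasis k V j)) *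
      (MvPolynomial.X i * MvPolynomial.X j)

lemma quadForm_mem (q : QuadraticForm k V) :
    quadForm q ∈ coordGrading k V 2 :=
  Submodule.sum_mem _ fun i _ => Submodule.sum_mem _ fun j _ => by
    have h := (MvPolynomial.isHomogeneous_X k i).mul (MvPolynomial.isHomogeneous_X k j)
    have h' := (MvPolynomial.isHomogeneous_C (Fin (Module.finrank k V))
      (2⁻¹ * QuadraticMap.polar q (Module.finBasis k V i) (Module.finBasis k V j))).mul h
    rw [MvPolynomial.mem_homogeneousSubmodule]
    exact h'

/-- The homogeneous ideal generated by a set of homogeneous polynomials of the same degree `d`. -/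
def spanIdeal (d : ℕ) (s : Set (CoordRing k V)) (hs : ∀ f ∈ s, f ∈ coordGrading k V d) :
    HomogeneousIdeal (coordGrading k V) :=
  ⟨Ideal.span s, Ideal.homogeneous_span _ _ fun f hf => ⟨d, hs f hf⟩⟩

/-- The projective quadric `q = 0` in `ℙ(V)`. -/
def quadric (q : QuadraticForm k V) : Over (Spec (CommRingCat.of k)) :=
  projScheme (coordGrading k V)
    (spanIdeal 2 {quadForm q} (by rintro _ rfl; exact quadForm_mem q))

/-- The value of a polynomial function on `V` at a point of `K ⊗ V`, for an extension `K` of `k`. -/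
def evalAt (K : Type u) [Field K] [Algebra k K] (x : K ⊗[k] V) : CoordRing k V →ₐ[k] K :=
  MvPolynomial.aeval fun i => ((Module.finBasis k V).baseChange K).repr x i

/-- The homogeneous ideal of a set `S` of points over an algebraic closure `k̄`: it is generated by
the homogeneous polynomials over `k` that vanish at all points of `S`. -/
def idealOfPoints (S : Set (AlgebraicClosure k ⊗[k] V)) : HomogeneousIdeal (coordGrading k V) :=
  ⟨Ideal.span {f | (∃ d, f ∈ coordGrading k V d) ∧ ∀ x ∈ S, evalAt (AlgebraicClosure k) x f = 0},
    Ideal.homogeneous_span _ _ fun _ hf => hf.1⟩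

/-- For a closed subscheme `X = Proj (k[V] / I)` of `ℙ(V)` and a set `L` of linear forms on `V`,
regarded as sections of `𝒪(1)` on `X`: the scheme of base points of the rational map from `X`
to projective space given by these sections. It is the closed subscheme of `X` where all the
sections vanish, i.e. its ideal sheaf is generated by the sections. -/
def baseScheme (I : HomogeneousIdeal (coordGrading k V)) (L : Set (Module.Dual k V)) :
    Over (Spec (CommRingCat.of k)) :=
  projScheme (coordGrading k V)
    (I ⊔ spanIdeal 1 (linForm '' L) (by rintro _ ⟨ℓ, -, rfl⟩; exact linForm_mem ℓ))

end ProjectiveSpace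

/-! ### Composition algebras and Jordan algebras of hermitian matrices -/

section Jordan

variable {k : Type u} [Field k] {C : Type v} [NonAssocRing C] [Module k C]

/-- The unital algebra `C` with the quadratic form `φ` is a composition algebra: `φ` is
non-degenerate and multiplicative. -/
structure IsCompositionAlgebra (φ : QuadraticForm k C) : Prop where
  nondegenerate : (QuadraticMap.polarBilin φ).Nondegenerate
  map_mul : ∀ x y : C, φ (x * y) = φ x * φ y

/-- The conjugation `x̄ = φ(x, 1) 1 - x` of a composition algebra with norm form `φ`, where
`φ(x, y) = φ (x + y) - φ x - φ y`. -/
def conj (φ : QuadraticForm k C) : C →ₗ[k] C :=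
  (LinearMap.toSpanSingleton k C 1) ∘ₗ (QuadraticMap.polarBilin φ).flip 1 - LinearMap.id

/-- The space `J = Sym(M_n(C), σ_b)` of matrices fixed by `σ_b(x) = Γ⁻¹ x̄ᵗ Γ`, where
`Γ = diag(b_1, …, b_n)`. -/
def symMatrices (φ : QuadraticForm k C) {n : ℕ} (b : Fin n → k) :
    Submodule k (Matrix (Fin n) (Fin n) C) where
  carrier := {x | ∀ i j, (b i)⁻¹ • b j • conj φ (x j i) = x i j}
  add_mem' := by
    intro x y hx hy i j
    simp [smul_add, hx i j, hy i j]
  zero_mem' := by intro i j; simp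
  smul_mem' := by
    intro c x hx i j
    rw [Matrix.smul_apply, Matrix.smul_apply, ← hx i j, map_smul, smul_comm (b j) c,
      smul_comm (b i)⁻¹ c]

/-- The Jordan product `x ∘ y = (xy + yx) / 2`. -/
def jordanMul (K : Type*) [Field K] {M : Type*} [NonUnitalNonAssocRing M] [Module K M]
    (x y : M) : M :=
  (2 : K)⁻¹ • (x * y + y * x)

/-- The quadratic operator `U_x y = 2 x ∘ (x ∘ y) - (x ∘ x) ∘ y` of the Jordan product. -/
def jordanU (K : Type*) [Field K] {M : Type*} [NonUnitalNonAssocRing M] [Module K M]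
    (x y : M) : M :=
  (2 : K) • jordanMul K x (jordanMul K x y) - jordanMul K (jordanMul K x x) y

/-- The Veronese map `v_2([c_1, …, c_n]) = [c_i c̄_j b_j]`, from `ℙ(C^n)` to `ℙ(J)`. It is
considered on the subspace of those `c` with `c_n ∈ k 1`. -/
def veronese (φ : QuadraticForm k C) {n : ℕ} (b : Fin n → k) (c : Fin n → C) :
    Matrix (Fin n) (Fin n) C :=
  Matrix.of fun i j => b j • (c i * conj φ (c j))

/-- On the chart where `c_n = t 1` is a non-zero scalar, the last row of `v_2(c)` recovers `c`, up
to a non-zero factor and to the linear automorphism `c_j ↦ b_j c̄_j` of `C^(n-1) × k`. -/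
lemma veronese_lastRow [IsScalarTower k C C] (φ : QuadraticForm k C) {m : ℕ} (b : Fin (m + 1) → k)
    (c : Fin (m + 1) → C) (t : k) (ht : c (Fin.last m) = t • 1) (j : Fin (m + 1)) :
    veronese φ b c (Fin.last m) j = t • b j • conj φ (c j) := by
  simp [veronese, ht, smul_comm t]

lemma IsCompositionAlgebra.map_one [CharZero k] [Nontrivial C] {φ : QuadraticForm k C}
    (h : IsCompositionAlgebra φ) : φ 1 = 1 := by
  have h1 : φ 1 = φ 1 * φ 1 := by simpa using h.map_mul 1 1
  by_cases h0 : φ 1 = 0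
  · exfalso
    have hz : ∀ x, φ x = 0 := fun x => by simpa [h0] using h.map_mul 1 x
    have : (1 : C) = 0 := h.nondegenerate.1 1 fun y => by simp [QuadraticMap.polar, hz]
    exact one_ne_zero this
  · exact (mul_right_cancel₀ h0 (by rw [one_mul]; exact h1)).symm

/-- Equivalently, the last column of `v_2(c)` is a non-zero multiple of `c` itself. For `x ∈ J` the
last row and the last column determine each other linearly: `x_{j,n} = b_j⁻¹ b_n x̄_{n,j}`. -/
lemma veronese_lastCol [SMulCommClass k C C] [CharZero k] [Nontrivial C] {φ : QuadraticForm k C}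
    (h : IsCompositionAlgebra φ) {m : ℕ} (b : Fin (m + 1) → k)
    (c : Fin (m + 1) → C) (t : k) (ht : c (Fin.last m) = t • 1) (j : Fin (m + 1)) :
    veronese φ b c j (Fin.last m) = (b (Fin.last m) * t) • c j := by
  have h2 : conj φ (1 : C) = 1 := by
    have h3 : φ (1 + 1) = 4 := by
      rw [← two_smul k (1 : C), QuadraticMap.map_smul, h.map_one]
      norm_num
    have h4 : QuadraticMap.polar φ 1 1 = 2 := by
      rw [QuadraticMap.polar, h3, h.map_one]
      norm_num
    simp [conj, h4, two_smul]
  simp [veronese, ht, h2, mul_smul]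

variable [IsScalarTower k C C] [SMulCommClass k C C]

/-- The inclusion of `J ⊗ K` in the (non-associative) matrix algebra `M_n(C) ⊗ K`. -/
def symInclusion (K : Type u) [Field K] [Algebra k K] (φ : QuadraticForm k C) {n : ℕ}
    (b : Fin n → k) :
    K ⊗[k] symMatrices φ b →ₗ[K] K ⊗[k] Matrix (Fin n) (Fin n) C :=
  (symMatrices φ b).subtype.baseChange K

/-- An element `x` of `J ⊗ K` is zero or of rank one (`reduced`): `U_x (J ⊗ K) ⊆ K x`. -/
def IsRankLeOne (K : Type u) [Field K] [Algebra k K] (φ : QuadraticForm k C) {n : ℕ}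
    (b : Fin n → k) (x : K ⊗[k] symMatrices φ b) : Prop :=
  ∀ y, ∃ c : K, jordanU K (symInclusion K φ b x) (symInclusion K φ b y) = c • symInclusion K φ b x

/-- The trace of an element of `J ⊗ K` is zero. -/
def IsTraceless (K : Type u) [Field K] [Algebra k K] (φ : QuadraticForm k C) {n : ℕ}
    (b : Fin n → k) (x : K ⊗[k] symMatrices φ b) : Prop :=
  (Matrix.traceLinearMap (Fin n) k C).baseChange K (symInclusion K φ b x) = 0

variable [Module.Finite k C]

/-- The homogeneous ideal of `X(J)` in the coordinate ring of `ℙ(J)`: the ideal of the set of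
traceless elements of rank one of `J ⊗ k̄`. -/
def idealXJ (φ : QuadraticForm k C) {n : ℕ} (b : Fin n → k) :
    HomogeneousIdeal (coordGrading k (symMatrices φ b)) :=
  idealOfPoints {x | IsRankLeOne (AlgebraicClosure k) φ b x ∧
    IsTraceless (AlgebraicClosure k) φ b x}

/-- The projective variety `X(J)` (with its reduced structure) of traceless rank one elements of
`J = Sym(M_n(C), σ_b)`. -/
def XJ (φ : QuadraticForm k C) {n : ℕ} (b : Fin n → k) : Over (Spec (CommRingCat.of k)) :=
  projScheme (coordGrading k (symMatrices φ b)) (idealXJ φ b)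

/-- The coordinates of the last row `[x_{n,1}, …, x_{n,n}]`, as linear forms on `J`. -/
def lastRowForms (φ : QuadraticForm k C) {m : ℕ} (b : Fin (m + 1) → k) :
    Set (Module.Dual k (symMatrices φ b)) :=
  {ℓ | ∃ (j : Fin (m + 1)) (μ : Module.Dual k C), ∀ x : symMatrices φ b,
    ℓ x = μ (x.1 (Fin.last m) j)}

/-- The scheme `Z_2` of base points of the rational map `v_2⁻¹` on `X(J)`, which is given by the
linear system of the last row, `[x_{ij}] ↦ [x_{n,1}, …, x_{n,n}]` (see `veronese_lastRow`; the last
column, as in `veronese_lastCol`, spans the same linear system). -/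
def Z2 (φ : QuadraticForm k C) {m : ℕ} (b : Fin (m + 1) → k) : Over (Spec (CommRingCat.of k)) :=
  baseScheme (idealXJ φ b) (lastRowForms φ b)

end Jordan

end JordanVeronese

end

open JordanVeronese

/-!
The base scheme `Z_2` is compared with a smaller projective scheme `Y`, the quadric
`φ ⊗ ⟨b_1⟩ ⊥ ⟨b_2⟩` for `n = 3` and `X(J_{n-1})` for `n > 3`. A matrix in `J_n` with last row zero
is determined by its block of size `n - 1`, so `Z_2` lies in the linear subspace `ℙ(J_{n-1})`, and
it remains to see that the equations of `X(J_n)` cut out `Y` there. Restriction of polynomial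
functions to this subspace is a surjective graded homomorphism from the coordinate ring of `Z_2` to
that of `Y`. Its kernel is killed by powers of linear forms that span the dual space, so it induces
an isomorphism of projective schemes (`nonempty_projScheme_iso`). The schemes `Y` are reduced and
irreducible because their homogeneous ideals are radical and prime, and smooth by the infinitesimal
lifting criterion on affine charts (`smooth_projScheme_of_lift`).

For `n = 3`, which includes the octonions, a matrix `x` of rank one satisfies
`x_{11} x_{22} = x_{12} x_{21}`, by the formula `(U_x e)_{ij} = x_{i1} x_{1j}` for the idempotent
`e = e_{11}` (`minor_eq_zero`). With trace zero and last row zero this is the equation of the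
quadric. Conversely, a traceless matrix with last row zero that satisfies this equation has rank
one, by the alternative laws (`jordanU_block`). Here the kernel is zero.

For `n > 3` the algebra `C` has dimension at most four, hence is associative
(`IsCompositionAlgebra.mul_assoc_of_finrank`). Write `v(c) = c c̄ᵗ Γ` and `d^* = d̄ᵗ Γ`. In the
matrix algebra `U_x y = x y x`, and for `y = v(d)` this gives the equation `v(x d) = (d^* x d) x`
for all `x` of rank one (`veroneseIn_mulVec_eq`). Since the linear forms `d^* x d` span the dual of `J`,
every traceless element of rank one over an algebraically closed field is `v(c)` for some `c` with
`∑ b_i φ(c_i) = 0`, and the ideal of `X(J)` is the preimage under `v` of the prime ideal of this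
quadric (`mem_idealXJ_iff`). The same equation shows that, where `d^* x d` is invertible, a point of
`X(J)` is determined by the vector `x d` on the quadric. Moving this vector in the direction `d`
lifts points along square-zero ideals (`smooth_XJ`), and the equation applied to points of `Z_2`
bounds the kernel above (`map_pow_mul_eq_zero`).
-/

open CategoryTheory AlgebraicGeometry
open scoped TensorProduct

set_option linter.unusedSectionVars false

noncomputable section

namespace JordanVeronese

universe u v

/-! ### `Proj` of graded algebras: isomorphisms, reducedness, irreducibility, smoothness -/

section ProjGeneral

open HomogeneousLocalization HomogeneousIdeal

variable {A B : Type u} [CommRing A] [CommRing B] {k : Type u} [Field k] [Algebra k A] [Algebra k B]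
  {𝒜 : ℕ → Submodule k A} {ℬ : ℕ → Submodule k B} [GradedAlgebra 𝒜] [GradedAlgebra ℬ]

lemma awayMap_bijective (f : 𝒜 →+*ᵍ ℬ) (hsurj : ∀ n, ∀ y ∈ ℬ n, ∃ x ∈ 𝒜 n, f x = y)
    {t : A} (ht : t ∈ 𝒜 1) (htor : ∀ n, ∀ a ∈ 𝒜 n, f a = 0 → ∃ N : ℕ, t ^ N * a = 0) :
    Function.Bijective (Away.map f t) := by
  constructor
  · rw [injective_iff_map_eq_zero]
    intro x hx
    obtain ⟨n, a, ha, rfl⟩ := Away.mk_surjective 𝒜 ht x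
    rw [Away.map_mk] at hx
    replace hx := congrArg HomogeneousLocalization.val hx
    rw [Away.val_mk, val_zero, Localization.mk_eq_mk', IsLocalization.mk'_eq_zero_iff] at hx
    obtain ⟨⟨_, M, rfl⟩, hM⟩ := hx
    have h1 : f (t ^ M * a) = 0 := by
      rw [map_mul, map_pow]; exact hM
    obtain ⟨N, hN⟩ := htor (M • 1 + n • 1) (t ^ M * a)
      (SetLike.mul_mem_graded (SetLike.pow_mem_graded M ht) ha) h1
    ext
    rw [Away.val_mk, val_zero, Localization.mk_eq_mk', IsLocalization.mk'_eq_zero_iff]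
    exact ⟨⟨t ^ (N + M), N + M, rfl⟩, by rw [← hN]; simp only [pow_add]; ring⟩
  · intro y
    obtain ⟨n, b, hb, rfl⟩ := Away.mk_surjective ℬ (f.2 ht) y
    obtain ⟨a, ha, rfl⟩ := hsurj _ b hb
    exact ⟨Away.mk 𝒜 ht n a ha, Away.map_mk _ _ _ _ _ _⟩

/-- A surjective homomorphism of graded rings whose kernel is killed by powers of each member `t i`
of a family of degree-one elements generating the irrelevant ideal is an isomorphism on `Proj`. -/
lemma isIso_projMap (f : 𝒜 →+*ᵍ ℬ) (hf : ℬ₊ ≤ 𝒜₊.map f)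
    (hsurj : ∀ n, ∀ y ∈ ℬ n, ∃ x ∈ 𝒜 n, f x = y) {ι : Type*} (t : ι → A)
    (ht : ∀ i, t i ∈ 𝒜 1) (hspan : 𝒜₊.toIdeal ≤ Ideal.span (Set.range t))
    (htor : ∀ i n, ∀ a ∈ 𝒜 n, f a = 0 → ∃ N : ℕ, t i ^ N * a = 0) :
    IsIso (Proj.map f hf) := by
  have hcov := Proj.iSup_basicOpen_eq_top 𝒜 t hspan
  have haff : ∀ i, IsAffineOpen (Proj.basicOpen 𝒜 (t i)) := fun i =>
    Proj.isAffineOpen_basicOpen 𝒜 _ (ht i) one_pos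
  have haff' : ∀ i, IsAffineOpen (Proj.map f hf ⁻¹ᵁ Proj.basicOpen 𝒜 (t i)) := fun i => by
    rw [Proj.map_preimage_basicOpen]
    exact Proj.isAffineOpen_basicOpen ℬ _ (f.2 (ht i)) one_pos
  have : IsAffineHom (Proj.map f hf) := by
    apply isAffineHom_of_forall_exists_isAffineOpen
    intro x
    have hx : x ∈ ⨆ i, Proj.basicOpen 𝒜 (t i) := by rw [hcov]; trivial
    obtain ⟨i, hi⟩ := TopologicalSpace.Opens.mem_iSup.mp hx
    exact ⟨_, hi, haff i, haff' i⟩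
  refine (IsZariskiLocalAtTarget.iff_of_iSup_eq_top (P := MorphismProperty.isomorphisms Scheme)
    _ hcov).mpr fun i => ?_
  refine (isIso_morphismRestrict_iff_isIso_app _ (haff i)).mpr ?_
  have key := Proj.awayToSection_comp_appLE f hf (ht i)
  have i1 : IsIso (Proj.awayToSection 𝒜 (t i)) :=
    (Proj.basicOpenIsoAway 𝒜 (t i) (ht i) one_pos).isIso_hom
  have i2 : IsIso (Proj.awayToSection ℬ (f (t i))) :=
    (Proj.basicOpenIsoAway ℬ (f (t i)) (f.2 (ht i)) one_pos).isIso_hom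
  have i3 : IsIso (CommRingCat.ofHom (Away.map f (t i))) :=
    (RingEquiv.ofBijective _ (awayMap_bijective f hsurj (ht i) (htor i))).toCommRingCatIso.isIso_hom
  rw [Scheme.Hom.app_eq_appLE]
  have i4 : IsIso (Proj.awayToSection 𝒜 (t i) ≫ Scheme.Hom.appLE (Proj.map f hf)
    (Proj.basicOpen 𝒜 (t i)) (Proj.basicOpen ℬ (f (t i))) (by rfl)) := by
    rw [key]; exact IsIso.comp_isIso
  exact @IsIso.of_isIso_comp_left _ _ _ _ _ _ _ i1 i4

variable (𝒜) in
/-- The structure morphism of `Proj A` over the base field. -/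
def projStr : Proj 𝒜 ⟶ Spec (CommRingCat.of k) :=
  Proj.toSpecZero 𝒜 ≫ Spec.map (CommRingCat.ofHom (algebraMap k (𝒜 0)))

variable (𝒜) in
lemma awayι_projStr {t : A} {m : ℕ} (ht : t ∈ 𝒜 m) (hm : 0 < m) :
    Proj.awayι 𝒜 t ht hm ≫ projStr 𝒜 =
      Spec.map (CommRingCat.ofHom ((fromZeroRingHom 𝒜 _).comp (algebraMap k (𝒜 0)))) := by
  rw [projStr, Proj.awayι_toSpecZero_assoc, ← Spec.map_comp]
  rfl

lemma awayι_projMap_projStr (f : 𝒜 →+*ᵍ ℬ) (hf : ℬ₊ ≤ 𝒜₊.map f)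
    (hk : ∀ c : k, f (algebraMap k A c) = algebraMap k B c) {i : ℕ} (hi : 0 < i) {s : A}
    (hs : s ∈ 𝒜 i) :
    Proj.awayι ℬ (f s) (f.2 hs) hi ≫ Proj.map f hf ≫ projStr 𝒜 =
      Proj.awayι ℬ (f s) (f.2 hs) hi ≫ projStr ℬ := by
  rw [Proj.awayι_comp_map_assoc _ _ hi _ hs, awayι_projStr, awayι_projStr, ← Spec.map_comp]
  congr 1
  refine CommRingCat.hom_ext (RingHom.ext fun c => ?_)
  change Away.map f s (fromZeroRingHom 𝒜 _ (algebraMap k (𝒜 0) c)) =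
    fromZeroRingHom ℬ _ (algebraMap k (ℬ 0) c)
  ext
  change Localization.mk (f (algebraMap k A c)) _ = Localization.mk (algebraMap k B c) _
  rw [hk]
  congr 1
  ext
  simp

lemma projMap_projStr (f : 𝒜 →+*ᵍ ℬ) (hf : ℬ₊ ≤ 𝒜₊.map f)
    (hk : ∀ c : k, f (algebraMap k A c) = algebraMap k B c) :
    Proj.map f hf ≫ projStr 𝒜 = projStr ℬ :=
  (Proj.mapAffineOpenCover f hf).openCover.hom_ext _ _ fun s =>
    awayι_projMap_projStr f hf hk s.1.2 s.2.2

lemma isReduced_proj [_root_.IsReduced A] : IsReduced (Proj 𝒜) := by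
  have : ∀ i, IsReduced ((Proj.affineOpenCover 𝒜).openCover.X i) := by
    intro i
    refine (affine_isReduced_iff _).mpr ?_
    change _root_.IsReduced (Away 𝒜 (i.2 : A))
    have hloc : _root_.IsReduced (Localization.Away (i.2 : A)) :=
      isReduced_localizationPreserves (Submonoid.powers (i.2 : A))
        (Localization.Away (i.2 : A)) inferInstance
    refine ⟨fun x hx => ?_⟩
    have : IsNilpotent x.val := hx.map (algebraMap (Away 𝒜 (i.2 : A)) (Localization.Away (i.2 : A)))
    exact HomogeneousLocalization.val_injective _ (by rw [this.eq_zero, val_zero])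
  exact IsReduced.of_openCover _ (Proj.affineOpenCover 𝒜).openCover

lemma irreducibleSpace_proj [IsDomain A] {n : ℕ} (hn : 0 < n) {a : A} (ha : a ∈ 𝒜 n) (ha0 : a ≠ 0) :
    IrreducibleSpace (Proj 𝒜) := by
  let η : ProjectiveSpectrum 𝒜 := ⟨⊥, by
    rw [HomogeneousIdeal.toIdeal_bot]; exact Ideal.isPrime_bot, fun h => ha0 <| by
      have := h (HomogeneousIdeal.mem_irrelevant_of_mem 𝒜 hn ha)
      exact this⟩
  have hη : closure ({η} : Set (ProjectiveSpectrum 𝒜)) = Set.univ := by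
    ext x
    simp only [Set.mem_univ, iff_true]
    rw [← ProjectiveSpectrum.le_iff_mem_closure]
    exact (bot_le : (⊥ : HomogeneousIdeal 𝒜) ≤ x.asHomogeneousIdeal)
  have : IsIrreducible (Set.univ : Set (ProjectiveSpectrum 𝒜)) := by
    rw [← hη]; exact isIrreducible_singleton.closure
  have hp : PreirreducibleSpace (ProjectiveSpectrum 𝒜) := ⟨this.2⟩
  exact { hp with toNonempty := ⟨η⟩ }

lemma smooth_projStr {ι : Type*} (t : ι → A)
    (ht : ∀ i, t i ∈ 𝒜 1) (hspan : 𝒜₊.toIdeal ≤ Ideal.span (Set.range t))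
    (H : ∀ i, ((fromZeroRingHom 𝒜 (Submonoid.powers (t i))).comp (algebraMap k (𝒜 0))).Smooth) :
    Smooth (projStr 𝒜) := by
  have : IsZariskiLocalAtSource @Smooth.{u} :=
    HasRingHomProperty.instIsZariskiLocalAtSource (Q := RingHom.Smooth)
  refine IsZariskiLocalAtSource.of_openCover (P := @Smooth)
    (Proj.affineOpenCoverOfIrrelevantLESpan 𝒜 t ht (fun _ => one_pos) hspan).openCover fun i => ?_
  change Smooth (Proj.awayι 𝒜 (t i) (ht i) one_pos ≫ projStr 𝒜)
  rw [awayι_projStr]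
  exact (HasRingHomProperty.Spec_iff (P := @Smooth)).mpr (H i)

variable (𝒜) in
/-- Dehomogenization: the homomorphism `A → A_(t)` sending a homogeneous element `a` of degree `n`
to `a / t ^ n`, for `t` of degree one. -/
lemma exists_dehomogenize {t : A} (ht : t ∈ 𝒜 1) :
    ∃ δ : A →+* Away 𝒜 t, ∀ n a (ha : a ∈ 𝒜 n),
      δ a = Away.mk 𝒜 ht n a (by simp [ha]) := by
  let F : ∀ n, 𝒜 n →+ Away 𝒜 t := fun n =>
    { toFun := fun a => Away.mk 𝒜 ht n a (by simp)
      map_zero' := by ext; simp [Localization.mk_zero]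
      map_add' := fun a b => by
        ext; simp [Localization.add_mk_self] }
  let δ : (DirectSum ℕ fun i => 𝒜 i) →+* Away 𝒜 t := DirectSum.toSemiring F
    (by ext; simp [F])
    (fun {i j} a b => by
      ext
      simp [F, Localization.mk_mul, pow_add])
  refine ⟨δ.comp (DirectSum.decomposeRingEquiv 𝒜).toRingHom, fun n a ha => ?_⟩
  have : DirectSum.decomposeRingEquiv 𝒜 a = DirectSum.of (fun i => 𝒜 i) n ⟨a, ha⟩ :=
    DirectSum.decompose_of_mem 𝒜 ha
  simp only [RingHom.comp_apply, RingEquiv.toRingHom_eq_coe, RingHom.coe_coe, this, δ,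
    DirectSum.toSemiring_of]
  rfl

/-- If `k`-homomorphisms from `A` to a quotient `B / N` by a square-zero ideal that send `t` to a
unit always lift to `B`, then the affine chart `A_(t)` of `Proj A` is smooth over `k`. -/
lemma smooth_away [Algebra.FiniteType k A] {t : A} (ht : t ∈ 𝒜 1)
    (h0 : Function.Surjective (algebraMap k (𝒜 0)))
    (H : ∀ (R : Type u) [CommRing R] [Algebra k R] (N : Ideal R), N ^ 2 = ⊥ →
      ∀ g : A →ₐ[k] R ⧸ N, IsUnit (g t) → ∃ g' : A →ₐ[k] R, (Ideal.Quotient.mkₐ k N).comp g' = g) :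
    ((fromZeroRingHom 𝒜 (Submonoid.powers t)).comp (algebraMap k (𝒜 0))).Smooth := by
  let : Algebra k (Away 𝒜 t) :=
    ((fromZeroRingHom 𝒜 (Submonoid.powers t)).comp (algebraMap k (𝒜 0))).toAlgebra
  have halg : ∀ c : k, (algebraMap k (Away 𝒜 t) c).val =
      algebraMap A (Localization.Away t) (algebraMap k A c) := fun c => by
    rw [← Localization.mk_one_eq_algebraMap]
    rfl
  change Algebra.Smooth k (Away 𝒜 t)
  have ft : Algebra.FiniteType k (Away 𝒜 t) := by
    have f0 : IsScalarTower k (𝒜 0) A := ⟨fun c a x => smul_mul_assoc c (a : A) x⟩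
    have f1 : Algebra.FiniteType (𝒜 0) A := Algebra.FiniteType.of_restrictScalars_finiteType k _ _
    have f2 : Algebra.FiniteType (𝒜 0) (Away 𝒜 t) := Away.finiteType t 1 ht
    have f3 : (algebraMap k (𝒜 0)).FiniteType := RingHom.FiniteType.of_surjective _ h0
    exact RingHom.FiniteType.comp (g := fromZeroRingHom 𝒜 (Submonoid.powers t)) f2 f3
  refine ⟨Algebra.FormallySmooth.of_comp_surjective ?_,
    Algebra.FinitePresentation.of_finiteType.mp ft⟩
  intro R _ _ N hN h
  obtain ⟨δ, hδ⟩ := exists_dehomogenize 𝒜 ht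
  have hδk : ∀ c : k, δ (algebraMap k A c) = algebraMap k (Away 𝒜 t) c := fun c => by
    refine (hδ 0 _ (algebraMap k (𝒜 0) c).2).trans ?_
    ext
    rw [halg, ← Localization.mk_one_eq_algebraMap, Away.val_mk]
    simp
    rfl
  let δ' : A →ₐ[k] Away 𝒜 t := { δ with commutes' := hδk }
  have h1 : h (δ' t) = 1 := by
    rw [← map_one h]
    congr 1
    refine (hδ 1 t ht).trans ?_
    ext
    simp
  obtain ⟨g', hg'⟩ := H R N hN (h.comp δ') (by rw [AlgHom.comp_apply, h1]; exact isUnit_one)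
  have hg'' : ∀ a, Ideal.Quotient.mk N (g' a) = h (δ' a) := fun a => DFunLike.congr_fun hg' a
  have hu : IsUnit (g' t) := by
    obtain ⟨y, hy⟩ : ∃ y ∈ N, g' t = 1 + y := by
      refine ⟨g' t - 1, ?_, by ring⟩
      rw [← Ideal.Quotient.eq_zero_iff_mem, map_sub, hg'', h1, map_one, sub_self]
    have hy2 : y ^ 2 = 0 := by
      have : y ^ 2 ∈ N ^ 2 := Ideal.pow_mem_pow hy.1 2
      rwa [hN, Ideal.mem_bot] at this
    rw [hy.2]
    exact IsUnit.of_mul_eq_one (1 - y) (by linear_combination -hy2)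
  let ψ : Localization.Away t →+* R := IsLocalization.Away.lift t (g := g'.toRingHom) hu
  have hψ : ∀ n a, ψ (Localization.mk a ⟨t ^ n, n, rfl⟩) * g' t ^ n = g' a := fun n a => by
    have h2 : ∀ a, ψ (algebraMap A _ a) = g' a := fun a => IsLocalization.Away.lift_eq t hu a
    rw [← map_pow, ← h2, ← h2, ← map_mul]
    congr 1
    rw [Localization.mk_eq_mk']
    exact IsLocalization.mk'_spec _ _ _
  let ψ' : Away 𝒜 t →ₐ[k] R :=
    { toRingHom := ψ.comp (algebraMap (Away 𝒜 t) (Localization.Away t))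
      commutes' := fun c => by
        change ψ (algebraMap (Away 𝒜 t) (Localization.Away t) (algebraMap k (Away 𝒜 t) c)) = _
        rw [HomogeneousLocalization.algebraMap_apply, halg]
        exact (IsLocalization.Away.lift_eq t hu _).trans (AlgHom.commutes _ _) }
  refine ⟨ψ', AlgHom.ext fun x => ?_⟩
  obtain ⟨n, a, ha, rfl⟩ := Away.mk_surjective 𝒜 ht x
  change Ideal.Quotient.mk N (ψ (Localization.mk a ⟨t ^ n, n, rfl⟩)) = _
  have h3 := congrArg (Ideal.Quotient.mk N) (hψ n a)
  rw [map_mul, map_pow, hg'', h1, one_pow, mul_one, hg''] at h3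
  rw [h3]
  congr 1
  refine (hδ n a (by simpa using ha)).trans ?_
  rfl

end ProjGeneral

/-! ### Projective schemes of homogeneous ideals -/

section ProjQuotient

open HomogeneousLocalization HomogeneousIdeal

attribute [local instance] MvPolynomial.gradedAlgebra

variable {k : Type u} [Field k] {V : Type*} [AddCommGroup V] [Module k V] [Module.Finite k V]
  {W : Type*} [AddCommGroup W] [Module k W] [Module.Finite k W]

lemma linForm_finBasis_coord (i : Fin (Module.finrank k V)) :
    linForm ((Module.finBasis k V).coord i) = MvPolynomial.X i := by
  simp [linForm, Finsupp.single_apply]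

variable (k V) in
/-- `linForm` as a linear map. -/
def linFormₗ : Module.Dual k V →ₗ[k] CoordRing k V where
  toFun := linForm
  map_add' ℓ ℓ' := by simp [linForm, add_mul, Finset.sum_add_distrib]
  map_smul' c ℓ := by simp [linForm, MvPolynomial.smul_eq_C_mul, Finset.mul_sum, mul_assoc]

lemma X_mem_of_span_eq_top {ι : Type*} {T : ι → Module.Dual k V}
    (hT : Submodule.span k (Set.range T) = ⊤) (i : Fin (Module.finrank k V))
    {P : Ideal (CoordRing k V)} (hP : ∀ j, linForm (T j) ∈ P) : MvPolynomial.X i ∈ P := by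
  have h : (Module.finBasis k V).coord i ∈ Submodule.span k (Set.range T) := hT ▸ Submodule.mem_top
  rw [← linForm_finBasis_coord]
  have h2 : Submodule.span k (Set.range T) ≤ (P.restrictScalars k).comap (linFormₗ k V) := by
    rw [Submodule.span_le]
    rintro _ ⟨j, rfl⟩
    exact hP j
  exact h2 h

lemma irrelevant_quotient_le (I : HomogeneousIdeal (coordGrading k V)) {ι : Type*}
    {T : ι → Module.Dual k V} (hT : Submodule.span k (Set.range T) = ⊤) :
    (irrelevant (quotientGrading (coordGrading k V) I)).toIdeal ≤
      Ideal.span (Set.range fun i => Ideal.Quotient.mk I.toIdeal (linForm (T i))) := by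
  rw [toIdeal_irrelevant_le]
  rintro n hn _ ⟨f, hf, rfl⟩
  change Ideal.Quotient.mk I.toIdeal f ∈ _
  set P := (Ideal.span (Set.range fun i => Ideal.Quotient.mk I.toIdeal (linForm (T i)))).comap
    (Ideal.Quotient.mk I.toIdeal)
  change f ∈ P
  have hX : ∀ i, MvPolynomial.X i ∈ P := fun i => X_mem_of_span_eq_top hT i fun j =>
    Ideal.subset_span ⟨j, rfl⟩
  rw [f.as_sum]
  refine Ideal.sum_mem _ fun m hm => ?_
  have hdeg : m.degree = n := by
    by_contra h
    exact (MvPolynomial.mem_support_iff.mp hm) (MvPolynomial.IsHomogeneous.coeff_eq_zero hf h)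
  obtain ⟨i, hi⟩ : ∃ i, m i ≠ 0 := by
    by_contra! h
    have : m = 0 := Finsupp.ext h
    simp [this] at hdeg
    omega
  have : MvPolynomial.monomial m (MvPolynomial.coeff m f) =
      MvPolynomial.monomial (m - Finsupp.single i 1) (MvPolynomial.coeff m f) *
        MvPolynomial.X i := by
    rw [MvPolynomial.X, MvPolynomial.monomial_mul, mul_one, tsub_add_cancel_of_le]
    simpa [Nat.one_le_iff_ne_zero] using hi
  rw [this]
  exact P.mul_mem_left _ (hX i)

lemma mk_linForm_mem (I : HomogeneousIdeal (coordGrading k V)) (ℓ : Module.Dual k V) :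
    Ideal.Quotient.mk I.toIdeal (linForm ℓ) ∈ quotientGrading (coordGrading k V) I 1 :=
  ⟨_, linForm_mem ℓ, rfl⟩

/-- A surjective graded homomorphism `θ` of polynomial rings induces an isomorphism of the
projective schemes of homogeneous ideals `I` and `J`, provided that `θ` maps `I` to `J` and that,
for linear forms `T i` spanning the dual space, the preimage of `J` lies in `I` up to powers
of `T i`. -/
lemma nonempty_projScheme_iso (I : HomogeneousIdeal (coordGrading k V))
    (J : HomogeneousIdeal (coordGrading k W)) (θ : CoordRing k V →ₐ[k] CoordRing k W)
    (hθ : ∀ n, ∀ f ∈ coordGrading k V n, θ f ∈ coordGrading k W n)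
    (hsurj : ∀ n, ∀ g ∈ coordGrading k W n, ∃ f ∈ coordGrading k V n, θ f = g)
    (hIJ : ∀ f ∈ I.toIdeal, θ f ∈ J.toIdeal) {ι : Type*} (T : ι → Module.Dual k V)
    (hT : Submodule.span k (Set.range T) = ⊤)
    (htor : ∀ i n, ∀ f ∈ coordGrading k V n, θ f ∈ J.toIdeal →
      ∃ N : ℕ, linForm (T i) ^ N * f ∈ I.toIdeal) :
    Nonempty (projScheme (coordGrading k V) I ≅ projScheme (coordGrading k W) J) := by
  let ψ : quotientGrading (coordGrading k V) I →+*ᵍ quotientGrading (coordGrading k W) J :=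
    { Ideal.quotientMap J.toIdeal (θ : CoordRing k V →+* CoordRing k W) (fun f hf => hIJ f hf) with
      map_mem := by
        rintro n _ ⟨f, hf, rfl⟩
        exact ⟨θ f, hθ n f hf, rfl⟩ }
  have hs : ∀ n, ∀ y ∈ quotientGrading (coordGrading k W) J n,
      ∃ x ∈ quotientGrading (coordGrading k V) I n, ψ x = y := by
    rintro n _ ⟨g, hg, rfl⟩
    obtain ⟨f, hf, rfl⟩ := hsurj n g hg
    exact ⟨_, ⟨f, hf, rfl⟩, rfl⟩
  have hirr : irrelevant (quotientGrading (coordGrading k W) J) ≤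
      (irrelevant (quotientGrading (coordGrading k V) I)).map ψ := by
    rw [irrelevant_le]
    intro n hn y hy
    obtain ⟨x, hx, rfl⟩ := hs n y hy
    exact Ideal.mem_map_of_mem _ (mem_irrelevant_of_mem _ hn hx)
  have hiso : IsIso (Proj.map ψ hirr) := by
    refine isIso_projMap ψ hirr hs (fun i => Ideal.Quotient.mk I.toIdeal (linForm (T i)))
      (fun i => mk_linForm_mem I (T i)) (irrelevant_quotient_le I hT) ?_
    rintro i n _ ⟨f, hf, rfl⟩ h
    have h' : θ f ∈ J.toIdeal := Ideal.Quotient.eq_zero_iff_mem.mp h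
    obtain ⟨N, hN⟩ := htor i n f hf h'
    exact ⟨N, Ideal.Quotient.eq_zero_iff_mem.mpr hN⟩
  have hcomm : Proj.map ψ hirr ≫ projStr (k := k) (quotientGrading (coordGrading k V) I) =
      projStr (k := k) (quotientGrading (coordGrading k W) J) :=
    projMap_projStr ψ hirr fun c => by
      change Ideal.Quotient.mk J.toIdeal (θ (algebraMap k _ c)) = _
      rw [AlgHom.commutes]; rfl
  let e : (projScheme (coordGrading k W) J).left ≅ (projScheme (coordGrading k V) I).left :=
    @asIso _ _ _ _ (Proj.map ψ hirr) hiso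
  exact ⟨(Over.isoMk e hcomm).symm⟩

lemma isReduced_projScheme {I : HomogeneousIdeal (coordGrading k V)} (hI : I.toIdeal.IsRadical) :
    IsReduced (projScheme (coordGrading k V) I).left := by
  have : _root_.IsReduced (CoordRing k V ⧸ I.toIdeal) :=
    (Ideal.isRadical_iff_quotient_reduced _).mp hI
  exact isReduced_proj (𝒜 := quotientGrading (coordGrading k V) I)

lemma irreducibleSpace_projScheme {I : HomogeneousIdeal (coordGrading k V)}
    (hI : I.toIdeal.IsPrime) {ℓ : Module.Dual k V} (hℓ : linForm ℓ ∉ I.toIdeal) :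
    IrreducibleSpace (projScheme (coordGrading k V) I).left :=
  irreducibleSpace_proj (𝒜 := quotientGrading (coordGrading k V) I) one_pos (mk_linForm_mem I ℓ)
    fun h => hℓ (Ideal.Quotient.eq_zero_iff_mem.mp h)

lemma smooth_projScheme {I : HomogeneousIdeal (coordGrading k V)} {ι : Type*}
    (T : ι → Module.Dual k V) (hT : Submodule.span k (Set.range T) = ⊤)
    (H : ∀ i (R : Type u) [CommRing R] [Algebra k R] (N : Ideal R), N ^ 2 = ⊥ →
      ∀ g : CoordRing k V →ₐ[k] R ⧸ N, (∀ f ∈ I.toIdeal, g f = 0) → IsUnit (g (linForm (T i))) →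
        ∃ g' : CoordRing k V →ₐ[k] R, (∀ f ∈ I.toIdeal, g' f = 0) ∧
          (Ideal.Quotient.mkₐ k N).comp g' = g) :
    Smooth (projScheme (coordGrading k V) I).hom := by
  refine smooth_projStr (𝒜 := quotientGrading (coordGrading k V) I)
    (fun i => Ideal.Quotient.mk I.toIdeal (linForm (T i)))
    (fun i => mk_linForm_mem I (T i)) (irrelevant_quotient_le I hT) fun i => ?_
  have ft : Algebra.FiniteType k (CoordRing k V ⧸ I.toIdeal) :=
    Algebra.FiniteType.of_surjective (Ideal.Quotient.mkₐ k I.toIdeal) Ideal.Quotient.mk_surjective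
  refine smooth_away (mk_linForm_mem I (T i)) ?_ ?_
  · rintro ⟨_, f, hf, rfl⟩
    obtain ⟨c, rfl⟩ : ∃ c, MvPolynomial.C c = f := by
      have h0 : f.totalDegree = 0 := Nat.le_zero.mp (MvPolynomial.IsHomogeneous.totalDegree_le hf)
      exact ⟨_, (MvPolynomial.totalDegree_eq_zero_iff_eq_C.mp h0).symm⟩
    exact ⟨c, rfl⟩
  · intro R _ _ N hN g hg
    obtain ⟨g', hg', hc⟩ := H i R N hN (g.comp (Ideal.Quotient.mkₐ k I.toIdeal))
      (fun f hf => by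
        change g (Ideal.Quotient.mk I.toIdeal f) = 0
        rw [Ideal.Quotient.eq_zero_iff_mem.mpr hf, map_zero]) hg
    refine ⟨Ideal.Quotient.liftₐ I.toIdeal g' hg', ?_⟩
    apply Ideal.Quotient.algHom_ext
    rw [← hc]
    ext
    rfl

end ProjQuotient

section Transfer

variable {k : Type u} [Field k] {X Y : Over (Spec (CommRingCat.of k))}

lemma isReduced_of_iso (e : X ≅ Y) (hY : IsReduced Y.left) : IsReduced X.left :=
  have : IsIso e.hom.left := (Over.forget _).map_isIso e.hom
  isReduced_of_isOpenImmersion e.hom.left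

lemma smooth_of_iso (e : X ≅ Y) (hY : Smooth Y.hom) : Smooth X.hom := by
  have : IsIso e.hom.left := (Over.forget _).map_isIso e.hom
  rw [← Over.w e.hom]
  infer_instance

lemma irreducibleSpace_of_iso (e : X ≅ Y) (hY : IrreducibleSpace Y.left) :
    IrreducibleSpace X.left :=
  have : IrreducibleSpace ↥((Over.forget _).obj Y) := hY
  (Scheme.homeoOfIso ((Over.forget _).mapIso e)).symm.surjective.irreducibleSpace
    (Scheme.homeoOfIso ((Over.forget _).mapIso e)).symm.continuous

end Transfer

/-! ### Polynomial functions at points with values in algebras -/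

section Points

open MvPolynomial

attribute [local instance] MvPolynomial.gradedAlgebra

variable {k : Type u} [Field k] {V : Type*} [AddCommGroup V] [Module k V]
  {W : Type*} [AddCommGroup W] [Module k W] {U : Type*} [AddCommGroup U] [Module k U]
  {B : Type*} [CommRing B] [Algebra k B] {B' : Type*} [CommRing B'] [Algebra k B']

variable (V) in
/-- Extension of scalars of points of `V` along a homomorphism `g : B → B'`. -/
def mapPt (g : B →ₐ[k] B') : B ⊗[k] V →ₗ[k] B' ⊗[k] V := g.toLinearMap.rTensor V

@[simp] lemma mapPt_tmul (g : B →ₐ[k] B') (b : B) (v : V) :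
    mapPt V g (b ⊗ₜ v) = g b ⊗ₜ v := rfl

@[simp] lemma mapPt_smul (g : B →ₐ[k] B') (b : B) (x : B ⊗[k] V) :
    mapPt V g (b • x) = g b • mapPt V g x := by
  induction x with
  | zero => simp
  | add x y hx hy => simp only [smul_add, map_add, hx, hy]
  | tmul a v => simp [TensorProduct.smul_tmul']

lemma mapPt_baseChange (g : B →ₐ[k] B') (ℓ : V →ₗ[k] W) (x : B ⊗[k] V) :
    mapPt W g (ℓ.baseChange B x) = ℓ.baseChange B' (mapPt V g x) := by
  induction x with
  | zero => simp
  | add x y hx hy => simp only [map_add, hx, hy]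
  | tmul a v => simp

lemma map_bilinForm (g : B →ₐ[k] B') (β : LinearMap.BilinForm k V) (x y : B ⊗[k] V) :
    g (LinearMap.BilinForm.baseChange B β x y) =
      LinearMap.BilinForm.baseChange B' β (mapPt V g x) (mapPt V g y) := by
  induction x with
  | zero => simp
  | add x y hx hy => simp only [map_add, LinearMap.add_apply, hx, hy]
  | tmul a v =>
    induction y with
    | zero => simp
    | add x y hx hy => simp only [map_add, hx, hy]
    | tmul b w => simp [LinearMap.BilinForm.baseChange_tmul]

variable (B) in
/-- The `B`-linear extension of a linear form. -/
def dualExt (ℓ : Module.Dual k V) : B ⊗[k] V →ₗ[B] B :=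
  Module.Dual.baseChange B ℓ

@[simp] lemma dualExt_tmul (ℓ : Module.Dual k V) (b : B) (v : V) :
    dualExt B ℓ (b ⊗ₜ v) = ℓ v • b := by
  simp [dualExt, Algebra.smul_def, mul_comm]

lemma map_dualExt (g : B →ₐ[k] B') (ℓ : Module.Dual k V) (x : B ⊗[k] V) :
    g (dualExt B ℓ x) = dualExt B' ℓ (mapPt V g x) := by
  induction x with
  | zero => simp
  | add x y hx hy => simp only [map_add, hx, hy]
  | tmul a v => simp

lemma dualExt_comp (ℓ : Module.Dual k W) (u : V →ₗ[k] W) (x : B ⊗[k] V) :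
    dualExt B (ℓ ∘ₗ u) x = dualExt B ℓ (u.baseChange B x) := by
  induction x with
  | zero => simp
  | add x y hx hy => simp only [map_add, hx, hy]
  | tmul a v => simp

lemma eq_zero_of_dualExt [Module.Finite k V] {x : B ⊗[k] V}
    (h : ∀ ℓ : Module.Dual k V, dualExt B ℓ x = 0) : x = 0 := by
  have key : ∀ x : B ⊗[k] V, ∀ i, ((Module.finBasis k V).baseChange B).repr x i =
      dualExt B ((Module.finBasis k V).coord i) x := fun x i => by
    induction x with
    | zero => simp
    | add x y hx hy => simp only [map_add, Finsupp.add_apply, hx, hy]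
    | tmul a v => simp
  apply ((Module.finBasis k V).baseChange B).repr.injective
  ext i
  rw [key, h]
  simp

variable [Module.Finite k V]

/-- The value of a polynomial function on `V` at a point of `B ⊗ V`, for a `k`-algebra `B`. -/
def evalIn (x : B ⊗[k] V) : CoordRing k V →ₐ[k] B :=
  aeval fun i => dualExt B ((Module.finBasis k V).coord i) x

lemma evalIn_X (x : B ⊗[k] V) (i) :
    evalIn x (X i) = dualExt B ((Module.finBasis k V).coord i) x := by simp [evalIn]

lemma evalAt_eq_evalIn {K : Type u} [Field K] [Algebra k K] (x : K ⊗[k] V) :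
    evalAt K x = evalIn x := by
  apply algHom_ext
  intro i
  rw [evalIn_X]
  simp only [evalAt, aeval_X]
  induction x with
  | zero => simp
  | add x y hx hy => simp only [map_add, Finsupp.add_apply, hx, hy]
  | tmul a v => simp

lemma evalIn_linForm (x : B ⊗[k] V) (ℓ : Module.Dual k V) :
    evalIn x (linForm ℓ) = dualExt B ℓ x := by
  simp only [linForm, map_sum, map_mul, evalIn_X, algHom_C]
  induction x with
  | zero => simp
  | add x y hx hy => simp only [map_add, mul_add, Finset.sum_add_distrib, hx, hy]
  | tmul a v =>
    have h : ℓ v = ∑ i, (Module.finBasis k V).repr v i * ℓ (Module.finBasis k V i) := by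
      conv_lhs => rw [← (Module.finBasis k V).sum_repr v]
      simp only [map_sum, map_smul, smul_eq_mul]
    simp only [dualExt_tmul, h, Finset.sum_smul, Module.Basis.coord_apply]
    refine Finset.sum_congr rfl fun i _ => ?_
    rw [← Algebra.smul_def, smul_smul, mul_comm]

lemma map_evalIn (g : B →ₐ[k] B') (x : B ⊗[k] V) (f : CoordRing k V) :
    g (evalIn x f) = evalIn (mapPt V g x) f := by
  rw [← AlgHom.comp_apply]
  congr 1
  apply algHom_ext
  intro i
  rw [AlgHom.comp_apply, evalIn_X, evalIn_X, map_dualExt]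

variable (k V) in
/-- The generic point of `V`, with values in the ring of polynomial functions. -/
def genericPt : CoordRing k V ⊗[k] V :=
  ∑ i, X i ⊗ₜ Module.finBasis k V i

lemma evalIn_mapPt_genericPt (g : CoordRing k V →ₐ[k] B) :
    evalIn (mapPt V g (genericPt k V)) = g := by
  apply algHom_ext
  intro i
  simp [evalIn_X, genericPt, Finsupp.single_apply]

lemma mapPt_evalIn_genericPt (x : B ⊗[k] V) : mapPt V (evalIn x) (genericPt k V) = x := by
  induction x with
  | zero => simp [genericPt, evalIn_X]
  | add x y hx hy =>
    conv_rhs => rw [← hx, ← hy]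
    simp only [genericPt, map_sum, mapPt_tmul, evalIn_X, map_add, TensorProduct.add_tmul,
      Finset.sum_add_distrib]
  | tmul a v =>
    simp only [genericPt, map_sum, mapPt_tmul, evalIn_X, dualExt_tmul, TensorProduct.smul_tmul,
      ← TensorProduct.tmul_sum]
    congr 1
    exact (Module.finBasis k V).sum_repr v

lemma evalIn_smul {n : ℕ} {f : CoordRing k V} (hf : f ∈ coordGrading k V n) (b : B)
    (x : B ⊗[k] V) : evalIn (b • x) f = b ^ n * evalIn x f := by
  simp only [evalIn, aeval_def, eval₂_eq, map_smul, smul_eq_mul, Finset.mul_sum, mul_pow,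
    Finset.prod_mul_distrib, Finset.prod_pow_eq_pow_sum]
  refine Finset.sum_congr rfl fun d hd => ?_
  have : ∑ i ∈ d.support, d i = n := (IsHomogeneous.degree_eq_sum_deg_support hf hd).symm
  rw [this]
  ring

/-- The ideal of a cone `S` consists of all polynomials that vanish on `S`. -/
lemma mem_idealOfPoints {S : Set (AlgebraicClosure k ⊗[k] V)}
    (hS : ∀ x ∈ S, ∀ c : AlgebraicClosure k, c • x ∈ S) {f : CoordRing k V} :
    f ∈ (idealOfPoints S).toIdeal ↔ ∀ x ∈ S, evalIn x f = 0 := by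
  constructor
  · intro hf x hx
    have h : (idealOfPoints S).toIdeal ≤ RingHom.ker (evalIn x) := by
      refine Ideal.span_le.mpr fun g hg => ?_
      have := hg.2 x hx
      rwa [evalAt_eq_evalIn] at this
    exact h hf
  · intro hf
    rw [← sum_homogeneousComponent f]
    refine Ideal.sum_mem _ fun n _ => Ideal.subset_span ⟨⟨n, homogeneousComponent_mem n f⟩, ?_⟩
    intro x hx
    rw [evalAt_eq_evalIn]
    -- the values on the line through `x` are those of a polynomial in one variable
    let P : Polynomial (AlgebraicClosure k) := ∑ m ∈ Finset.range (f.totalDegree + 1),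
      Polynomial.monomial m (evalIn x (homogeneousComponent m f))
    have hP : P = 0 := by
      refine Polynomial.funext fun c => ?_
      have h1 := hf _ (hS x hx c)
      rw [← sum_homogeneousComponent f, map_sum] at h1
      rw [Polynomial.eval_zero, ← h1, Polynomial.eval_finsetSum]
      refine Finset.sum_congr rfl fun m _ => ?_
      rw [evalIn_smul (homogeneousComponent_mem m f), Polynomial.eval_monomial, mul_comm]
    by_cases hn : n ≤ f.totalDegree
    · have h2 := congrArg (fun Q => Polynomial.coeff Q n) hP
      simpa [P, Polynomial.finsetSum_coeff, Polynomial.coeff_monomial, hn] using h2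
    · rw [homogeneousComponent_eq_zero _ _ (by omega), map_zero]

/-- Every tuple of elements of `B` is the tuple of coordinates of a point of `B ⊗ V`. -/
lemma exists_point (x : Fin (Module.finrank k V) → B) :
    ∃ y : B ⊗[k] V, ∀ f, evalIn y f = aeval x f := by
  refine ⟨mapPt V (aeval x) (genericPt k V), fun f => ?_⟩
  rw [evalIn_mapPt_genericPt]

lemma evalIn_quadForm (q : QuadraticForm k V) (x : B ⊗[k] V) :
    evalIn x (quadForm q) =
      (2⁻¹ : k) • LinearMap.BilinForm.baseChange B (QuadraticMap.polarBilin q) x x := by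
  have h1 : ∀ y : B ⊗[k] V, ∑ i, ∑ j, QuadraticMap.polar q (Module.finBasis k V i)
      (Module.finBasis k V j) • (dualExt B ((Module.finBasis k V).coord i) x *
        dualExt B ((Module.finBasis k V).coord j) y) =
      LinearMap.BilinForm.baseChange B (QuadraticMap.polarBilin q) x y := fun y => by
    induction x with
    | zero => simp
    | add x x' hx hx' =>
      simp only [map_add, LinearMap.add_apply, add_mul, smul_add, Finset.sum_add_distrib, hx, hx']
    | tmul a v =>
      induction y with
      | zero => simp
      | add y y' hx hx' =>
        simp only [map_add, mul_add, smul_add, Finset.sum_add_distrib, hx, hx']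
      | tmul b w =>
        have h : QuadraticMap.polarBilin q v w = ∑ i, ∑ j, (Module.finBasis k V).repr v i *
            ((Module.finBasis k V).repr w j * QuadraticMap.polar q (Module.finBasis k V i)
              (Module.finBasis k V j)) := by
          conv_lhs => rw [← (Module.finBasis k V).sum_repr v, ← (Module.finBasis k V).sum_repr w]
          simp only [map_sum, LinearMap.sum_apply, map_smul, LinearMap.smul_apply, smul_eq_mul,
            Finset.mul_sum, QuadraticMap.polarBilin_apply_apply]
          rw [Finset.sum_comm]
          refine Finset.sum_congr rfl fun i _ => Finset.sum_congr rfl fun j _ => by ring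
        rw [LinearMap.BilinForm.baseChange_tmul, h]
        simp only [dualExt_tmul, Finset.sum_smul, Module.Basis.coord_apply]
        refine Finset.sum_congr rfl fun i _ => Finset.sum_congr rfl fun j _ => ?_
        simp only [smul_mul_smul_comm, smul_smul]
        congr 1
        ring
  rw [← h1 x, Finset.smul_sum]
  simp only [quadForm, map_sum, map_mul, evalIn_X, algHom_C, Finset.smul_sum]
  refine Finset.sum_congr rfl fun i _ => Finset.sum_congr rfl fun j _ => ?_
  rw [smul_smul, Algebra.smul_def, map_mul]

lemma exists_eq_C_add_linForm {f : CoordRing k V} (hf : f.totalDegree ≤ 1) :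
    ∃ (a : k) (ℓ : Module.Dual k V), f = C a + linForm ℓ := by
  refine ⟨coeff 0 f, (Module.finBasis k V).constr k fun i => coeff (Finsupp.single i 1) f, ?_⟩
  ext m
  have hlin : coeff m (linForm ((Module.finBasis k V).constr k
      fun i => coeff (Finsupp.single i 1) f)) =
      ∑ i, if Finsupp.single i 1 = m then coeff (Finsupp.single i 1) f else 0 := by
    simp [linForm, coeff_sum, coeff_C_mul, coeff_X]
  rw [coeff_add, hlin, coeff_C]
  by_cases h0 : m = 0
  · subst h0
    simp
  · rw [if_neg (Ne.symm h0), zero_add]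
    by_cases h1 : m.degree ≤ 1
    · obtain ⟨i, rfl⟩ : ∃ i, m = Finsupp.single i 1 := by
        have : m.degree = 1 := by
          have := (Finsupp.degree_eq_zero_iff m).not.mpr h0
          omega
        exact (Finsupp.sum_eq_one_iff m).mp this
      rw [Finset.sum_eq_single i]
      · simp
      · intro j _ hj
        rw [if_neg]
        intro h
        exact hj (Finsupp.single_left_injective one_ne_zero h)
      · simp
    · rw [Finset.sum_eq_zero, coeff_eq_zero_of_totalDegree_lt]
      · exact lt_of_le_of_lt hf (by simpa [Finsupp.degree_apply] using h1)
      · intro i _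
        rw [if_neg]
        rintro rfl
        simp at h1

/-! ### Quadratic forms as polynomials -/

section Quadric

variable [CharZero k] {q : QuadraticForm k V}

lemma aeval_quadForm (v : V) : evalIn ((1 : k) ⊗ₜ[k] v) (quadForm q) = q v := by
  rw [evalIn_quadForm]
  simp only [LinearMap.BilinForm.baseChange_tmul, QuadraticMap.polarBilin_apply_apply,
    QuadraticMap.polar_self]
  simp

/-- If a quadratic form is a product of two polynomials of degree at most one, it is the product of
their linear parts. -/
lemma eq_mul_of_quadForm_eq {a b : k} {ℓ m : Module.Dual k V}
    (h : quadForm q = (C a + linForm ℓ) * (C b + linForm m)) (v : V) : q v = ℓ v * m v := by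
  have key : ∀ v, q v = (a + ℓ v) * (b + m v) := fun v => by
    rw [← aeval_quadForm, h]
    simp [evalIn_linForm]
  have h0 := key 0
  have h2 := key (-v)
  rw [QuadraticMap.map_neg] at h2
  simp only [map_zero, map_neg] at h0 h2
  have := key v
  refine mul_left_cancel₀ (two_ne_zero (α := k)) ?_
  linear_combination this + h2 - 2 * h0

lemma eq_zero_of_eq_mul (hq : (QuadraticMap.polarBilin q).Nondegenerate)
    {ℓ m : Module.Dual k V} (h : ∀ v, q v = ℓ v * m v) {v : V} (h1 : ℓ v = 0) (h2 : m v = 0) :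
    v = 0 := hq.1 v fun w => by
  simp only [QuadraticMap.polarBilin_apply_apply, QuadraticMap.polar, h, map_add, h1, h2]
  ring

lemma isUnit_of_totalDegree_eq_zero {f : CoordRing k V} (hf : f ≠ 0) (hf' : f.totalDegree = 0) :
    IsUnit f := by
  obtain ⟨c, rfl⟩ : ∃ c, f = C c := ⟨_, totalDegree_eq_zero_iff_eq_C.mp hf'⟩
  exact (isUnit_iff_ne_zero.mpr fun h0 => hf (by rw [h0, map_zero])).map C

lemma quadForm_ne_zero [Nontrivial V] (hq : (QuadraticMap.polarBilin q).Nondegenerate) :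
    quadForm q ≠ 0 := by
  intro h
  obtain ⟨v, hv⟩ := exists_ne (0 : V)
  refine hv (hq.1 v fun w => ?_)
  have h0 : ∀ v, q v = 0 := fun v => by rw [← aeval_quadForm, h, map_zero]
  simp [QuadraticMap.polar, h0]

lemma isPrime_span_quadForm (hq : (QuadraticMap.polarBilin q).Nondegenerate)
    (hV : 3 ≤ Module.finrank k V) : (Ideal.span {quadForm q}).IsPrime := by
  have : Nontrivial V := Module.nontrivial_of_finrank_pos (R := k) (by omega)
  have hne := quadForm_ne_zero hq
  rw [Ideal.span_singleton_prime hne, ← irreducible_iff_prime]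
  have hdeg : (quadForm q).totalDegree = 2 := IsHomogeneous.totalDegree (quadForm_mem q) hne
  refine ⟨fun h => ?_, fun f g h => ?_⟩
  · have := (MvPolynomial.isUnit_iff_totalDegree_of_isReduced.mp h).2
    omega
  · have hf0 : f ≠ 0 := by rintro rfl; simp [h] at hne
    have hg0 : g ≠ 0 := by rintro rfl; simp [h] at hne
    have hsum := totalDegree_mul_of_isDomain hf0 hg0
    rw [← h, hdeg] at hsum
    by_cases hf1 : f.totalDegree = 0
    · exact Or.inl (isUnit_of_totalDegree_eq_zero hf0 hf1)
    by_cases hg1 : g.totalDegree = 0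
    · exact Or.inr (isUnit_of_totalDegree_eq_zero hg0 hg1)
    exfalso
    obtain ⟨a, ℓ, rfl⟩ := exists_eq_C_add_linForm (f := f) (by omega)
    obtain ⟨b, m, rfl⟩ := exists_eq_C_add_linForm (f := g) (by omega)
    have hinj : Function.Injective (ℓ.prod m) := (injective_iff_map_eq_zero _).mpr fun v hv =>
      eq_zero_of_eq_mul hq (eq_mul_of_quadForm_eq h) (congrArg Prod.fst hv) (congrArg Prod.snd hv)
    have := LinearMap.finrank_le_finrank_of_injective hinj
    rw [Module.finrank_prod, Module.finrank_self] at this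
    omega

lemma isRadical_span_quadForm (hq : (QuadraticMap.polarBilin q).Nondegenerate)
    (hV : 2 ≤ Module.finrank k V) : (Ideal.span {quadForm q}).IsRadical := by
  have : Nontrivial V := Module.nontrivial_of_finrank_pos (R := k) (by omega)
  have hne := quadForm_ne_zero hq
  rw [← isRadical_iff_span_singleton, isRadical_iff_squarefree_of_ne_zero hne]
  have hdeg : (quadForm q).totalDegree = 2 := IsHomogeneous.totalDegree (quadForm_mem q) hne
  rintro f ⟨g, h⟩
  have hf0 : f ≠ 0 := by rintro rfl; simp [h] at hne
  have hg0 : g ≠ 0 := by rintro rfl; simp [h] at hne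
  have hsum := totalDegree_mul_of_isDomain (mul_ne_zero hf0 hf0) hg0
  rw [← h, hdeg, totalDegree_mul_of_isDomain hf0 hf0] at hsum
  by_cases hf1 : f.totalDegree = 0
  · exact isUnit_of_totalDegree_eq_zero hf0 hf1
  exfalso
  obtain ⟨c, rfl⟩ : ∃ c, g = C c := ⟨_, totalDegree_eq_zero_iff_eq_C.mp (by omega)⟩
  obtain ⟨a, ℓ, rfl⟩ := exists_eq_C_add_linForm (f := f) (by omega)
  have h' : quadForm q = (C a + linForm ℓ) * (C (c * a) + linForm (c • ℓ)) := by
    rw [h, (linFormₗ k V).map_smul c ℓ |>.trans (MvPolynomial.smul_eq_C_mul _ _) |> (show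
      linForm (c • ℓ) = _ from ·), C_mul]
    change _ = _ * (_ + C c * linForm ℓ)
    ring
  have hinj : Function.Injective ℓ := (injective_iff_map_eq_zero _).mpr fun v hv =>
    eq_zero_of_eq_mul hq (eq_mul_of_quadForm_eq h') hv (by simp [hv])
  have := LinearMap.finrank_le_finrank_of_injective hinj
  rw [Module.finrank_self] at this
  omega

end Quadric

/-! ### Vanishing of polynomials and pullback along linear maps -/

/-- Nullstellensatz for a radical principal ideal. -/
lemma mem_span_of_vanishing {p f : CoordRing k V} (hp : (Ideal.span {p}).IsRadical)
    (h : ∀ x : AlgebraicClosure k ⊗[k] V, evalIn x p = 0 → evalIn x f = 0) :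
    f ∈ Ideal.span {p} := by
  rw [← hp.radical, ← MvPolynomial.vanishingIdeal_zeroLocus_eq_radical (K := AlgebraicClosure k)]
  rw [mem_vanishingIdeal_iff]
  intro x hx
  obtain ⟨y, hy⟩ := exists_point (V := V) x
  rw [← hy]
  apply h
  rw [hy]
  exact (mem_zeroLocus_iff.mp hx) _ (Ideal.mem_span_singleton_self p)

section Pullback

variable [Module.Finite k W]

/-- Composition of polynomial functions with a linear map `u`. -/
def pullback (u : W →ₗ[k] V) : CoordRing k V →ₐ[k] CoordRing k W :=
  evalIn (u.baseChange _ (genericPt k W))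

lemma evalIn_pullback (u : W →ₗ[k] V) (x : B ⊗[k] W) (f : CoordRing k V) :
    evalIn x (pullback u f) = evalIn (u.baseChange B x) f := by
  rw [pullback, map_evalIn, mapPt_baseChange, mapPt_evalIn_genericPt]

lemma evalIn_genericPt (f : CoordRing k V) : evalIn (genericPt k V) f = f := by
  have := evalIn_mapPt_genericPt (AlgHom.id k (CoordRing k V))
  have h : mapPt V (AlgHom.id k (CoordRing k V)) (genericPt k V) = genericPt k V := by
    simp [mapPt]
  rw [h] at this
  rw [this]
  rfl

lemma pullback_linForm (u : W →ₗ[k] V) (ℓ : Module.Dual k V) :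
    pullback u (linForm ℓ) = linForm (ℓ ∘ₗ u) := by
  rw [pullback, evalIn_linForm, ← dualExt_comp, ← evalIn_linForm, evalIn_genericPt]

lemma pullback_pullback [Module.Finite k U] (u : W →ₗ[k] V) (s : V →ₗ[k] U) (f : CoordRing k U) :
    pullback u (pullback s f) = pullback (s ∘ₗ u) f := by
  rw [pullback, evalIn_pullback, pullback, LinearMap.baseChange_comp, LinearMap.comp_apply]

lemma pullback_id (f : CoordRing k V) : pullback LinearMap.id f = f := by
  rw [pullback, LinearMap.baseChange_id, LinearMap.id_apply, evalIn_genericPt]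

lemma pullback_mem (u : W →ₗ[k] V) {n : ℕ} {f : CoordRing k V} (hf : f ∈ coordGrading k V n) :
    pullback u f ∈ coordGrading k W n := by
  have h := IsHomogeneous.aeval (n := 1) hf (fun i => pullback u (X i)) fun i => by
    rw [← linForm_finBasis_coord, pullback_linForm]
    exact linForm_mem _
  rw [one_mul] at h
  have h2 : aeval (fun i => pullback u (X i)) = pullback u := by
    apply algHom_ext; intro i; simp
  rwa [h2] at h

/-- Modulo an ideal containing the linear forms that vanish on the image of an idempotent `e`,
every polynomial agrees with its composition with `e`. -/
lemma sub_pullback_mem (e : V →ₗ[k] V) (P : Ideal (CoordRing k V))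
    (hP : ∀ ℓ : Module.Dual k V, linForm (ℓ - ℓ ∘ₗ e) ∈ P) (f : CoordRing k V) :
    f - pullback e f ∈ P := by
  rw [← Ideal.Quotient.mk_eq_mk_iff_sub_mem]
  have h : (Ideal.Quotient.mkₐ k P) = (Ideal.Quotient.mkₐ k P).comp (pullback e) := by
    apply algHom_ext
    intro i
    rw [AlgHom.comp_apply, ← linForm_finBasis_coord, pullback_linForm]
    refine (Ideal.Quotient.mk_eq_mk_iff_sub_mem _ _).mpr ?_
    have := hP ((Module.finBasis k V).coord i)
    rwa [show linForm ((Module.finBasis k V).coord i - (Module.finBasis k V).coord i ∘ₗ e) =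
      linForm ((Module.finBasis k V).coord i) - linForm ((Module.finBasis k V).coord i ∘ₗ e) from
      map_sub (linFormₗ k V) _ _] at this
  exact DFunLike.congr_fun h f

end Pullback

end Points

/-! ### Composition algebras -/

section CompositionAlgebra

variable {k : Type u} [Field k] {C : Type v} [NonAssocRing C] [Module k C]

lemma conj_apply (φ : QuadraticForm k C) (x : C) :
    conj φ x = QuadraticMap.polar φ x 1 • (1 : C) - x := rfl

lemma associator_eq_zero_of_span [IsScalarTower k C C] [SMulCommClass k C C] {S : Set C}
    (hS : Submodule.span k S = ⊤) (h0 : ∀ x ∈ S, ∀ y ∈ S, ∀ z ∈ S, associator x y z = 0)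
    (x y z : C) : associator x y z = 0 := by
  have mem : ∀ x : C, x ∈ Submodule.span k S := fun x => hS ▸ Submodule.mem_top
  have h1 : ∀ x ∈ S, ∀ y ∈ S, ∀ z, associator x y z = 0 := fun x hx y hy z => by
    induction mem z using Submodule.span_induction with
    | mem z hz => exact h0 x hx y hy z hz
    | zero => simp [associator]
    | add a b _ _ ha hb =>
      simp only [associator, mul_add] at ha hb ⊢
      linear_combination (norm := module) ha + hb
    | smul c a _ ha =>
      simp only [associator, mul_smul_comm] at ha ⊢
      rw [← smul_sub, ha, smul_zero]
  have h2 : ∀ x ∈ S, ∀ y z, associator x y z = 0 := fun x hx y z => by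
    induction mem y using Submodule.span_induction with
    | mem y hy => exact h1 x hx y hy z
    | zero => simp [associator]
    | add a b _ _ ha hb =>
      simp only [associator, mul_add, add_mul] at ha hb ⊢
      linear_combination (norm := module) ha + hb
    | smul c a _ ha =>
      simp only [associator, mul_smul_comm, smul_mul_assoc] at ha ⊢
      rw [← smul_sub, ha, smul_zero]
  induction mem x using Submodule.span_induction with
  | mem x hx => exact h2 x hx y z
  | zero => simp [associator]
  | add a b _ _ ha hb =>
    simp only [associator, add_mul] at ha hb ⊢
    linear_combination (norm := module) ha + hb
  | smul c a _ ha =>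
    simp only [associator, smul_mul_assoc] at ha ⊢
    rw [← smul_sub, ha, smul_zero]

lemma span_eq_top_of_orthogonal [CharZero k] [Module.Finite k C] {φ : QuadraticForm k C}
    {n : ℕ} (e : Fin n → C) (hn : n = Module.finrank k C)
    (he : Pairwise fun i j => QuadraticMap.polar φ (e i) (e j) = 0) (he' : ∀ i, φ (e i) ≠ 0) :
    Submodule.span k (Set.range e) = ⊤ := by
  refine LinearIndependent.span_eq_top_of_card_eq_finrank' ?_ (by simpa using hn)
  refine LinearMap.linearIndependent_of_isOrthoᵢ (B := QuadraticMap.polarBilin φ)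
    (fun i j hij => he hij) fun i hi => ?_
  have : (2 : k) * φ (e i) = 0 := by simpa [QuadraticMap.polar_self] using hi
  simp [he' i] at this

namespace IsCompositionAlgebra

variable {φ : QuadraticForm k C} (h : IsCompositionAlgebra φ)

include h

lemma ext {x y : C} (hxy : ∀ z, QuadraticMap.polar φ x z = QuadraticMap.polar φ y z) : x = y := by
  rw [← sub_eq_zero]
  refine h.nondegenerate.1 _ fun z => ?_
  rw [map_sub, LinearMap.sub_apply, sub_eq_zero]
  exact hxy z

lemma polar_mul_left_left (x y z : C) :
    QuadraticMap.polar φ (x * y) (x * z) = φ x * QuadraticMap.polar φ y z := by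
  simp only [QuadraticMap.polar, ← mul_add, h.map_mul]
  ring

lemma polar_mul_right_right (x y z : C) :
    QuadraticMap.polar φ (x * z) (y * z) = QuadraticMap.polar φ x y * φ z := by
  simp only [QuadraticMap.polar, ← add_mul, h.map_mul]
  ring

lemma polar_mul_add (x y z w : C) :
    QuadraticMap.polar φ (x * y) (z * w) + QuadraticMap.polar φ (x * w) (z * y) =
      QuadraticMap.polar φ x z * QuadraticMap.polar φ y w := by
  have h1 := h.polar_mul_right_right x z (y + w)
  have h2 := h.polar_mul_right_right x z y
  have h3 := h.polar_mul_right_right x z w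
  rw [mul_add, mul_add, QuadraticMap.polar_add_left, QuadraticMap.polar_add_right,
    QuadraticMap.polar_add_right, h2, h3] at h1
  have h4 : φ (y + w) = QuadraticMap.polar φ y w + φ y + φ w := by
    simp only [QuadraticMap.polar]; ring
  rw [h4] at h1
  linear_combination h1

variable [IsScalarTower k C C] [SMulCommClass k C C]

lemma polar_mul_left (x y z : C) :
    QuadraticMap.polar φ (x * y) z = QuadraticMap.polar φ y (conj φ x * z) := by
  have := h.polar_mul_add x y 1 z
  rw [one_mul, one_mul, QuadraticMap.polar_comm φ (x * z)] at this
  rw [conj_apply, sub_mul, smul_mul_assoc, one_mul, QuadraticMap.polar_sub_right,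
    QuadraticMap.polar_smul_right, smul_eq_mul]
  linear_combination this

lemma polar_mul_right (x y z : C) :
    QuadraticMap.polar φ (x * y) z = QuadraticMap.polar φ x (z * conj φ y) := by
  have := h.polar_mul_add x y z 1
  rw [mul_one, mul_one] at this
  rw [conj_apply, mul_sub, mul_smul_comm, mul_one, QuadraticMap.polar_sub_right,
    QuadraticMap.polar_smul_right, smul_eq_mul]
  linear_combination this

lemma conj_mul_mul (x y : C) : conj φ x * (x * y) = φ x • y := h.ext fun z => by
  rw [QuadraticMap.polar_comm, ← h.polar_mul_left, h.polar_mul_left_left,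
    QuadraticMap.polar_smul_left, smul_eq_mul, QuadraticMap.polar_comm φ z]

lemma mul_mul_conj (x y : C) : (y * x) * conj φ x = φ x • y := h.ext fun z => by
  rw [QuadraticMap.polar_comm, ← h.polar_mul_right, h.polar_mul_right_right,
    QuadraticMap.polar_smul_left, smul_eq_mul, QuadraticMap.polar_comm φ z, mul_comm]

variable [CharZero k] [Nontrivial C]

lemma polar_one_one : QuadraticMap.polar φ 1 1 = 2 := by
  rw [QuadraticMap.polar_self, h.map_one]
  norm_num

lemma conj_one : conj φ 1 = 1 := by
  rw [conj_apply, h.polar_one_one, two_smul, add_sub_cancel_right]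

lemma conj_conj (x : C) : conj φ (conj φ x) = x := by
  conv_lhs => rw [conj_apply φ x]
  rw [map_sub, map_smul, h.conj_one, conj_apply, sub_sub_cancel]

lemma map_conj (x : C) : φ (conj φ x) = φ x := by
  have h1 : φ (conj φ x) = φ (QuadraticMap.polar φ x 1 • (1 : C)) + φ (-x) +
      QuadraticMap.polar φ (QuadraticMap.polar φ x 1 • (1 : C)) (-x) := by
    rw [conj_apply, sub_eq_add_neg, QuadraticMap.map_add φ]
  rw [h1, QuadraticMap.map_smul, h.map_one, QuadraticMap.map_neg, QuadraticMap.polar_smul_left,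
    QuadraticMap.polar_neg_right, QuadraticMap.polar_comm φ 1 x]
  simp only [smul_eq_mul]
  ring

lemma mul_conj_mul (x y : C) : x * (conj φ x * y) = φ x • y := by
  have := h.conj_mul_mul (conj φ x) y
  rwa [h.conj_conj, h.map_conj] at this

lemma conj_mul (x y : C) : conj φ (x * y) = conj φ y * conj φ x := h.ext fun z => by
  have h1 : QuadraticMap.polar φ (conj φ (x * y)) z = QuadraticMap.polar φ 1 ((x * y) * z) := by
    have := h.polar_mul_left (conj φ (x * y)) 1 z
    rwa [mul_one, h.conj_conj] at this
  rw [h1, QuadraticMap.polar_comm, h.polar_mul_right, one_mul, h.polar_mul_left, h.polar_mul_left,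
    h.conj_conj, QuadraticMap.polar_comm, h.polar_mul_right, h.conj_conj]

lemma mul_conj (x : C) : x * conj φ x = φ x • 1 := by
  simpa using h.mul_conj_mul x 1

lemma conj_mul_self (x : C) : conj φ x * x = φ x • 1 := by
  simpa using h.conj_mul_mul x 1

lemma mul_conj_mul_add (x y z : C) :
    x * (conj φ y * z) + y * (conj φ x * z) = QuadraticMap.polar φ x y • z := by
  have h1 := h.mul_conj_mul (x + y) z
  simp only [map_add, add_mul, mul_add, h.mul_conj_mul, QuadraticMap.map_add φ] at h1
  linear_combination (norm := module) h1

lemma mul_mul_conj_add (x y z : C) :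
    (z * x) * conj φ y + (z * y) * conj φ x = QuadraticMap.polar φ x y • z := by
  have h1 := h.mul_mul_conj (x + y) z
  simp only [map_add, add_mul, mul_add, h.mul_mul_conj, QuadraticMap.map_add φ] at h1
  linear_combination (norm := module) h1

lemma mul_self_mul (x y : C) : (x * x) * y = x * (x * y) := by
  have h1 := h.conj_mul_mul x y
  have h2 := congrArg (· * y) (h.conj_mul_self x)
  simp only [conj_apply, sub_mul, smul_mul_assoc, one_mul] at h1 h2
  linear_combination (norm := module) h1 - h2

lemma mul_mul_self (x y : C) : (y * x) * x = y * (x * x) := by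
  have h1 := h.mul_mul_conj x y
  have h2 := congrArg (y * ·) (h.mul_conj x)
  simp only [conj_apply, mul_sub, mul_smul_comm, mul_one] at h1 h2
  linear_combination (norm := module) h2 - h1

lemma associator_swap_left (x y z : C) :
    associator y x z = -associator x y z := by
  have h1 := h.mul_self_mul (x + y) z
  have h2 := h.mul_self_mul x z
  have h3 := h.mul_self_mul y z
  simp only [add_mul, mul_add] at h1
  simp only [associator]
  linear_combination (norm := module) h1 - h2 - h3

lemma associator_swap_right (x y z : C) :
    associator x z y = -associator x y z := by
  have h1 := h.mul_mul_self (y + z) x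
  have h2 := h.mul_mul_self y x
  have h3 := h.mul_mul_self z x
  simp only [add_mul, mul_add] at h1
  simp only [associator]
  linear_combination (norm := module) h1 - h2 - h3

lemma exists_anisotropic_orthogonal {n : ℕ} (e : Fin n → C)
    (hn : n < Module.finrank k C)
    (he : Pairwise fun i j => QuadraticMap.polar φ (e i) (e j) = 0) (he' : ∀ i, φ (e i) ≠ 0) :
    ∃ v, (∀ i, QuadraticMap.polar φ (e i) v = 0) ∧ φ v ≠ 0 := by
  have : Module.Finite k C := Module.finite_of_finrank_pos (by omega)
  let L : C →ₗ[k] (Fin n → k) := LinearMap.pi fun i => QuadraticMap.polarBilin φ (e i)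
  obtain ⟨p, hp, hp0⟩ : ∃ p ∈ LinearMap.ker L, p ≠ 0 := by
    refine (Submodule.ne_bot_iff _).mp (LinearMap.ker_ne_bot_of_finrank_lt ?_)
    simpa using hn
  have hL : ∀ v, v ∈ LinearMap.ker L ↔ ∀ i, QuadraticMap.polar φ (e i) v = 0 := fun v => by
    rw [LinearMap.mem_ker, funext_iff]; rfl
  by_contra! hcon
  refine hp0 (h.nondegenerate.1 p fun z => ?_)
  -- the component of `z` orthogonal to all `e i`
  set z' := z - ∑ i, (QuadraticMap.polar φ (e i) z / (2 * φ (e i))) • e i with hz'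
  have hz : z' ∈ LinearMap.ker L := (hL _).mpr fun i => by
    change QuadraticMap.polarBilin φ (e i) z' = 0
    rw [hz', map_sub, map_sum, Finset.sum_eq_single i]
    · simp only [map_smul, QuadraticMap.polarBilin_apply_apply, QuadraticMap.polar_self,
        smul_eq_mul, nsmul_eq_mul]
      have := he' i
      field_simp
      simp
    · intro j _ hj
      rw [map_smul, QuadraticMap.polarBilin_apply_apply, he hj.symm, smul_zero]
    · simp
  have h0 : QuadraticMap.polar φ p z' = 0 := by
    rw [QuadraticMap.polar, hcon _ ((hL _).mp hz), hcon _ ((hL _).mp hp),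
      hcon _ ((hL _).mp (add_mem hp hz))]
    simp
  have hdec : z = z' + ∑ i, (QuadraticMap.polar φ (e i) z / (2 * φ (e i))) • e i := by
    rw [hz', sub_add_cancel]
  rw [hdec, map_add, map_sum, QuadraticMap.polarBilin_apply_apply, h0, zero_add]
  refine Finset.sum_eq_zero fun i _ => ?_
  rw [map_smul, QuadraticMap.polarBilin_apply_apply, QuadraticMap.polar_comm φ p, (hL p).mp hp i,
    smul_zero]

/-- A composition algebra of dimension at most four is associative: the associator is alternating
and vanishes on the orthogonal basis `1, u, v, u v`. -/
lemma mul_assoc_of_finrank {r : ℕ} (hr : r ≤ 2) (hC : Module.finrank k C = 2 ^ r) (x y z : C) :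
    (x * y) * z = x * (y * z) := by
  rw [← sub_eq_zero]
  change associator x y z = 0
  have : Module.Finite k C := Module.finite_of_finrank_pos (by rw [hC]; positivity)
  have hone : φ 1 ≠ 0 := by rw [h.map_one]; exact one_ne_zero
  have hl : ∀ x y : C, associator x x y = 0 := fun x y => sub_eq_zero.mpr (h.mul_self_mul x y)
  have hr' : ∀ x y : C, associator x y y = 0 := fun x y => sub_eq_zero.mpr (h.mul_mul_self y x)
  have hm : ∀ x y : C, associator x y x = 0 := fun x y => by
    rw [h.associator_swap_right, hl, neg_zero]
  have h1 : ∀ x y : C, associator 1 x y = 0 := fun x y => by simp [associator]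
  have h2 : ∀ x y : C, associator x 1 y = 0 := fun x y => by simp [associator]
  have h3 : ∀ x y : C, associator x y 1 = 0 := fun x y => by simp [associator]
  interval_cases r
  · have hs := span_eq_top_of_orthogonal (φ := φ) (k := k) ![(1 : C)] (by rw [hC]; rfl)
      (fun i j hij => absurd (Subsingleton.elim i j) hij) (by simpa using hone)
    refine associator_eq_zero_of_span hs ?_ x y z
    simp [h1]
  · obtain ⟨u, hu, hu0⟩ := h.exists_anisotropic_orthogonal ![(1 : C)] (by rw [hC]; norm_num)
      (fun i j hij => absurd (Subsingleton.elim i j) hij) (by simpa using hone)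
    replace hu : QuadraticMap.polar φ 1 u = 0 := hu 0
    have hs := span_eq_top_of_orthogonal (φ := φ) (k := k) ![1, u] (by rw [hC]; rfl)
      (by
        intro i j hij
        fin_cases i <;> fin_cases j <;> simp_all [QuadraticMap.polar_comm φ u])
      (by simp [Fin.forall_fin_two, hone, hu0])
    refine associator_eq_zero_of_span hs ?_ x y z
    simp [h1, h2, h3, hl]
  · obtain ⟨u, hu, hu0⟩ := h.exists_anisotropic_orthogonal ![(1 : C)] (by rw [hC]; norm_num)
      (fun i j hij => absurd (Subsingleton.elim i j) hij) (by simpa using hone)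
    replace hu : QuadraticMap.polar φ 1 u = 0 := hu 0
    obtain ⟨v, hv, hv0⟩ := h.exists_anisotropic_orthogonal ![1, u] (by rw [hC]; norm_num)
      (by
        intro i j hij
        fin_cases i <;> fin_cases j <;> simp_all [QuadraticMap.polar_comm φ u])
      (by simp [Fin.forall_fin_two, hone, hu0])
    have huv : QuadraticMap.polar φ u v = 0 := hv 1
    replace hv : QuadraticMap.polar φ 1 v = 0 := hv 0
    have cu : conj φ u = -u := by rw [conj_apply, QuadraticMap.polar_comm, hu, zero_smul, zero_sub]
    have cv : conj φ v = -v := by rw [conj_apply, QuadraticMap.polar_comm, hv, zero_smul, zero_sub]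
    have hw : QuadraticMap.polar φ 1 (u * v) = 0 := by
      rw [QuadraticMap.polar_comm, h.polar_mul_left, cu, mul_one, QuadraticMap.polar_neg_right,
        QuadraticMap.polar_comm, huv, neg_zero]
    have huw : QuadraticMap.polar φ u (u * v) = 0 := by
      have := h.polar_mul_left_left u 1 v
      rwa [mul_one, hv, mul_zero] at this
    have hvw : QuadraticMap.polar φ v (u * v) = 0 := by
      have := h.polar_mul_right_right 1 u v
      rwa [one_mul, hu, zero_mul] at this
    have hw0 : φ (u * v) ≠ 0 := by rw [h.map_mul]; exact mul_ne_zero hu0 hv0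
    have cw : conj φ (u * v) = -(u * v) := by
      rw [conj_apply, QuadraticMap.polar_comm, hw, zero_smul, zero_sub]
    have hs := span_eq_top_of_orthogonal (φ := φ) (k := k) ![1, u, v, u * v] (by rw [hC]; rfl)
      (by
        intro i j hij
        wlog hlt : i < j generalizing i j
        · rw [QuadraticMap.polar_comm]
          exact this hij.symm (lt_of_le_of_ne (not_lt.mp hlt) hij.symm)
        fin_cases i <;> fin_cases j <;>
          first | exact absurd hlt (by decide) | exact hu | exact hv | exact hw | exact huv |
            exact huw | exact hvw)
      (by
        intro i
        fin_cases i <;> simp [hone, hu0, hv0, h.map_mul])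
    have hvu : u * v = -(v * u) := by
      have := h.conj_mul u v
      rw [cw, cu, cv, neg_mul_neg] at this
      rw [← this, neg_neg]
    have key : associator u v (u * v) = 0 := by
      have e1 : (u * v) * (u * v) = -(φ (u * v) • 1) := by
        rw [← h.mul_conj, cw, mul_neg, neg_neg]
      have e2 : v * (u * v) = φ v • u := by
        rw [hvu, mul_neg, ← neg_mul, ← cv, h.conj_mul_mul]
      have e3 : u * u = -(φ u • 1) := by
        rw [← h.mul_conj, cu, mul_neg, neg_neg]
      rw [associator, e1, e2, mul_smul_comm, e3, h.map_mul]
      module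
    have key' : associator (u * v) u v = 0 := by
      rw [h.associator_swap_left, h.associator_swap_right, key]; simp
    have key2 : associator v (u * v) u = 0 := by
      rw [h.associator_swap_left (u * v) v u, h.associator_swap_right, key']; simp
    refine associator_eq_zero_of_span hs ?_ x y z
    simp [h1, h2, h3, hl, hr', hm, key, key', key2, h.associator_swap_left u v,
      h.associator_swap_right u v, h.associator_swap_right (u * v) u v]

end IsCompositionAlgebra

/-! ### Composition algebras after extension of scalars -/

section BaseChange

variable [IsScalarTower k C C] [SMulCommClass k C C] (φ : QuadraticForm k C)
  {B : Type*} [CommRing B] [Algebra k B] {B' : Type*} [CommRing B'] [Algebra k B']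

lemma mapPt_mul (g : B →ₐ[k] B') (x y : B ⊗[k] C) :
    mapPt C g (x * y) = mapPt C g x * mapPt C g y := by
  induction x with
  | zero => simp
  | add x x' hx hx' => simp only [map_add, add_mul, hx, hx']
  | tmul a v =>
    induction y with
    | zero => simp
    | add y y' hy hy' => simp only [map_add, mul_add, hy, hy']
    | tmul b w => simp [Algebra.TensorProduct.tmul_mul_tmul]

/-- The conjugation of `B ⊗ C`. -/
def conjIn : B ⊗[k] C →ₗ[B] B ⊗[k] C := (conj φ).baseChange B

/-- The polar form of the norm form of `B ⊗ C`. -/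
def polarIn : LinearMap.BilinForm B (B ⊗[k] C) :=
  LinearMap.BilinForm.baseChange B (QuadraticMap.polarBilin φ)

/-- The norm form of `B ⊗ C`. -/
def normIn (x : B ⊗[k] C) : B := (2⁻¹ : k) • polarIn φ x x

@[simp] lemma conjIn_tmul (b : B) (x : C) : conjIn φ (b ⊗ₜ[k] x) = b ⊗ₜ conj φ x := rfl

@[simp] lemma polarIn_tmul (b b' : B) (x y : C) :
    polarIn φ (b ⊗ₜ[k] x) (b' ⊗ₜ y) = QuadraticMap.polar φ x y • (b * b') := by
  simp [polarIn]

lemma mapPt_conjIn (g : B →ₐ[k] B') (x : B ⊗[k] C) :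
    mapPt C g (conjIn φ x) = conjIn φ (mapPt C g x) := mapPt_baseChange _ _ _

lemma map_polarIn (g : B →ₐ[k] B') (x y : B ⊗[k] C) :
    g (polarIn φ x y) = polarIn φ (mapPt C g x) (mapPt C g y) := map_bilinForm _ _ _ _

lemma mapPt_one (g : B →ₐ[k] B') : mapPt C g 1 = 1 := by
  simp [Algebra.TensorProduct.one_def]

variable {φ}

namespace IsCompositionAlgebra

variable (h : IsCompositionAlgebra φ)

lemma conjIn_eq (x : B ⊗[k] C) : conjIn φ x = polarIn φ x 1 • 1 - x := by
  induction x with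
  | zero => simp
  | add x x' hx hx' => simp only [map_add, LinearMap.add_apply, hx, hx', add_smul]; abel
  | tmul a v =>
    simp [Algebra.TensorProduct.one_def, conj_apply, TensorProduct.tmul_sub,
      TensorProduct.smul_tmul']

include h

lemma mul_conjIn_mul_add [CharZero k] [Nontrivial C] (x y z : B ⊗[k] C) :
    x * (conjIn φ y * z) + y * (conjIn φ x * z) = polarIn φ x y • z := by
  induction x with
  | zero => simp
  | add x x' hx hx' =>
    simp only [map_add, LinearMap.add_apply, add_smul, add_mul, mul_add, ← hx, ← hx']; abel
  | tmul a u =>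
    induction y with
    | zero => simp
    | add x x' hx hx' =>
      simp only [map_add, add_smul, add_mul, mul_add, ← hx, ← hx']; abel
    | tmul b v =>
      induction z with
      | zero => simp
      | add x x' hx hx' => simp only [smul_add, mul_add, ← hx, ← hx']; abel
      | tmul c w =>
        simp only [conjIn_tmul, Algebra.TensorProduct.tmul_mul_tmul, polarIn_tmul,
          TensorProduct.smul_tmul', smul_eq_mul, smul_mul_assoc]
        rw [show b * (a * c) = a * (b * c) by ring, ← TensorProduct.tmul_add, h.mul_conj_mul_add,
          TensorProduct.tmul_smul, TensorProduct.smul_tmul', mul_assoc]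

lemma mul_mul_conjIn_add [CharZero k] [Nontrivial C] (x y z : B ⊗[k] C) :
    (z * x) * conjIn φ y + (z * y) * conjIn φ x = polarIn φ x y • z := by
  induction x with
  | zero => simp
  | add x x' hx hx' =>
    simp only [map_add, LinearMap.add_apply, add_smul, add_mul, mul_add, ← hx, ← hx']; abel
  | tmul a u =>
    induction y with
    | zero => simp
    | add x x' hx hx' =>
      simp only [map_add, add_smul, add_mul, mul_add, ← hx, ← hx']; abel
    | tmul b v =>
      induction z with
      | zero => simp
      | add x x' hx hx' => simp only [smul_add, add_mul, ← hx, ← hx']; abel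
      | tmul c w =>
        simp only [conjIn_tmul, Algebra.TensorProduct.tmul_mul_tmul, polarIn_tmul,
          TensorProduct.smul_tmul', smul_eq_mul, smul_mul_assoc]
        rw [show c * b * a = c * a * b by ring, ← TensorProduct.tmul_add, h.mul_mul_conj_add,
          TensorProduct.tmul_smul, TensorProduct.smul_tmul', show c * a * b = a * b * c by ring]

lemma conjIn_conjIn [CharZero k] [Nontrivial C] (x : B ⊗[k] C) : conjIn φ (conjIn φ x) = x := by
  induction x with
  | zero => simp
  | add x x' hx hx' => simp only [map_add, hx, hx']
  | tmul a v => simp [h.conj_conj]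

lemma conjIn_one [CharZero k] [Nontrivial C] : conjIn φ (1 : B ⊗[k] C) = 1 := by
  simp [Algebra.TensorProduct.one_def, h.conj_one]

lemma conjIn_mul [CharZero k] [Nontrivial C] (x y : B ⊗[k] C) :
    conjIn φ (x * y) = conjIn φ y * conjIn φ x := by
  induction x with
  | zero => simp
  | add x x' hx hx' => simp only [map_add, add_mul, mul_add, hx, hx']
  | tmul a v =>
    induction y with
    | zero => simp
    | add y y' hy hy' => simp only [map_add, add_mul, mul_add, hy, hy']
    | tmul b w => simp [Algebra.TensorProduct.tmul_mul_tmul, h.conj_mul, mul_comm a b]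

lemma polarIn_conjIn_conjIn [CharZero k] [Nontrivial C] (x y : B ⊗[k] C) :
    polarIn φ (conjIn φ x) (conjIn φ y) = polarIn φ x y := by
  induction x with
  | zero => simp
  | add x x' hx hx' => simp only [map_add, LinearMap.add_apply, hx, hx']
  | tmul a v =>
    induction y with
    | zero => simp
    | add y y' hy hy' => simp only [map_add, hy, hy']
    | tmul b w =>
      simp only [conjIn_tmul, polarIn_tmul]
      simp only [QuadraticMap.polar, ← map_add, h.map_conj]

lemma polarIn_one_one [CharZero k] [Nontrivial C] : polarIn φ (1 : B ⊗[k] C) 1 = 2 := by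
  simp only [Algebra.TensorProduct.one_def, polarIn_tmul, h.polar_one_one, mul_one]
  rw [Algebra.smul_def, mul_one, map_ofNat]

lemma polarIn_smul_one [CharZero k] [Nontrivial C] (b : B) :
    (2⁻¹ : k) • polarIn φ (b • (1 : B ⊗[k] C)) 1 = b := by
  have h2 : (2 : B) = (2 : k) • 1 := by rw [Algebra.smul_def, map_ofNat, mul_one]
  rw [map_smul, LinearMap.smul_apply, h.polarIn_one_one, smul_eq_mul, h2, mul_smul_comm, mul_one,
    smul_smul, inv_mul_cancel₀ two_ne_zero, one_smul]

lemma smul_one_injective [CharZero k] [Nontrivial C] {b b' : B}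
    (hb : b • (1 : B ⊗[k] C) = b' • 1) : b = b' := by
  rw [← h.polarIn_smul_one b, hb, h.polarIn_smul_one]

lemma mul_conjIn_mul [CharZero k] [Nontrivial C] (x z : B ⊗[k] C) :
    x * (conjIn φ x * z) = normIn φ x • z := by
  have h1 := congrArg ((2⁻¹ : k) • ·) (h.mul_conjIn_mul_add x x z)
  simp only [← two_smul k (x * (conjIn φ x * z)), smul_smul] at h1
  rw [inv_mul_cancel₀ two_ne_zero, one_smul] at h1
  rw [h1, normIn, smul_assoc]

lemma mul_mul_conjIn [CharZero k] [Nontrivial C] (x z : B ⊗[k] C) :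
    (z * x) * conjIn φ x = normIn φ x • z := by
  have h1 := congrArg ((2⁻¹ : k) • ·) (h.mul_mul_conjIn_add x x z)
  simp only [← two_smul k ((z * x) * conjIn φ x), smul_smul] at h1
  rw [inv_mul_cancel₀ two_ne_zero, one_smul] at h1
  rw [h1, normIn, smul_assoc]

lemma normIn_conjIn [CharZero k] [Nontrivial C] (x : B ⊗[k] C) :
    normIn φ (conjIn φ x) = normIn φ x := by
  rw [normIn, h.polarIn_conjIn_conjIn, normIn]

lemma mul_conjIn [CharZero k] [Nontrivial C] (x : B ⊗[k] C) :
    x * conjIn φ x = normIn φ x • 1 := by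
  simpa using h.mul_conjIn_mul x 1

lemma conjIn_mul_self [CharZero k] [Nontrivial C] (x : B ⊗[k] C) :
    conjIn φ x * x = normIn φ x • 1 := by
  have := h.mul_conjIn (conjIn φ x)
  rwa [h.conjIn_conjIn, h.normIn_conjIn] at this

/-- An element of `B ⊗ C` that is fixed under conjugation is a scalar. -/
lemma eq_smul_one [CharZero k] [Nontrivial C] {x : B ⊗[k] C} (hx : conjIn φ x = x) :
    x = ((2⁻¹ : k) • polarIn φ x 1) • (1 : B ⊗[k] C) := by
  have h1 := conjIn_eq (φ := φ) x
  rw [hx, eq_sub_iff_add_eq, ← two_smul k] at h1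
  rw [smul_assoc, ← h1, smul_smul, inv_mul_cancel₀ two_ne_zero, one_smul]

end IsCompositionAlgebra

end BaseChange

end CompositionAlgebra

/-! ### Infinitesimal lifting and smoothness of quadrics -/

section Lifting

attribute [local instance] MvPolynomial.gradedAlgebra

variable {k : Type u} [Field k] {V : Type*} [AddCommGroup V] [Module k V] [Module.Finite k V]
  {B : Type*} [CommRing B] [Algebra k B]

/-- The infinitesimal lifting criterion for smoothness of a projective scheme, in terms of points
with values in `k`-algebras: locally where a linear form is invertible, a point modulo a
square-zero ideal can be lifted. -/
lemma smooth_projScheme_of_lift {I : HomogeneousIdeal (coordGrading k V)}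
    {T : Set (Module.Dual k V)} (hT : Submodule.span k T = ⊤)
    (H : ∀ ℓ ∈ T, ∀ (R : Type u) [CommRing R] [Algebra k R] (N : Ideal R), N ^ 2 = ⊥ →
      ∀ x : R ⊗[k] V, (∀ f ∈ I.toIdeal, evalIn x f ∈ N) → IsUnit (dualExt R ℓ x) →
        ∃ y : R ⊗[k] V, (∀ f ∈ I.toIdeal, evalIn y f = 0) ∧
          mapPt V (Ideal.Quotient.mkₐ k N) y = mapPt V (Ideal.Quotient.mkₐ k N) x) :
    Smooth (projScheme (coordGrading k V) I).hom := by
  refine smooth_projScheme (ι := T) (fun ℓ => ℓ) (by simpa using hT) ?_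
  rintro ⟨ℓ, hℓ⟩ R _ _ N hN g hg hu
  obtain ⟨x, hx⟩ := LinearMap.rTensor_surjective V (g := (Ideal.Quotient.mkₐ k N).toLinearMap)
    Ideal.Quotient.mk_surjective (mapPt V g (genericPt k V))
  replace hx : mapPt V (Ideal.Quotient.mkₐ k N) x = mapPt V g (genericPt k V) := hx
  have key : ∀ f, Ideal.Quotient.mkₐ k N (evalIn x f) = g f := fun f => by
    rw [map_evalIn, hx, evalIn_mapPt_genericPt]
  obtain ⟨y, hy, hyx⟩ := H ℓ hℓ R N hN x
    (fun f hf => Ideal.Quotient.eq_zero_iff_mem.mp ((key f).trans (hg f hf))) (by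
      rw [← evalIn_linForm, ← IsNilpotent.isUnit_quotient_mk_iff (I := N) ⟨2, hN⟩]
      change IsUnit (Ideal.Quotient.mkₐ k N _)
      rwa [key])
  refine ⟨evalIn y, hy, AlgHom.ext fun f => ?_⟩
  rw [AlgHom.comp_apply, map_evalIn, hyx, hx, evalIn_mapPt_genericPt]

variable (k B) in
lemma algebraMap_inv_two_mul_two [CharZero k] : algebraMap k B 2⁻¹ * 2 = 1 := by
  rw [← map_ofNat (algebraMap k B) 2, ← map_mul, inv_mul_cancel₀ two_ne_zero, map_one]

/-- Moving a point by `-ε y`, with `ε ^ 2 = 0`, changes the value of a quadratic form by `-ε` times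
the polar form; so a value of the form can be corrected in a square-zero ideal by moving in a
direction where the polar form is invertible. -/
lemma evalIn_quadForm_sub [CharZero k] (q : QuadraticForm k V) (x y : B ⊗[k] V) {ε : B}
    (hε : ε * ε = 0) : evalIn (x - ε • y) (quadForm q) = evalIn x (quadForm q) -
      ε * LinearMap.BilinForm.baseChange B (QuadraticMap.polarBilin q) x y := by
  have hsymm : ∀ x y : B ⊗[k] V,
      LinearMap.BilinForm.baseChange B (QuadraticMap.polarBilin q) x y =
      LinearMap.BilinForm.baseChange B (QuadraticMap.polarBilin q) y x := fun x y => by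
    induction x with
    | zero => simp
    | add x x' hx hx' => simp only [map_add, LinearMap.add_apply, hx, hx']
    | tmul a v =>
      induction y with
      | zero => simp
      | add y y' hy hy' => simp only [map_add, LinearMap.add_apply, hy, hy']
      | tmul b w => simp [QuadraticMap.polar_comm q v, mul_comm a b]
  simp only [evalIn_quadForm, map_sub, LinearMap.sub_apply, map_smul, LinearMap.smul_apply,
    smul_eq_mul, hsymm y x]
  have h2 := algebraMap_inv_two_mul_two k B
  simp only [Algebra.smul_def]
  linear_combination (- ε * LinearMap.BilinForm.baseChange B (QuadraticMap.polarBilin q) x y) * h2 +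
    algebraMap k B 2⁻¹ * LinearMap.BilinForm.baseChange B (QuadraticMap.polarBilin q) y y * hε

lemma span_polar_eq_top {q : QuadraticForm k V} (hq : (QuadraticMap.polarBilin q).Nondegenerate) :
    Submodule.span k (Set.range fun y => (QuadraticMap.polarBilin q).flip y) = ⊤ := by
  refine Submodule.span_eq_top_of_ne_zero fun x hx => ?_
  by_contra! hcon
  exact hx (hq.1 x fun y => hcon _ ⟨y, rfl⟩)

lemma dualExt_polar (q : QuadraticForm k V) (y : V) (x : B ⊗[k] V) :
    dualExt B ((QuadraticMap.polarBilin q).flip y) x =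
      LinearMap.BilinForm.baseChange B (QuadraticMap.polarBilin q) x (1 ⊗ₜ y) := by
  induction x with
  | zero => simp
  | add x x' hx hx' => simp only [map_add, LinearMap.add_apply, hx, hx']
  | tmul a v => simp

lemma evalIn_mem_of_mem_span {p : CoordRing k V} {N : Ideal B} {x : B ⊗[k] V}
    (hp : evalIn x p ∈ N) {f : CoordRing k V} (hf : f ∈ Ideal.span {p}) : evalIn x f ∈ N := by
  obtain ⟨g, rfl⟩ := Ideal.mem_span_singleton.mp hf
  rw [map_mul]
  exact N.mul_mem_right _ hp

/-- A non-zero linear form does not vanish on a non-degenerate quadric, for reasons of degree. -/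
lemma linForm_notMem_span_quadForm [CharZero k] {q : QuadraticForm k V}
    (hq : (QuadraticMap.polarBilin q).Nondegenerate) {ℓ : Module.Dual k V} {v : V}
    (hℓ : ℓ v ≠ 0) : linForm ℓ ∉ Ideal.span {quadForm q} := by
  have : Nontrivial V := ⟨v, 0, by rintro rfl; simp at hℓ⟩
  have h0 : linForm ℓ ≠ 0 := fun h => hℓ (by
    have := evalIn_linForm ((1 : k) ⊗ₜ[k] v) ℓ
    rw [h, map_zero, dualExt_tmul, smul_eq_mul, mul_one] at this
    exact this.symm)
  intro h
  obtain ⟨g, hg⟩ := Ideal.mem_span_singleton.mp h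
  have hg0 : g ≠ 0 := by rintro rfl; simp [h0] at hg
  have h1 := MvPolynomial.totalDegree_mul_of_isDomain (quadForm_ne_zero hq) hg0
  rw [← hg, (linForm_mem ℓ).totalDegree h0,
    (quadForm_mem q).totalDegree (quadForm_ne_zero hq)] at h1
  omega

/-- Non-degenerate quadrics are smooth. -/
lemma smooth_quadric [CharZero k] {q : QuadraticForm k V}
    (hq : (QuadraticMap.polarBilin q).Nondegenerate) : Smooth (quadric q).hom := by
  refine smooth_projScheme_of_lift (span_polar_eq_top hq) ?_
  rintro _ ⟨y, rfl⟩ R _ _ N hN x hx hu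
  have hx0 : evalIn x (quadForm q) ∈ N := hx _ (Ideal.subset_span rfl)
  obtain ⟨s, hs⟩ := hu
  set ε : R := evalIn x (quadForm q) * ↑s⁻¹ with hε
  have hεN : ε ∈ N := N.mul_mem_right _ hx0
  have hε2 : ε * ε = 0 := by
    have := Ideal.mul_mem_mul hεN hεN
    rwa [← sq, ← sq, hN, Ideal.mem_bot, sq] at this
  refine ⟨x - ε • (1 ⊗ₜ y), fun f hf => ?_, ?_⟩
  · have := evalIn_mem_of_mem_span (N := (⊥ : Ideal R)) (x := x - ε • ((1 : R) ⊗ₜ[k] y)) ?_ hf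
    · exact this
    · rw [Ideal.mem_bot, evalIn_quadForm_sub q _ _ hε2, ← dualExt_polar, ← hs, hε, mul_assoc,
        Units.inv_mul, mul_one, sub_self]
  · rw [map_sub, mapPt_smul]
    have : Ideal.Quotient.mkₐ k N ε = 0 := Ideal.Quotient.eq_zero_iff_mem.mpr hεN
    rw [this, zero_smul, sub_zero]

end Lifting

/-! ### Hermitian matrices after extension of scalars -/

section Matrices

attribute [local instance] MvPolynomial.gradedAlgebra

variable {k : Type u} [Field k] {C : Type v} [NonAssocRing C] [Module k C]
  [IsScalarTower k C C] [SMulCommClass k C C] {n : ℕ}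
  {B : Type*} [CommRing B] [Algebra k B] {B' : Type*} [CommRing B'] [Algebra k B']

/-- The matrix over `B ⊗ C` of an element of `B ⊗ M_n(C)`. -/
def toMatrix : B ⊗[k] Matrix (Fin n) (Fin n) C →ₗ[B] Matrix (Fin n) (Fin n) (B ⊗[k] C) :=
  LinearMap.pi fun i => LinearMap.pi fun j => (Matrix.entryLinearMap k C i j).baseChange B

@[simp] lemma toMatrix_tmul (a : B) (m : Matrix (Fin n) (Fin n) C) (i j : Fin n) :
    toMatrix (a ⊗ₜ[k] m) i j = a ⊗ₜ m i j := rfl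

/-- The element of `B ⊗ M_n(C)` with a given matrix over `B ⊗ C`. -/
def ofMatrix (M : Matrix (Fin n) (Fin n) (B ⊗[k] C)) : B ⊗[k] Matrix (Fin n) (Fin n) C :=
  ∑ i, ∑ j, (Matrix.singleLinearMap k i j).baseChange B (M i j)

lemma ofMatrix_toMatrix (x : B ⊗[k] Matrix (Fin n) (Fin n) C) : ofMatrix (toMatrix x) = x := by
  induction x with
  | zero => simp [ofMatrix]
  | add x y hx hy =>
    conv_rhs => rw [← hx, ← hy]
    simp only [ofMatrix, map_add, Matrix.add_apply, Finset.sum_add_distrib]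
  | tmul a m =>
    conv_rhs => rw [Matrix.matrix_eq_sum_single m]
    simp [ofMatrix, TensorProduct.tmul_sum]

lemma toMatrix_single (a : B ⊗[k] C) (i j : Fin n) :
    toMatrix ((Matrix.singleLinearMap k i j).baseChange B a) = Matrix.single i j a := by
  induction a with
  | zero => simp
  | add x y hx hy => rw [map_add, map_add, hx, hy, Matrix.single_add]
  | tmul b c =>
    ext i' j'
    simp only [LinearMap.baseChange_tmul, toMatrix_tmul, Matrix.singleLinearMap_apply,
      Matrix.single_apply]
    split_ifs <;> simp

lemma toMatrix_ofMatrix (M : Matrix (Fin n) (Fin n) (B ⊗[k] C)) : toMatrix (ofMatrix M) = M := by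
  simp only [ofMatrix, map_sum, toMatrix_single]
  exact (Matrix.matrix_eq_sum_single M).symm

lemma toMatrix_injective : Function.Injective
    (toMatrix : B ⊗[k] Matrix (Fin n) (Fin n) C →ₗ[B] Matrix (Fin n) (Fin n) (B ⊗[k] C)) :=
  Function.LeftInverse.injective ofMatrix_toMatrix

lemma toMatrix_mul (x y : B ⊗[k] Matrix (Fin n) (Fin n) C) :
    toMatrix (x * y) = toMatrix x * toMatrix y := by
  induction x with
  | zero => simp
  | add x x' hx hx' => simp only [map_add, add_mul, hx, hx']
  | tmul a m =>
    induction y with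
    | zero => simp
    | add y y' hy hy' => simp only [map_add, mul_add, hy, hy']
    | tmul b m' =>
      ext i j
      rw [Algebra.TensorProduct.tmul_mul_tmul]
      simp [Matrix.mul_apply, TensorProduct.tmul_sum, Algebra.TensorProduct.tmul_mul_tmul]

lemma toMatrix_jordanU {K : Type*} [Field K] [Algebra k K]
    (x y : K ⊗[k] Matrix (Fin n) (Fin n) C) :
    toMatrix (jordanU K x y) = jordanU K (toMatrix x) (toMatrix y) := by
  simp only [jordanU, jordanMul, map_sub, map_smul, map_add, toMatrix_mul]

/-- A matrix over `B ⊗ C` is fixed by the involution `x ↦ Γ⁻¹ x̄ᵗ Γ`, with `Γ = diag(b)`. -/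
def IsHermitian (φ : QuadraticForm k C) (b : Fin n → k)
    (M : Matrix (Fin n) (Fin n) (B ⊗[k] C)) : Prop :=
  ∀ i j, b j • conjIn φ (M j i) = b i • M i j

/-- The matrix over `B ⊗ C` of an element of `B ⊗ J`. -/
def matIn (φ : QuadraticForm k C) (b : Fin n → k) (x : B ⊗[k] symMatrices φ b) :
    Matrix (Fin n) (Fin n) (B ⊗[k] C) :=
  toMatrix ((symMatrices φ b).subtype.baseChange B x)

variable {φ : QuadraticForm k C} {b : Fin n → k}

lemma matIn_tmul (a : B) (m : symMatrices φ b) (i j : Fin n) :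
    matIn φ b (a ⊗ₜ[k] m) i j = a ⊗ₜ m.1 i j := rfl

lemma matIn_add (x y : B ⊗[k] symMatrices φ b) :
    matIn φ b (x + y) = matIn φ b x + matIn φ b y := by simp [matIn]

lemma matIn_zero : matIn φ b (0 : B ⊗[k] symMatrices φ b) = 0 := by simp [matIn]

lemma matIn_smul (a : B) (x : B ⊗[k] symMatrices φ b) :
    matIn φ b (a • x) = a • matIn φ b x := by simp [matIn]

/-- The linear map that takes a matrix in `J` to one of its entries. -/
def entry (φ : QuadraticForm k C) (b : Fin n → k) (i j : Fin n) : symMatrices φ b →ₗ[k] C :=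
  Matrix.entryLinearMap k C i j ∘ₗ (symMatrices φ b).subtype

lemma entry_apply (i j : Fin n) (x : symMatrices φ b) : entry φ b i j x = x.1 i j := rfl

lemma baseChange_entry (i j : Fin n) (x : B ⊗[k] symMatrices φ b) :
    (entry φ b i j).baseChange B x = matIn φ b x i j := by
  rw [entry, LinearMap.baseChange_comp]
  rfl

lemma matIn_mapPt (g : B →ₐ[k] B') (x : B ⊗[k] symMatrices φ b) (i j : Fin n) :
    matIn φ b (mapPt _ g x) i j = mapPt C g (matIn φ b x i j) := by
  rw [← baseChange_entry, ← baseChange_entry, mapPt_baseChange]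

lemma isHermitian_matIn (hb : ∀ i, b i ≠ 0) (x : B ⊗[k] symMatrices φ b) :
    IsHermitian φ b (matIn φ b x) := fun i j => by
  induction x with
  | zero => simp [matIn_zero]
  | add x y hx hy => simp only [matIn_add, Matrix.add_apply, map_add, smul_add, hx, hy]
  | tmul a m =>
    rw [matIn_tmul, matIn_tmul, conjIn_tmul, ← m.2 i j, ← TensorProduct.tmul_smul,
      ← TensorProduct.tmul_smul, smul_inv_smul₀ (hb i)]

variable (φ b) in
/-- The involution `x ↦ Γ⁻¹ x̄ᵗ Γ` of `M_n(C)`, with `Γ = diag(b)`. -/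
def adjoint : Matrix (Fin n) (Fin n) C →ₗ[k] Matrix (Fin n) (Fin n) C where
  toFun m := Matrix.of fun i j => (b i)⁻¹ • b j • conj φ (m j i)
  map_add' m m' := by ext; simp
  map_smul' c m := by
    ext i j
    simp [smul_comm _ c]

lemma toMatrix_adjoint (x : B ⊗[k] Matrix (Fin n) (Fin n) C) (i j : Fin n) :
    toMatrix ((adjoint φ b).baseChange B x) i j = (b i)⁻¹ • b j • conjIn φ (toMatrix x j i) := by
  induction x with
  | zero => simp
  | add x y hx hy => simp only [map_add, Matrix.add_apply, smul_add, hx, hy]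
  | tmul a m => simp [adjoint, TensorProduct.tmul_smul]

section

variable [CharZero k] [Nontrivial C] (h : IsCompositionAlgebra φ) (hb : ∀ i, b i ≠ 0)

/-- The projection `m ↦ (m + Γ⁻¹ m̄ᵗ Γ) / 2` of `M_n(C)` to `J`. -/
def symProj : Matrix (Fin n) (Fin n) C →ₗ[k] symMatrices φ b :=
  ((2⁻¹ : k) • (LinearMap.id + adjoint φ b)).codRestrict _ fun m i j => by
    simp only [adjoint, LinearMap.smul_apply, LinearMap.add_apply, LinearMap.id_apply,
      LinearMap.coe_mk, AddHom.coe_mk, Matrix.smul_apply, Matrix.add_apply, Matrix.of_apply,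
      map_smul, map_add, h.conj_conj, smul_add, smul_comm _ (2⁻¹ : k), smul_inv_smul₀ (hb j),
      inv_smul_smul₀ (hb i)]
    exact add_comm _ _

include h hb

lemma symProj_comp_subtype :
    symProj h hb ∘ₗ (symMatrices φ b).subtype = LinearMap.id := by
  ext m i j
  have h2 : adjoint φ b m.1 i j = m.1 i j := m.2 i j
  change (2⁻¹ : k) • (m.1 i j + adjoint φ b m.1 i j) = m.1 i j
  rw [h2, ← two_smul k, inv_smul_smul₀ two_ne_zero]

lemma subtype_comp_symProj : (symMatrices φ b).subtype ∘ₗ symProj h hb =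
    (2⁻¹ : k) • (LinearMap.id + adjoint φ b) := rfl

lemma matIn_injective : Function.Injective (matIn φ b : B ⊗[k] symMatrices φ b → _) := by
  intro x y hxy
  have h1 := congrArg ((symProj h hb).baseChange B) (toMatrix_injective hxy)
  rwa [← LinearMap.comp_apply, ← LinearMap.comp_apply, ← LinearMap.baseChange_comp,
    symProj_comp_subtype, LinearMap.baseChange_id] at h1

lemma exists_matIn_eq {M : Matrix (Fin n) (Fin n) (B ⊗[k] C)} (hM : IsHermitian φ b M) :
    ∃ x : B ⊗[k] symMatrices φ b, matIn φ b x = M := by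
  refine ⟨(symProj h hb).baseChange B (ofMatrix M), ?_⟩
  rw [matIn, ← LinearMap.comp_apply (LinearMap.baseChange B (symMatrices φ b).subtype),
    ← LinearMap.baseChange_comp, subtype_comp_symProj]
  ext i j
  have h1 := toMatrix_adjoint (φ := φ) (b := b) (ofMatrix M) i j
  rw [toMatrix_ofMatrix, hM i j, inv_smul_smul₀ (hb i)] at h1
  rw [LinearMap.baseChange_smul, LinearMap.baseChange_add, LinearMap.baseChange_id]
  have h3 : toMatrix ((2⁻¹ : k) • (ofMatrix M + (adjoint φ b).baseChange B (ofMatrix M))) =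
      (2⁻¹ : k) • (M + toMatrix ((adjoint φ b).baseChange B (ofMatrix M))) := by
    rw [← algebraMap_smul B (2⁻¹ : k), map_smul, map_add, toMatrix_ofMatrix, algebraMap_smul]
  change toMatrix ((2⁻¹ : k) • (ofMatrix M + (adjoint φ b).baseChange B (ofMatrix M))) i j = M i j
  rw [h3, Matrix.smul_apply, Matrix.add_apply, h1, ← two_smul k, inv_smul_smul₀ two_ne_zero]

lemma isRankLeOne_iff {K : Type u} [Field K] [Algebra k K] (x : K ⊗[k] symMatrices φ b) :
    IsRankLeOne K φ b x ↔ ∀ M : Matrix (Fin n) (Fin n) (K ⊗[k] C), IsHermitian φ b M →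
      ∃ c : K, jordanU K (matIn φ b x) M = c • matIn φ b x := by
  constructor
  · intro hx M hM
    obtain ⟨y, rfl⟩ := exists_matIn_eq h hb hM
    obtain ⟨c, hc⟩ := hx y
    refine ⟨c, ?_⟩
    have := congrArg toMatrix hc
    rwa [toMatrix_jordanU, map_smul] at this
  · intro hx y
    obtain ⟨c, hc⟩ := hx _ (isHermitian_matIn hb y)
    refine ⟨c, toMatrix_injective ?_⟩
    rw [toMatrix_jordanU, map_smul]
    exact hc

end

lemma isTraceless_iff {K : Type u} [Field K] [Algebra k K] (x : K ⊗[k] symMatrices φ b) :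
    IsTraceless K φ b x ↔ ∑ i, matIn φ b x i i = 0 := by
  rw [IsTraceless]
  have h1 : ∀ m : K ⊗[k] Matrix (Fin n) (Fin n) C,
      (Matrix.traceLinearMap (Fin n) k C).baseChange K m = ∑ i, toMatrix m i i := fun m => by
    induction m with
    | zero => simp
    | add x y hx hy => simp only [map_add, Matrix.add_apply, Finset.sum_add_distrib, hx, hy]
    | tmul a m => simp [Matrix.trace, TensorProduct.tmul_sum]
  rw [h1]
  rfl

lemma jordanU_apply {K : Type*} [Field K] [CharZero K] {M : Type*} [NonUnitalNonAssocRing M]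
    [Module K M] [IsScalarTower K M M] [SMulCommClass K M M] (x y : M) :
    (2 : K) • jordanU K x y =
      x * (x * y) + x * (y * x) + (x * y) * x + (y * x) * x - ((x * x) * y + y * (x * x)) := by
  simp only [jordanU, jordanMul, mul_smul_comm, smul_mul_assoc, smul_add, add_mul, mul_add,
    smul_sub]
  module

lemma jordanU_smul_left {K : Type*} [Field K] {M : Type*} [NonUnitalNonAssocRing M]
    [Module K M] [IsScalarTower K M M] [SMulCommClass K M M] (a : K) (x y : M) :
    jordanU K (a • x) y = a ^ 2 • jordanU K x y := by
  simp only [jordanU, jordanMul, mul_smul_comm, smul_mul_assoc, smul_add, add_mul, mul_add,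
    smul_sub]
  module

variable [Module.Finite k C]

lemma mem_idealXJ {f : CoordRing k (symMatrices φ b)} :
    f ∈ (idealXJ φ b).toIdeal ↔ ∀ x : AlgebraicClosure k ⊗[k] symMatrices φ b,
      IsRankLeOne (AlgebraicClosure k) φ b x → IsTraceless (AlgebraicClosure k) φ b x →
        evalIn x f = 0 := by
  rw [idealXJ, mem_idealOfPoints]
  · exact ⟨fun H x h1 h2 => H x ⟨h1, h2⟩, fun H x hx => H x hx.1 hx.2⟩
  · rintro x ⟨h1, h2⟩ c
    refine ⟨fun y => ?_, ?_⟩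
    · obtain ⟨d, hd⟩ := h1 y
      refine ⟨c * d, ?_⟩
      rw [map_smul, jordanU_smul_left, hd, smul_smul, smul_smul]
      congr 1
      ring
    · rw [IsTraceless] at h2 ⊢
      rw [map_smul, map_smul, h2, smul_zero]

end Matrices

/-! ### The ideal of the base scheme -/

section LastRow

attribute [local instance] MvPolynomial.gradedAlgebra

variable {k : Type u} [Field k] {C : Type v} [NonAssocRing C] [Module k C]
  [IsScalarTower k C C] [SMulCommClass k C C] [Module.Finite k C] {φ : QuadraticForm k C}
  {m : ℕ} {b : Fin (m + 1) → k}

variable (φ b) in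
/-- The ideal in the coordinate ring of `J` whose scheme of zeros is `Z_2`. -/
def idealZ2 : HomogeneousIdeal (coordGrading k (symMatrices φ b)) :=
  idealXJ φ b ⊔ spanIdeal 1 (linForm '' lastRowForms φ b)
    (by rintro _ ⟨ℓ, -, rfl⟩; exact linForm_mem ℓ)

lemma idealXJ_le_idealZ2 : (idealXJ φ b).toIdeal ≤ (idealZ2 φ b).toIdeal := by
  rw [idealZ2, HomogeneousIdeal.toIdeal_sup]
  exact le_sup_left

/-- Linear forms that vanish on matrices whose last row is zero belong to the ideal of `Z_2`. -/
lemma linForm_mem_idealZ2 {ℓ : Module.Dual k (symMatrices φ b)}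
    (hℓ : ∀ x : symMatrices φ b, (∀ j, x.1 (Fin.last m) j = 0) → ℓ x = 0) :
    linForm ℓ ∈ (idealZ2 φ b).toIdeal := by
  rw [idealZ2, HomogeneousIdeal.toIdeal_sup]
  refine Ideal.mem_sup_right ?_
  let R : symMatrices φ b →ₗ[k] (Fin (m + 1) → C) := LinearMap.pi fun j => entry φ b (Fin.last m) j
  obtain ⟨μ, rfl⟩ : ℓ ∈ LinearMap.range R.dualMap := by
    rw [LinearMap.range_dualMap_eq_dualAnnihilator_ker, Submodule.mem_dualAnnihilator]
    exact fun x hx => hℓ x fun j => congrFun (LinearMap.mem_ker.mp hx) j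
  have h1 : R.dualMap μ = ∑ j, (μ ∘ₗ LinearMap.single k (fun _ => C) j) ∘ₗ
      entry φ b (Fin.last m) j := by
    ext x
    simp only [LinearMap.dualMap_apply, LinearMap.sum_apply, LinearMap.comp_apply, ← map_sum]
    congr 1
    exact (Finset.univ_sum_single (R x)).symm
  rw [h1]
  change linFormₗ k _ _ ∈ _
  rw [map_sum]
  exact Ideal.sum_mem _ fun j _ => Ideal.subset_span
    ⟨_, ⟨j, μ ∘ₗ LinearMap.single k (fun _ => C) j, fun x => rfl⟩, rfl⟩

/-- To send the ideal of `Z_2` to a given ideal `P`, it suffices to send the ideal of `X(J)` and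
the linear forms of the last row to `P`. -/
lemma map_mem_of_mem_idealZ2 {R : Type*} [CommRing R] [Algebra k R]
    (θ : CoordRing k (symMatrices φ b) →ₐ[k] R) (P : Ideal R)
    (h1 : ∀ f ∈ (idealXJ φ b).toIdeal, θ f ∈ P)
    (h2 : ∀ ℓ ∈ lastRowForms φ b, θ (linForm ℓ) ∈ P)
    {f : CoordRing k (symMatrices φ b)} (hf : f ∈ (idealZ2 φ b).toIdeal) : θ f ∈ P := by
  rw [idealZ2, HomogeneousIdeal.toIdeal_sup] at hf
  have h3 : (idealXJ φ b).toIdeal ⊔ Ideal.span (linForm '' lastRowForms φ b) ≤ P.comap θ := by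
    refine sup_le h1 (Ideal.span_le.mpr ?_)
    rintro _ ⟨ℓ, hℓ, rfl⟩
    exact h2 ℓ hℓ
  exact h3 hf

/-- The scalar `α` of a matrix entry of the form `α 1`, as a linear form on `J`. -/
def entryScalar (φ : QuadraticForm k C) {n : ℕ} (b : Fin n → k) (i : Fin n) :
    Module.Dual k (symMatrices φ b) :=
  ((2⁻¹ : k) • (QuadraticMap.polarBilin φ).flip 1) ∘ₗ entry φ b i i

section

variable [CharZero k] [Nontrivial C] (h : IsCompositionAlgebra φ) {n : ℕ} {b : Fin n → k}
  (hb : ∀ i, b i ≠ 0) {B : Type*} [CommRing B] [Algebra k B]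

include h

lemma diag_eq_smul_one {M : Matrix (Fin n) (Fin n) (B ⊗[k] C)} (hb : ∀ i, b i ≠ 0)
    (hM : IsHermitian φ b M) (i : Fin n) :
    M i i = ((2⁻¹ : k) • polarIn φ (M i i) 1) • (1 : B ⊗[k] C) := by
  refine h.eq_smul_one ?_
  have := congrArg ((b i)⁻¹ • ·) (hM i i)
  simpa only [inv_smul_smul₀ (hb i)] using this

lemma dualExt_entryScalar (i : Fin n) (x : B ⊗[k] symMatrices φ b) :
    dualExt B (entryScalar φ b i) x = (2⁻¹ : k) • polarIn φ (matIn φ b x i i) 1 := by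
  rw [entryScalar, dualExt_comp, baseChange_entry]
  generalize matIn φ b x i i = y
  induction y with
  | zero => simp
  | add y z hy hz => simp only [map_add, LinearMap.add_apply, smul_add, hy, hz]
  | tmul a c => simp [Algebra.TensorProduct.one_def, smul_smul]

lemma diag_eq_dualExt (hb : ∀ i, b i ≠ 0) (i : Fin n) (x : B ⊗[k] symMatrices φ b) :
    matIn φ b x i i = dualExt B (entryScalar φ b i) x • (1 : B ⊗[k] C) := by
  rw [dualExt_entryScalar h]
  exact diag_eq_smul_one h hb (isHermitian_matIn hb x) i

lemma linForm_trace_mem (hb : ∀ i, b i ≠ 0) :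
    linForm (∑ i, entryScalar φ b i) ∈ (idealXJ φ b).toIdeal := by
  rw [mem_idealXJ]
  intro x _ hx
  rw [isTraceless_iff] at hx
  have h1 : linForm (∑ i, entryScalar φ b i) = ∑ i, linForm (entryScalar φ b i) :=
    map_sum (linFormₗ k _) _ _
  simp only [h1, map_sum, evalIn_linForm]
  refine h.smul_one_injective ?_
  simp only [diag_eq_dualExt h hb, ← Finset.sum_smul] at hx
  rw [zero_smul, ← hx]

end

end LastRow

/-! ### Elements of rank one in degree three -/

section ThreeByThree

variable {k : Type u} [Field k] [CharZero k] {C : Type v} [NonAssocRing C] [Module k C]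
  [IsScalarTower k C C] [SMulCommClass k C C] [Nontrivial C]
  {φ : QuadraticForm k C} (h : IsCompositionAlgebra φ)
  {K : Type*} [Field K] [Algebra k K] [CharZero K]

lemma jordanU_single_apply (M : Matrix (Fin 3) (Fin 3) (K ⊗[k] C)) (i j : Fin 3) :
    jordanU K M (Matrix.single 0 0 1) i j = M i 0 * M 0 j := by
  have h2 := congrFun (congrFun (jordanU_apply (K := K) M (Matrix.single 0 0 1)) i) j
  refine smul_right_injective _ (two_ne_zero (α := K)) ?_
  change (2 : K) • jordanU K M (Matrix.single 0 0 1) i j = (2 : K) • (M i 0 * M 0 j)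
  rw [← Matrix.smul_apply, h2, two_smul]
  fin_cases i <;> fin_cases j <;>
    simp [Matrix.mul_apply, Fin.sum_univ_three, Matrix.single_apply] <;> abel

include h

lemma jordanU_block {M Y : Matrix (Fin 3) (Fin 3) (K ⊗[k] C)} {a t p s : K} {c g : K ⊗[k] C}
    (hN : a * normIn φ c = -(t * t))
    (h00 : M 0 0 = t • 1) (h01 : M 0 1 = c) (h02 : M 0 2 = 0)
    (h10 : M 1 0 = a • conjIn φ c) (h11 : M 1 1 = (-t) • 1) (h12 : M 1 2 = 0)
    (h20 : M 2 0 = 0) (h21 : M 2 1 = 0) (h22 : M 2 2 = 0)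
    (y00 : Y 0 0 = p • 1) (y01 : Y 0 1 = g) (y10 : Y 1 0 = a • conjIn φ g) (y11 : Y 1 1 = s • 1) :
    jordanU K M Y = (t * p - t * s + a * polarIn φ c g) • M := by
  have e1 : ∀ z, c * (conjIn φ c * z) = normIn φ c • z := h.mul_conjIn_mul c
  have e2 : ∀ z, conjIn φ c * (c * z) = normIn φ c • z := fun z => by
    have := h.mul_conjIn_mul (conjIn φ c) z
    rwa [h.conjIn_conjIn, h.normIn_conjIn] at this
  have e3 : ∀ z, (z * c) * conjIn φ c = normIn φ c • z := h.mul_mul_conjIn c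
  have e4 : ∀ z, (z * conjIn φ c) * c = normIn φ c • z := fun z => by
    have := h.mul_mul_conjIn (conjIn φ c) z
    rwa [h.conjIn_conjIn, h.normIn_conjIn] at this
  have e5 : c * conjIn φ c = normIn φ c • 1 := h.mul_conjIn c
  have e6 : conjIn φ c * c = normIn φ c • 1 := h.conjIn_mul_self c
  have f1 : g * conjIn φ c = polarIn φ c g • 1 + (-1 : K) • (c * conjIn φ g) := by
    have := h.mul_conjIn_mul_add c g 1
    rw [mul_one, mul_one] at this
    rw [← this]; module
  have f2 : conjIn φ g * c = polarIn φ c g • 1 + (-1 : K) • (conjIn φ c * g) := by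
    have := h.mul_conjIn_mul_add (conjIn φ c) (conjIn φ g) 1
    rw [mul_one, mul_one, h.conjIn_conjIn, h.conjIn_conjIn, h.polarIn_conjIn_conjIn] at this
    rw [← this]; module
  have f3 : (c * conjIn φ g) * c = polarIn φ c g • c + (-normIn φ c) • g := by
    have := h.mul_mul_conjIn_add (conjIn φ c) (conjIn φ g) c
    rw [h.conjIn_conjIn, h.conjIn_conjIn, h.polarIn_conjIn_conjIn, e5, smul_mul_assoc,
      one_mul] at this
    rw [← this]; module
  have f4 : (conjIn φ c * g) * conjIn φ c = 
      polarIn φ c g • conjIn φ c + (-normIn φ c) • conjIn φ g := by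
    have := h.mul_mul_conjIn_add c g (conjIn φ c)
    rw [e6, smul_mul_assoc, one_mul] at this
    rw [← this]; module
  have hMM : M * M = 0 := by
    ext i j
    fin_cases i <;> fin_cases j <;>
      simp only [Matrix.mul_apply, Fin.sum_univ_three, h00, h01, h02, h10, h11, h12, h20, h21, h22,
        Matrix.zero_apply, Fin.zero_eta, Fin.mk_one, Fin.reduceFinMk, mul_zero, zero_mul, add_zero,
        smul_mul_assoc, mul_smul_comm, one_mul, mul_one, e5, e6] <;>
      match_scalars <;>
      clear * - hN <;> grind
  refine smul_right_injective _ (two_ne_zero (α := K)) ?_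
  change (2 : K) • jordanU K M Y = (2 : K) • _
  rw [jordanU_apply, hMM, zero_mul, mul_zero, add_zero, sub_zero]
  ext i j
  fin_cases i <;> fin_cases j <;>
    simp only [Matrix.add_apply, Matrix.smul_apply, Matrix.mul_apply, Fin.sum_univ_three, h00, h01,
      h02, h10, h11, h12, h20, h21, h22, y00, y01, y10, y11, Fin.zero_eta, Fin.mk_one,
      Fin.reduceFinMk, mul_zero, zero_mul, add_zero, zero_add, smul_zero, smul_mul_assoc,
      mul_smul_comm, one_mul, mul_one, mul_add, add_mul, e1, e2, e3, e4, e5, e6, f1, f2, f3, f4,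
      smul_smul] <;>
    match_scalars <;> clear * - hN <;> grind

/-- For a matrix of rank one in `J_3`, the minor of the first two rows and columns vanishes. -/
lemma minor_eq_zero {M : Matrix (Fin 3) (Fin 3) (K ⊗[k] C)} {a α β : K}
    (hM : ∃ l : K, jordanU K M (Matrix.single 0 0 1) = l • M)
    (h00 : M 0 0 = α • 1) (h11 : M 1 1 = β • 1) (h10 : M 1 0 = a • conjIn φ (M 0 1)) :
    a * normIn φ (M 0 1) = α * β := by
  obtain ⟨l, hl⟩ := hM
  have key : ∀ i j, M i 0 * M 0 j = l • M i j := fun i j => by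
    rw [← jordanU_single_apply, hl, Matrix.smul_apply]
  have e00 : α * α = l * α := h.smul_one_injective (by
    have := key 0 0
    rwa [h00, smul_mul_smul_comm, one_mul, smul_smul] at this)
  have e11 : a * normIn φ (M 0 1) = l * β := h.smul_one_injective (by
    have := key 1 1
    rwa [h10, smul_mul_assoc, h.conjIn_mul_self, h11, smul_smul, smul_smul] at this)
  have e01 : (α - l) • M 0 1 = 0 := by
    have := key 0 1
    rw [h00, smul_mul_assoc, one_mul] at this
    linear_combination (norm := module) this
  by_cases hα : α = l
  · rw [e11, hα]
  · have h01 : M 0 1 = 0 := (smul_eq_zero.mp e01).resolve_left (sub_ne_zero.mpr hα)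
    have h0 : α = 0 := by
      have : (α - l) * α = 0 := by linear_combination e00
      exact (mul_eq_zero.mp this).resolve_left (sub_ne_zero.mpr hα)
    rw [h01, h0, zero_mul, normIn, map_zero, smul_zero, mul_zero]

end ThreeByThree

/-! ### The base scheme in degree three -/

section DegreeThree

attribute [local instance] MvPolynomial.gradedAlgebra

variable {k : Type u} [Field k] [CharZero k] {C : Type v} [NonAssocRing C] [Module k C]
  [IsScalarTower k C C] [SMulCommClass k C C]
  (φ : QuadraticForm k C) {b : Fin 3 → k}

variable (b) in
/-- The quadratic form `φ ⊗ ⟨b_1⟩ ⊥ ⟨b_2⟩` on `C × k`. -/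
def planeForm : QuadraticForm k (C × k) :=
  (b 0 • φ).prod (b 1 • (QuadraticMap.sq : QuadraticForm k k))

lemma polar_planeForm (x y : C × k) : QuadraticMap.polar (planeForm φ b) x y =
    b 0 * QuadraticMap.polar φ x.1 y.1 + b 1 * (2 * x.2 * y.2) := by
  simp [planeForm, QuadraticMap.polar, QuadraticMap.prod_apply]
  ring

lemma planeForm_nondegenerate {φ : QuadraticForm k C} (h : IsCompositionAlgebra φ)
    (hb : ∀ i, b i ≠ 0) :
    (QuadraticMap.polarBilin (planeForm φ b)).Nondegenerate := by
  have hs : ∀ x, (∀ y, QuadraticMap.polar (planeForm φ b) x y = 0) → x = 0 := fun x hx => by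
    refine Prod.ext (h.nondegenerate.1 _ fun c => ?_) ?_
    · have := hx (c, 0)
      rw [polar_planeForm] at this
      simpa [hb 0] using this
    · have := hx (0, 1)
      rw [polar_planeForm] at this
      simpa [hb 1] using this
  refine ⟨hs, fun y hy => hs y fun x => ?_⟩
  rw [QuadraticMap.polar_comm]
  exact hy x

lemma evalIn_planeForm [Module.Finite k C] {B : Type*} [CommRing B] [Algebra k B]
    (x : B ⊗[k] (C × k)) : evalIn x (quadForm (planeForm φ b)) =
      b 0 • normIn φ ((LinearMap.fst k C k).baseChange B x) +
      b 1 • dualExt B (LinearMap.snd k C k) x ^ 2 := by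
  have h1 : ∀ y : B ⊗[k] (C × k),
      LinearMap.BilinForm.baseChange B (QuadraticMap.polarBilin (planeForm φ b)) x y =
      b 0 • polarIn φ ((LinearMap.fst k C k).baseChange B x)
        ((LinearMap.fst k C k).baseChange B y) +
      b 1 • (2 * dualExt B (LinearMap.snd k C k) x * dualExt B (LinearMap.snd k C k) y) := by
    intro y
    induction x with
    | zero => simp
    | add x x' hx hx' =>
      simp only [map_add, LinearMap.add_apply, hx, hx', smul_add, mul_add, add_mul]
      abel
    | tmul a v =>
      induction y with
      | zero => simp
      | add y y' hy hy' => simp only [map_add, hy, hy', smul_add, mul_add]; abel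
      | tmul a' w =>
        simp only [LinearMap.BilinForm.baseChange_tmul, QuadraticMap.polarBilin_apply_apply,
          polar_planeForm, LinearMap.baseChange_tmul, LinearMap.fst_apply, dualExt_tmul,
          LinearMap.snd_apply, polarIn_tmul, Algebra.smul_def, map_add, map_mul, map_ofNat]
        ring
  rw [evalIn_quadForm, h1, normIn]
  simp only [Algebra.smul_def]
  have h2 := algebraMap_inv_two_mul_two k B
  linear_combination (algebraMap k B (b 1) * dualExt B (LinearMap.snd k C k) x ^ 2) * h2

end DegreeThree

section DegreeThree

attribute [local instance] MvPolynomial.gradedAlgebra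

variable {k : Type u} [Field k] [CharZero k] {C : Type v} [NonAssocRing C] [Module k C]
  [IsScalarTower k C C] [SMulCommClass k C C] [Nontrivial C]
  {φ : QuadraticForm k C} (h : IsCompositionAlgebra φ) {b : Fin 3 → k} (hb : ∀ i, b i ≠ 0)
  {B : Type*} [CommRing B] [Algebra k B]

/-- The traceless matrix in `J_3` with last row zero and first row `(t, c, 0)`. -/
def planeIncl : C × k →ₗ[k] symMatrices φ b :=
  LinearMap.codRestrict _
    { toFun := fun x => !![x.2 • 1, x.1, 0; ((b 1)⁻¹ * b 0) • conj φ x.1, -x.2 • 1, 0; 0, 0, 0]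
      map_add' := fun x y => by
        ext i j
        fin_cases i <;> fin_cases j <;> simp [add_smul, add_comm]
      map_smul' := fun a x => by
        ext i j
        fin_cases i <;> fin_cases j <;> simp [smul_smul, mul_comm] }
    (fun x i j => by
      have h0 := hb 0
      have h1 := hb 1
      have h2 := hb 2
      fin_cases i <;> fin_cases j <;> simp [h.conj_one, h.conj_conj, smul_smul, h0, h1])

lemma coe_planeIncl (w : C × k) : (planeIncl h hb w : Matrix (Fin 3) (Fin 3) C) =
    !![w.2 • 1, w.1, 0; ((b 1)⁻¹ * b 0) • conj φ w.1, -w.2 • 1, 0; 0, 0, 0] := rfl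

/-- The projection from `J_3` that takes a matrix `x` to `x_{12}` and to the scalar `x_{11}`. -/
def planeProj (φ : QuadraticForm k C) (b : Fin 3 → k) : symMatrices φ b →ₗ[k] C × k :=
  (entry φ b 0 1).prod (entryScalar φ b 0)

lemma planeProj_planeIncl (w : C × k) : planeProj φ b (planeIncl h hb w) = w := by
  refine Prod.ext rfl ?_
  change (2⁻¹ : k) * QuadraticMap.polar φ (w.2 • 1) 1 = w.2
  rw [QuadraticMap.polar_smul_left, h.polar_one_one]
  simp [mul_comm]

lemma matIn_planeIncl (x : B ⊗[k] (C × k)) :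
    matIn φ b ((planeIncl h hb).baseChange B x) =
      !![dualExt B (LinearMap.snd k C k) x • 1, (LinearMap.fst k C k).baseChange B x, 0;
        algebraMap k B ((b 1)⁻¹ * b 0) • conjIn φ ((LinearMap.fst k C k).baseChange B x),
        (-dualExt B (LinearMap.snd k C k) x) • 1, 0; 0, 0, 0] := by
  induction x with
  | zero => ext i j; fin_cases i <;> fin_cases j <;> simp [matIn_zero]
  | add x y hx hy =>
    rw [map_add, matIn_add, hx, hy]
    ext i j
    fin_cases i <;> fin_cases j <;> simp [add_smul, add_comm]
    module
  | tmul a w =>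
    ext i j
    rw [LinearMap.baseChange_tmul, matIn_tmul, coe_planeIncl]
    fin_cases i <;> fin_cases j <;>
      simp [Algebra.TensorProduct.one_def, TensorProduct.smul_tmul', TensorProduct.tmul_smul,
        Algebra.smul_def, TensorProduct.tmul_neg, TensorProduct.neg_tmul]

variable [Module.Finite k C]

/-- The points of the quadric `b_1 φ(c) + b_2 t^2 = 0` give traceless elements of rank one. -/
lemma planeIncl_mem {K : Type u} [Field K] [Algebra k K] {x : K ⊗[k] (C × k)}
    (hx : evalIn x (quadForm (planeForm φ b)) = 0) :
    IsRankLeOne K φ b ((planeIncl h hb).baseChange K x) ∧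
      IsTraceless K φ b ((planeIncl h hb).baseChange K x) := by
  have : CharZero K := charZero_of_injective_algebraMap (algebraMap k K).injective
  constructor
  · rw [isRankLeOne_iff h hb]
    intro M hM
    have hN : algebraMap k K ((b 1)⁻¹ * b 0) * normIn φ ((LinearMap.fst k C k).baseChange K x) =
        -(dualExt K (LinearMap.snd k C k) x * dualExt K (LinearMap.snd k C k) x) := by
      rw [evalIn_planeForm] at hx
      simp only [Algebra.smul_def] at hx
      have h1 : algebraMap k K (b 1)⁻¹ * algebraMap k K (b 1) = 1 := by
        rw [← map_mul, inv_mul_cancel₀ (hb 1), map_one]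
      rw [map_mul]
      linear_combination algebraMap k K (b 1)⁻¹ * hx -
        (dualExt K (LinearMap.snd k C k) x * dualExt K (LinearMap.snd k C k) x) * h1
    refine ⟨_, jordanU_block h hN (p := (2⁻¹ : k) • polarIn φ (M 0 0) 1)
      (s := (2⁻¹ : k) • polarIn φ (M 1 1) 1) (g := M 0 1) ?_ ?_ ?_ ?_ ?_ ?_ ?_ ?_ ?_
      (diag_eq_smul_one h hb hM 0) rfl ?_ (diag_eq_smul_one h hb hM 1)⟩
    any_goals rw [matIn_planeIncl]; rfl
    have := congrArg ((b 1)⁻¹ • ·) (hM 1 0)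
    simp only [inv_smul_smul₀ (hb 1)] at this
    rw [← this, smul_smul, algebraMap_smul]
  · rw [isTraceless_iff, matIn_planeIncl, Fin.sum_univ_three]
    change dualExt K (LinearMap.snd k C k) x • (1 : K ⊗[k] C) +
      (-dualExt K (LinearMap.snd k C k) x) • 1 + 0 = 0
    module

include h hb

lemma pullback_planeProj_mem :
    pullback (planeProj φ b) (quadForm (planeForm φ b)) ∈ (idealZ2 φ b).toIdeal := by
  have h1 : pullback (planeProj φ b) (quadForm (planeForm φ b)) - b 1 •
      (linForm (entryScalar φ b 0) * (linForm (entryScalar φ b 0) + linForm (entryScalar φ b 1))) ∈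
      (idealZ2 φ b).toIdeal := by
    refine idealXJ_le_idealZ2 ?_
    rw [mem_idealXJ]
    intro x hx _
    rw [isRankLeOne_iff h hb] at hx
    have hE : IsHermitian φ b (Matrix.single 0 0 (1 : AlgebraicClosure k ⊗[k] C)) := by
      intro i j
      fin_cases i <;> fin_cases j <;> simp [h.conjIn_one]
    have h10 : matIn φ b x 1 0 =
        algebraMap k (AlgebraicClosure k) ((b 1)⁻¹ * b 0) • conjIn φ (matIn φ b x 0 1) := by
      have := congrArg ((b 1)⁻¹ • ·) (isHermitian_matIn hb x 1 0)
      simp only [inv_smul_smul₀ (hb 1)] at this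
      rw [← this, smul_smul, algebraMap_smul]
    have h2 := minor_eq_zero h (hx _ hE) (diag_eq_dualExt h hb 0 x) (diag_eq_dualExt h hb 1 x) h10
    have e1 : (LinearMap.fst k C k).baseChange (AlgebraicClosure k)
        ((planeProj φ b).baseChange (AlgebraicClosure k) x) = matIn φ b x 0 1 := by
      rw [← LinearMap.comp_apply, ← LinearMap.baseChange_comp, ← baseChange_entry]
      rfl
    have e2 : dualExt (AlgebraicClosure k) (LinearMap.snd k C k)
        ((planeProj φ b).baseChange (AlgebraicClosure k) x) =
        dualExt (AlgebraicClosure k) (entryScalar φ b 0) x := by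
      rw [← dualExt_comp]
      rfl
    simp only [map_sub, evalIn_pullback, evalIn_planeForm, e1, e2, map_smul, map_mul, map_add,
      evalIn_linForm]
    have h3 : algebraMap k (AlgebraicClosure k) (b 1) * algebraMap k (AlgebraicClosure k) (b 1)⁻¹
        = 1 := by
      rw [← map_mul, mul_inv_cancel₀ (hb 1), map_one]
    rw [map_mul] at h2
    simp only [Algebra.smul_def]
    linear_combination algebraMap k (AlgebraicClosure k) (b 1) * h2 -
      algebraMap k (AlgebraicClosure k) (b 0) * normIn φ (matIn φ b x 0 1) * h3
  have h2 : linForm (entryScalar φ b 0) + linForm (entryScalar φ b 1) ∈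
      (idealZ2 φ b).toIdeal := by
    have h3 := idealXJ_le_idealZ2 (linForm_trace_mem h hb)
    have h4 : linForm (entryScalar φ b 2) ∈ (idealZ2 φ b).toIdeal :=
      linForm_mem_idealZ2 fun x hx => by
        change (2⁻¹ : k) • (QuadraticMap.polarBilin φ).flip 1 (x.1 2 2) = 0
        rw [show x.1 2 2 = 0 from hx 2, map_zero, smul_zero]
    have h5 : linForm (∑ i, entryScalar φ b i) = ∑ i, linForm (entryScalar φ b i) :=
      map_sum (linFormₗ k _) _ _
    rw [h5, Fin.sum_univ_three] at h3
    simpa using sub_mem h3 h4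
  have h3 := add_mem h1 (Submodule.smul_of_tower_mem _ (b 1) (Ideal.mul_mem_left _
    (linForm (entryScalar φ b 0)) h2))
  rwa [sub_add_cancel] at h3

/-- On `Z_2` every matrix agrees with its projection to the plane part: the remaining
coordinates lie in the last row, except for `x_{22}`, which is `-x_{11}` up to the trace. -/
lemma sub_pullback_plane_mem (f : CoordRing k (symMatrices φ b)) :
    f - pullback (planeIncl h hb ∘ₗ planeProj φ b) f ∈ (idealZ2 φ b).toIdeal := by
  refine sub_pullback_mem _ _ (fun ℓ => ?_) f
  let E : symMatrices φ b := ⟨Matrix.single 1 1 1, fun i j => by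
    fin_cases i <;> fin_cases j <;> simp [h.conj_one, smul_smul, hb 1]⟩
  have h1 : linForm (ℓ - ℓ ∘ₗ (planeIncl h hb ∘ₗ planeProj φ b) -
      ℓ E • ∑ i, entryScalar φ b i) ∈ (idealZ2 φ b).toIdeal := by
    refine linForm_mem_idealZ2 fun x hx => ?_
    have hτ : ∀ i, x.1 i i = entryScalar φ b i x • (1 : C) := fun i => by
      have hc : conj φ (x.1 i i) = x.1 i i := by
        have := x.2 i i
        rwa [inv_smul_smul₀ (hb i)] at this
      rw [conj_apply, sub_eq_iff_eq_add, ← two_smul k] at hc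
      change _ = ((2⁻¹ : k) * QuadraticMap.polar φ (x.1 i i) 1) • (1 : C)
      rw [mul_smul, hc, inv_smul_smul₀ two_ne_zero]
    have hcol : ∀ i, x.1 i 2 = 0 := fun i => by
      rw [← x.2 i 2, show x.1 2 i = 0 from hx i, map_zero, smul_zero, smul_zero]
    have hdec : x = planeIncl h hb (planeProj φ b x) + (∑ i, entryScalar φ b i) x • E := by
      ext i j
      have h22 : entryScalar φ b 2 x = 0 := by
        change (2⁻¹ : k) • (QuadraticMap.polarBilin φ).flip 1 (x.1 2 2) = 0
        rw [hcol, map_zero, smul_zero]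
      have h10 : x.1 1 0 = ((b 1)⁻¹ * b 0) • conj φ (x.1 0 1) := by rw [mul_smul, x.2 1 0]
      have hrow : ∀ j, x.1 2 j = 0 := hx
      fin_cases i <;> fin_cases j <;>
        simp [coe_planeIncl, planeProj, E, Fin.sum_univ_three, h22, hτ, hcol, hrow, h10,
          entry_apply, add_smul]
    change ℓ x - ℓ (planeIncl h hb (planeProj φ b x)) - ℓ E * (∑ i, entryScalar φ b i) x = 0
    have := congrArg ℓ hdec
    rw [map_add, map_smul, smul_eq_mul] at this
    linear_combination this
  have h2 : linForm (ℓ E • ∑ i, entryScalar φ b i) ∈ (idealZ2 φ b).toIdeal := by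
    change linFormₗ k _ _ ∈ _
    rw [map_smul]
    exact Submodule.smul_of_tower_mem _ _ (idealXJ_le_idealZ2 (linForm_trace_mem h hb))
  have h3 := add_mem h1 h2
  change linFormₗ k _ _ + linFormₗ k _ _ ∈ _ at h3
  rwa [← map_add, sub_add_cancel] at h3

/-- In degree three `Z_2` is the quadric: restriction of polynomial functions along `planeIncl` is
an isomorphism of homogeneous coordinate rings, inverse to composition with `planeProj`. -/
lemma nonempty_Z2_iso_quadric (hr : 2 ≤ Module.finrank k (C × k)) :
    Nonempty (Z2 φ b ≅ quadric (planeForm φ b)) := by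
  have hrad := isRadical_span_quadForm (planeForm_nondegenerate h hb) hr
  refine nonempty_projScheme_iso (idealZ2 φ b) _ (pullback (planeIncl h hb))
    (fun n f hf => pullback_mem _ hf) (fun n g hg => ⟨pullback (planeProj φ b) g,
      pullback_mem _ hg, ?_⟩) (fun f hf => ?_) (T := id) (by simp) (fun _ n f hf hfJ => ⟨0, ?_⟩)
  · rw [pullback_pullback]
    convert pullback_id g
    exact LinearMap.ext (planeProj_planeIncl h hb)
  · refine map_mem_of_mem_idealZ2 (pullback (planeIncl h hb)) _ (fun f hf => ?_) (fun ℓ hℓ => ?_) hf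
    · refine mem_span_of_vanishing hrad fun x hx => ?_
      rw [evalIn_pullback]
      obtain ⟨h1, h2⟩ := planeIncl_mem h hb hx
      exact mem_idealXJ.mp hf _ h1 h2
    · obtain ⟨j, μ, hμ⟩ := hℓ
      have h0 : ℓ ∘ₗ planeIncl h hb = 0 := by
        refine LinearMap.ext fun w => ?_
        rw [LinearMap.comp_apply, hμ]
        have : (planeIncl h hb w).1 (Fin.last 2) j = 0 := by
          fin_cases j <;> rfl
        rw [this, map_zero, LinearMap.zero_apply]
      rw [pullback_linForm, h0]
      change linFormₗ k _ 0 ∈ _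
      rw [map_zero]
      exact zero_mem _
  · rw [pow_zero, one_mul]
    have h1 := sub_pullback_plane_mem h hb f
    rw [← pullback_pullback] at h1
    obtain ⟨g, hg⟩ := Ideal.mem_span_singleton.mp hfJ
    rw [hg, map_mul] at h1
    have h2 := add_mem h1 (Ideal.mul_mem_right (pullback (planeProj φ b) g) _
      (pullback_planeProj_mem h hb))
    rwa [sub_add_cancel] at h2

end DegreeThree

/-! ### The Veronese map over an associative composition algebra -/

section Associative

variable {k : Type u} [Field k] {C : Type v} [Ring C] [Module k C]
  [IsScalarTower k C C] [SMulCommClass k C C] {B : Type*} [CommRing B] [Algebra k B]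
  {B' : Type*} [CommRing B'] [Algebra k B']

lemma tensor_mul_assoc (x y z : B ⊗[k] C) : (x * y) * z = x * (y * z) := by
  induction x with
  | zero => simp
  | add x x' hx hx' => simp only [add_mul, hx, hx']
  | tmul a u =>
    induction y with
    | zero => simp
    | add y y' hy hy' => simp only [add_mul, mul_add, hy, hy']
    | tmul b v =>
      induction z with
      | zero => simp
      | add z z' hz hz' => simp only [mul_add, hz, hz']
      | tmul c w => simp only [Algebra.TensorProduct.tmul_mul_tmul, mul_assoc]

/-- The ring structure of `B ⊗ C`, extending its structure of a non-associative ring. It is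
needed because `C` carries no bundled `k`-algebra structure here. -/
instance tensorRing : Ring (B ⊗[k] C) :=
  { (inferInstance : NonAssocRing (B ⊗[k] C)) with
    mul_assoc := tensor_mul_assoc }

variable {φ : QuadraticForm k C} {n : ℕ} {b : Fin n → k}

variable (φ b) in
/-- The row vector `c̄ᵗ Γ` of a column vector `c` over `B ⊗ C`. -/
def dagger (c : Fin n → B ⊗[k] C) : Fin n → B ⊗[k] C := fun j => b j • conjIn φ (c j)

variable (φ b) in
/-- The matrix `c c̄ᵗ Γ` of the Veronese map over `B ⊗ C`. -/
def veroneseIn (c : Fin n → B ⊗[k] C) : Matrix (Fin n) (Fin n) (B ⊗[k] C) :=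
  Matrix.vecMulVec c (dagger φ b c)

lemma veroneseIn_apply (c : Fin n → B ⊗[k] C) (i j : Fin n) :
    veroneseIn φ b c i j = c i * b j • conjIn φ (c j) := rfl

lemma dagger_smul (a : B) (c : Fin n → B ⊗[k] C) : dagger φ b (a • c) = a • dagger φ b c := by
  ext j
  simp [dagger, smul_comm (b j) a]

lemma veroneseIn_smul (a : B) (c : Fin n → B ⊗[k] C) :
    veroneseIn φ b (a • c) = a ^ 2 • veroneseIn φ b c := by
  ext i j
  simp only [veroneseIn, Matrix.vecMulVec_apply, dagger_smul, Matrix.smul_apply, Pi.smul_apply,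
    smul_mul_smul_comm, sq]

variable (φ b) in
/-- The scalar `α` with `d̄ᵗ Γ M d = α 1`, for a hermitian matrix `M`. -/
def hermVal (d : Fin n → B ⊗[k] C) (M : Matrix (Fin n) (Fin n) (B ⊗[k] C)) : B :=
  (2⁻¹ : k) • polarIn φ (dagger φ b d ⬝ᵥ M.mulVec d) 1

lemma jordanU_eq_mul_mul {K : Type*} [Field K] [CharZero K] {M : Type*} [Ring M] [Module K M]
    [IsScalarTower K M M] [SMulCommClass K M M] (x y : M) : jordanU K x y = x * y * x := by
  refine smul_right_injective _ (two_ne_zero (α := K)) ?_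
  change (2 : K) • jordanU K x y = (2 : K) • (x * y * x)
  rw [jordanU_apply, two_smul]
  simp only [mul_assoc]
  abel

lemma mapPt_k_smul (g : B →ₐ[k] B') (a : k) (x : B ⊗[k] C) :
    mapPt C g (a • x) = a • mapPt C g x := map_smul _ a x

lemma mapPt_veroneseIn (g : B →ₐ[k] B') (c : Fin n → B ⊗[k] C) (i j : Fin n) :
    mapPt C g (veroneseIn φ b c i j) = veroneseIn φ b (fun l => mapPt C g (c l)) i j := by
  simp only [veroneseIn_apply, mapPt_mul, mapPt_k_smul, mapPt_conjIn]

lemma mapPt_mulVec (g : B →ₐ[k] B') (M : Matrix (Fin n) (Fin n) (B ⊗[k] C))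
    (d : Fin n → B ⊗[k] C) (i : Fin n) :
    mapPt C g (M.mulVec d i) = (M.map (mapPt C g)).mulVec (fun l => mapPt C g (d l)) i := by
  simp only [Matrix.mulVec, dotProduct, map_sum, mapPt_mul, Matrix.map_apply]

lemma map_hermVal (g : B →ₐ[k] B') (M : Matrix (Fin n) (Fin n) (B ⊗[k] C))
    (d : Fin n → B ⊗[k] C) :
    g (hermVal φ b d M) = hermVal φ b (fun l => mapPt C g (d l)) (M.map (mapPt C g)) := by
  rw [hermVal, map_smul, map_polarIn, mapPt_one, hermVal]
  simp only [dotProduct, map_sum, mapPt_mul, dagger, mapPt_k_smul, mapPt_conjIn, mapPt_mulVec]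

section

variable [CharZero k] [Nontrivial C] (h : IsCompositionAlgebra φ)

include h

lemma isHermitian_veroneseIn (c : Fin n → B ⊗[k] C) : IsHermitian φ b (veroneseIn φ b c) := by
  intro i j
  simp only [veroneseIn_apply, h.conjIn_mul, LinearMap.map_smul_of_tower, h.conjIn_conjIn,
    mul_smul_comm, smul_comm (b j)]

lemma dagger_mulVec {M : Matrix (Fin n) (Fin n) (B ⊗[k] C)} (hM : IsHermitian φ b M)
    (d : Fin n → B ⊗[k] C) : dagger φ b (M.mulVec d) = Matrix.vecMul (dagger φ b d) M := by
  ext j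
  simp only [dagger, Matrix.mulVec, Matrix.vecMul, dotProduct, map_sum, Finset.smul_sum,
    h.conjIn_mul]
  refine Finset.sum_congr rfl fun l _ => ?_
  rw [smul_mul_assoc, ← mul_smul_comm, ← mul_smul_comm, hM l j]

lemma conjIn_dagger_dotProduct (c e : Fin n → B ⊗[k] C) :
    conjIn φ (dagger φ b c ⬝ᵥ e) = dagger φ b e ⬝ᵥ c := by
  simp only [dagger, dotProduct, map_sum, h.conjIn_mul, LinearMap.map_smul_of_tower,
    h.conjIn_conjIn, smul_mul_assoc]

lemma dagger_dotProduct_mulVec {M : Matrix (Fin n) (Fin n) (B ⊗[k] C)} (hM : IsHermitian φ b M)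
    (d : Fin n → B ⊗[k] C) : dagger φ b d ⬝ᵥ M.mulVec d = hermVal φ b d M • 1 := by
  refine h.eq_smul_one ?_
  rw [conjIn_dagger_dotProduct h, dagger_mulVec h hM, Matrix.dotProduct_mulVec]

lemma mul_veroneseIn_mul {M : Matrix (Fin n) (Fin n) (B ⊗[k] C)} (hM : IsHermitian φ b M)
    (d : Fin n → B ⊗[k] C) : M * veroneseIn φ b d * M = veroneseIn φ b (M.mulVec d) := by
  rw [veroneseIn, Matrix.mul_vecMulVec, Matrix.vecMulVec_mul, veroneseIn, dagger_mulVec h hM]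

lemma veroneseIn_mul_mul {M : Matrix (Fin n) (Fin n) (B ⊗[k] C)} (hM : IsHermitian φ b M)
    (c : Fin n → B ⊗[k] C) :
    veroneseIn φ b c * M * veroneseIn φ b c = hermVal φ b c M • veroneseIn φ b c := by
  rw [veroneseIn, Matrix.vecMulVec_mul, Matrix.vecMulVec_mul_vecMulVec, ← Matrix.dotProduct_mulVec,
    dagger_dotProduct_mulVec h hM]
  ext i j
  simp only [Matrix.vecMulVec_apply, Pi.smul_apply, smul_eq_mul, smul_mul_assoc, one_mul,
    mul_smul_comm, Matrix.smul_apply]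

lemma veroneseIn_mulVec {M : Matrix (Fin n) (Fin n) (B ⊗[k] C)} (hM : IsHermitian φ b M)
    (d : Fin n → B ⊗[k] C) : (veroneseIn φ b (M.mulVec d)).mulVec d =
      hermVal φ b d M • M.mulVec d := by
  rw [veroneseIn, Matrix.vecMulVec_mulVec, dagger_mulVec h hM, ← Matrix.dotProduct_mulVec,
    dagger_dotProduct_mulVec h hM]
  ext i
  simp

/-- An element `x` of rank one satisfies `(x d) (x d)^* = (d^* x d) x` for all column vectors `d`,
where `d^* = d̄ᵗ Γ`; so it is a value of the Veronese map, up to a factor. -/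
lemma veroneseIn_mulVec_eq {K : Type*} [Field K] [Algebra k K]
    {M : Matrix (Fin n) (Fin n) (K ⊗[k] C)} (hM : IsHermitian φ b M) (d : Fin n → K ⊗[k] C)
    (hr : ∃ l : K, jordanU K M (veroneseIn φ b d) = l • M) :
    veroneseIn φ b (M.mulVec d) = hermVal φ b d M • M := by
  have : CharZero K := charZero_of_injective_algebraMap (algebraMap k K).injective
  obtain ⟨l, hl⟩ := hr
  rw [jordanU_eq_mul_mul, mul_veroneseIn_mul h hM] at hl
  set α := hermVal φ b d M with hα
  have h1 : α • M.mulVec d = l • M.mulVec d := by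
    rw [← veroneseIn_mulVec h hM, hl, Matrix.smul_mulVec]
  have h2 : α * α = l * α := by
    refine h.smul_one_injective ?_
    have := congrArg (dagger φ b d ⬝ᵥ ·) h1
    simpa only [dotProduct_smul, dagger_dotProduct_mulVec h hM, smul_smul] using this
  by_cases h0 : α = 0
  · rw [h0, zero_smul] at h1
    rcases smul_eq_zero.mp h1.symm with hl0 | hd
    · rw [hl, hl0, h0]
    · rw [hd, h0, zero_smul]
      ext i j
      simp [veroneseIn_apply]
  · rw [hl, mul_right_cancel₀ h0 h2]

lemma trace_veroneseIn (c : Fin n → B ⊗[k] C) :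
    ∑ i, veroneseIn φ b c i i = (∑ i, b i • normIn φ (c i)) • 1 := by
  simp only [veroneseIn_apply, mul_smul_comm, h.mul_conjIn, Finset.sum_smul, smul_assoc]

lemma dagger_dotProduct_add (c e : Fin n → B ⊗[k] C) :
    dagger φ b c ⬝ᵥ e + dagger φ b e ⬝ᵥ c = (∑ i, b i • polarIn φ (c i) (e i)) • 1 := by
  simp only [dagger, dotProduct, smul_mul_assoc, Finset.sum_smul, smul_assoc,
    ← Finset.sum_add_distrib, ← smul_add]
  refine Finset.sum_congr rfl fun i _ => ?_
  have := h.mul_conjIn_mul_add (conjIn φ (c i)) (conjIn φ (e i)) 1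
  rw [h.conjIn_conjIn, h.conjIn_conjIn, h.polarIn_conjIn_conjIn, mul_one, mul_one] at this
  rw [this]

end

section Vectors

variable (k C n) in
/-- The column vector over `B ⊗ C` of an element of `B ⊗ C^n`. -/
def vecIn (w : B ⊗[k] (Fin n → C)) : Fin n → B ⊗[k] C :=
  fun i => (LinearMap.proj (R := k) (φ := fun _ : Fin n => C) i).baseChange B w

lemma exists_vecIn_eq (c : Fin n → B ⊗[k] C) : ∃ w, vecIn k C n w = c := by
  refine ⟨∑ i, (LinearMap.single k (fun _ : Fin n => C) i).baseChange B (c i), ?_⟩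
  ext j
  simp only [vecIn, map_sum, ← LinearMap.comp_apply, ← LinearMap.baseChange_comp]
  rw [Finset.sum_eq_single j]
  · rw [LinearMap.proj_comp_single_same, LinearMap.baseChange_id, LinearMap.id_apply]
  · intro i _ hi
    rw [LinearMap.proj_comp_single_ne _ _ _ _ hi.symm, LinearMap.baseChange_zero,
      LinearMap.zero_apply]
  · simp

lemma vecIn_mapPt (g : B →ₐ[k] B') (w : B ⊗[k] (Fin n → C)) (i : Fin n) :
    vecIn k C n (mapPt _ g w) i = mapPt C g (vecIn k C n w i) := by
  rw [vecIn, vecIn, mapPt_baseChange]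

lemma vecIn_tmul (a : B) (d : Fin n → C) : vecIn k C n (a ⊗ₜ[k] d) = fun i => a ⊗ₜ d i := rfl

variable (φ b) in
/-- The hermitian form `∑ b_i φ(c_i)` on `C^n`. -/
def hermForm : QuadraticForm k (Fin n → C) :=
  ∑ i, b i • φ.comp (LinearMap.proj (R := k) (φ := fun _ : Fin n => C) i)

lemma polar_hermForm (c e : Fin n → C) :
    QuadraticMap.polar (hermForm φ b) c e = ∑ i, b i * QuadraticMap.polar φ (c i) (e i) := by
  simp only [hermForm, QuadraticMap.polar, _root_.sum_apply, _root_.smul_apply,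
    QuadraticMap.comp_apply, LinearMap.proj_apply, Pi.add_apply, smul_eq_mul,
    ← Finset.sum_sub_distrib]
  exact Finset.sum_congr rfl fun i _ => by ring

lemma hermForm_nondegenerate (h : IsCompositionAlgebra φ) (hb : ∀ i, b i ≠ 0) :
    (QuadraticMap.polarBilin (hermForm φ b)).Nondegenerate := by
  have hs : ∀ x, (∀ y, QuadraticMap.polar (hermForm φ b) x y = 0) → x = 0 := fun x hx => by
    ext i
    refine h.nondegenerate.1 _ fun c => ?_
    have := hx (Pi.single i c)
    rw [polar_hermForm, Finset.sum_eq_single i] at this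
    · simpa [hb i] using this
    · intro j _ hj
      simp [Pi.single_eq_of_ne hj]
    · simp
  refine ⟨hs, fun y hy => hs y fun x => ?_⟩
  rw [QuadraticMap.polar_comm]
  exact hy x

lemma baseChange_polar_hermForm (x y : B ⊗[k] (Fin n → C)) :
    LinearMap.BilinForm.baseChange B (QuadraticMap.polarBilin (hermForm φ b)) x y =
      ∑ i, b i • polarIn φ (vecIn k C n x i) (vecIn k C n y i) := by
  induction x with
  | zero => simp [vecIn]
  | add x x' hx hx' =>
    rw [map_add, LinearMap.add_apply, hx, hx', ← Finset.sum_add_distrib]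
    simp only [vecIn, map_add, LinearMap.add_apply, smul_add]
  | tmul a v =>
    induction y with
    | zero => simp [vecIn]
    | add y y' hy hy' =>
      rw [map_add, hy, hy', ← Finset.sum_add_distrib]
      simp only [vecIn, map_add, smul_add]
    | tmul a' w =>
      simp only [LinearMap.BilinForm.baseChange_tmul, QuadraticMap.polarBilin_apply_apply,
        polar_hermForm, vecIn_tmul, polarIn_tmul, Finset.sum_smul, mul_smul]

lemma evalIn_hermForm [Module.Finite k C] [CharZero k] (x : B ⊗[k] (Fin n → C)) :
    evalIn x (quadForm (hermForm φ b)) = ∑ i, b i • normIn φ (vecIn k C n x i) := by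
  rw [evalIn_quadForm, baseChange_polar_hermForm, Finset.smul_sum]
  simp only [normIn, smul_comm (2⁻¹ : k)]

end Vectors

end Associative

/-! ### Points of `X(J)` and the ideal of `X(J)` -/

section VeronesePoints

attribute [local instance] MvPolynomial.gradedAlgebra

variable {k : Type u} [Field k] [CharZero k] {C : Type v} [Ring C] [Module k C]
  [IsScalarTower k C C] [SMulCommClass k C C] [Nontrivial C]
  {B : Type*} [CommRing B] [Algebra k B] {B' : Type*} [CommRing B'] [Algebra k B']
  {φ : QuadraticForm k C} (h : IsCompositionAlgebra φ) {n : ℕ} {b : Fin n → k}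
  (hb : ∀ i, b i ≠ 0)

lemma matIn_mapPt_eq_map (g : B →ₐ[k] B') (x : B ⊗[k] symMatrices φ b) :
    (matIn φ b x).map (mapPt C g) = matIn φ b (mapPt _ g x) := by
  ext i j
  rw [matIn_mapPt, Matrix.map_apply]

lemma mapPt_veronese_mulVec (g : B →ₐ[k] B') (x : B ⊗[k] symMatrices φ b) (d : Fin n → C)
    (i j : Fin n) :
    mapPt C g (veroneseIn φ b ((matIn φ b x).mulVec (fun i => 1 ⊗ₜ d i)) i j) =
      veroneseIn φ b ((matIn φ b (mapPt _ g x)).mulVec (fun i => 1 ⊗ₜ d i)) i j := by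
  simp only [mapPt_veroneseIn, mapPt_mulVec, matIn_mapPt_eq_map, mapPt_tmul, map_one]

lemma map_hermVal_tmul (g : B →ₐ[k] B') (x : B ⊗[k] symMatrices φ b) (d : Fin n → C) :
    g (hermVal φ b (fun i => 1 ⊗ₜ d i) (matIn φ b x)) =
      hermVal φ b (fun i => 1 ⊗ₜ d i) (matIn φ b (mapPt _ g x)) := by
  simp only [map_hermVal, matIn_mapPt_eq_map, mapPt_tmul, map_one]

/-- The Veronese map on points with values in `B`. -/
def veronesePt (w : B ⊗[k] (Fin n → C)) : B ⊗[k] symMatrices φ b :=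
  (exists_matIn_eq h hb (isHermitian_veroneseIn (b := b) h (vecIn k C n w))).choose

lemma matIn_veronesePt (w : B ⊗[k] (Fin n → C)) :
    matIn φ b (veronesePt h hb w) = veroneseIn φ b (vecIn k C n w) :=
  (exists_matIn_eq h hb (isHermitian_veroneseIn (b := b) h (vecIn k C n w))).choose_spec

lemma mapPt_veronesePt (g : B →ₐ[k] B') (w : B ⊗[k] (Fin n → C)) :
    mapPt _ g (veronesePt h hb w) = veronesePt h hb (mapPt _ g w) := by
  refine matIn_injective h hb ?_
  ext i j
  rw [matIn_mapPt, matIn_veronesePt, matIn_veronesePt, mapPt_veroneseIn]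
  simp only [← vecIn_mapPt]

variable [Module.Finite k C]

/-- Composition of polynomial functions on `J` with the Veronese map. -/
def veroneseHom : CoordRing k (symMatrices φ b) →ₐ[k] CoordRing k (Fin n → C) :=
  evalIn (veronesePt h hb (genericPt k (Fin n → C)))

lemma evalIn_veroneseHom (w : B ⊗[k] (Fin n → C)) (f : CoordRing k (symMatrices φ b)) :
    evalIn w (veroneseHom h hb f) = evalIn (veronesePt h hb w) f := by
  rw [veroneseHom, map_evalIn, mapPt_veronesePt, mapPt_evalIn_genericPt]

lemma trace_veronesePt (w : B ⊗[k] (Fin n → C)) :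
    ∑ i, matIn φ b (veronesePt h hb w) i i = evalIn w (quadForm (hermForm φ b)) • 1 := by
  rw [matIn_veronesePt, trace_veroneseIn h, evalIn_hermForm]

/-- The Veronese map takes the quadric `∑ b_i φ(c_i) = 0` to traceless elements of rank one. -/
lemma veronesePt_mem {K : Type u} [Field K] [Algebra k K] {w : K ⊗[k] (Fin n → C)}
    (hw : evalIn w (quadForm (hermForm φ b)) = 0) :
    IsRankLeOne K φ b (veronesePt h hb w) ∧ IsTraceless K φ b (veronesePt h hb w) := by
  have : CharZero K := charZero_of_injective_algebraMap (algebraMap k K).injective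
  constructor
  · rw [isRankLeOne_iff h hb]
    intro M hM
    exact ⟨_, by rw [jordanU_eq_mul_mul, matIn_veronesePt, veroneseIn_mul_mul h hM]⟩
  · rw [isTraceless_iff, trace_veronesePt, hw, zero_smul]

variable (φ b) in
/-- The linear form `x ↦ d^* x d` on `J`, for a column vector `d` over `C`. -/
def hermLine (d : Fin n → C) : Module.Dual k (symMatrices φ b) :=
  ((2⁻¹ : k) • (QuadraticMap.polarBilin φ).flip 1) ∘ₗ
    ∑ i, ∑ j, (LinearMap.mulLeft k (b i • conj φ (d i)) ∘ₗ LinearMap.mulRight k (d j)) ∘ₗ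
      entry φ b i j

lemma dualExt_hermLine (d : Fin n → C) (x : B ⊗[k] symMatrices φ b) :
    dualExt B (hermLine φ b d) x = hermVal φ b (fun i => 1 ⊗ₜ d i) (matIn φ b x) := by
  induction x with
  | zero => simp [matIn_zero, hermVal]
  | add x y hx hy =>
    rw [map_add, hx, hy, matIn_add]
    simp only [hermVal, Matrix.add_mulVec, dotProduct_add, map_add, LinearMap.add_apply, smul_add]
  | tmul a m =>
    have h1 : dagger φ b (fun i => (1 : B) ⊗ₜ[k] d i) ⬝ᵥ
        (matIn φ b (a ⊗ₜ[k] m)).mulVec (fun i => (1 : B) ⊗ₜ[k] d i) =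
        a ⊗ₜ ∑ i, ∑ j, (b i • conj φ (d i)) * (m.1 i j * d j) := by
      simp only [dotProduct, dagger, Matrix.mulVec, matIn_tmul, conjIn_tmul, Finset.mul_sum,
        TensorProduct.tmul_sum, Algebra.TensorProduct.tmul_mul_tmul, ← TensorProduct.tmul_smul,
        one_mul, mul_one]
    rw [hermVal, h1, dualExt_tmul, Algebra.TensorProduct.one_def, polarIn_tmul, mul_one, smul_smul]
    simp only [hermLine, LinearMap.comp_apply, LinearMap.sum_apply, LinearMap.smul_apply,
      LinearMap.mulLeft_apply, LinearMap.mulRight_apply, entry_apply, smul_eq_mul,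
      LinearMap.flip_apply, QuadraticMap.polarBilin_apply_apply]

include h hb

/-- An element `x` of `J` with `d^* x d = 0` for all `d` is zero. -/
lemma eq_zero_of_hermLine {x : symMatrices φ b} (hx : ∀ d, hermLine φ b d x = 0) : x = 0 := by
  let F : (Fin n → C) → (Fin n → C) → C := fun c e =>
    ∑ i, ∑ j, (b i • conj φ (c i)) * (x.1 i j * e j)
  have hx2 : ∀ i j, b j • conj φ (x.1 j i) = b i • x.1 i j := fun i j => by
    rw [← x.2 i j, smul_inv_smul₀ (hb i)]
  have hF : ∀ d, F d d = 0 := fun d => by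
    have h1 : conj φ (F d d) = F d d := by
      simp only [F, map_sum, h.conj_mul, map_smul, h.conj_conj]
      rw [Finset.sum_comm]
      refine Finset.sum_congr rfl fun i _ => Finset.sum_congr rfl fun j _ => ?_
      rw [mul_smul_comm, ← smul_mul_assoc, ← mul_smul_comm, hx2 i j, mul_smul_comm, smul_mul_assoc,
        smul_mul_assoc, mul_assoc]
    have h2 : (2⁻¹ : k) * QuadraticMap.polar φ (F d d) 1 = 0 := by
      have := hx d
      simpa only [hermLine, LinearMap.comp_apply, LinearMap.sum_apply, LinearMap.smul_apply,
        LinearMap.mulLeft_apply, LinearMap.mulRight_apply, entry_apply, smul_eq_mul,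
        LinearMap.flip_apply, QuadraticMap.polarBilin_apply_apply] using this
    rw [conj_apply, (mul_eq_zero.mp h2).resolve_left (inv_ne_zero two_ne_zero), zero_smul,
      zero_sub, neg_eq_iff_add_eq_zero, ← two_smul k] at h1
    exact (smul_eq_zero.mp h1).resolve_left two_ne_zero
  have hF2 : ∀ c e, F c e + F e c = 0 := fun c e => by
    have h1 := hF (c + e)
    have h2 : F (c + e) (c + e) = F c c + F c e + F e c + F e e := by
      simp only [F, Pi.add_apply, map_add, smul_add, add_mul, mul_add, Finset.sum_add_distrib]
      abel
    rw [h2, hF, hF, zero_add, add_zero] at h1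
    exact h1
  have hsingle : ∀ i j u v, F (Pi.single i u) (Pi.single j v) =
      (b i • conj φ u) * (x.1 i j * v) := fun i j u v => by
    simp only [F]
    rw [Finset.sum_eq_single i, Finset.sum_eq_single j]
    · simp
    · intro j' _ hj
      simp [Pi.single_eq_of_ne hj]
    · simp
    · intro i' _ hi
      simp [Pi.single_eq_of_ne hi]
    · simp
  ext i j
  refine h.nondegenerate.1 _ fun u => ?_
  have h1 := hF2 (Pi.single i u) (Pi.single j 1)
  have h2 := h.mul_conj_mul_add (conj φ (x.1 i j)) (conj φ u) 1
  simp only [h.conj_conj, mul_one] at h2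
  have h3 : QuadraticMap.polar φ (conj φ (x.1 i j)) (conj φ u) =
      QuadraticMap.polar φ (x.1 i j) u := by
    simp only [QuadraticMap.polar, ← map_add, h.map_conj]
  rw [hsingle, hsingle, mul_one, h.conj_one, smul_mul_assoc, smul_mul_assoc, one_mul,
    ← smul_mul_assoc, ← smul_mul_assoc, ← hx2 j i, smul_mul_assoc, smul_mul_assoc, ← smul_add,
    add_comm, h2, h3, smul_eq_zero_iff_right (hb i)] at h1
  have h4 := congrArg (fun z => QuadraticMap.polar φ z 1) h1
  simpa [QuadraticMap.polar_smul_left, h.polar_one_one] using h4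

lemma span_hermLine_eq_top : Submodule.span k (Set.range (hermLine φ b)) = ⊤ := by
  refine Submodule.span_eq_top_of_ne_zero fun x hx => ?_
  by_contra! hcon
  exact hx (eq_zero_of_hermLine h hb fun d => hcon _ ⟨d, rfl⟩)

lemma eq_zero_of_dualExt_hermLine {x : B ⊗[k] symMatrices φ b}
    (hx : ∀ d, dualExt B (hermLine φ b d) x = 0) : x = 0 := by
  refine eq_zero_of_dualExt fun ℓ => ?_
  have hℓ : ℓ ∈ Submodule.span k (Set.range (hermLine φ b)) := by
    rw [span_hermLine_eq_top h hb]; exact Submodule.mem_top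
  rw [← evalIn_linForm]
  change evalIn x (linFormₗ k _ ℓ) = 0
  induction hℓ using Submodule.span_induction with
  | mem ℓ hℓ =>
    obtain ⟨d, rfl⟩ := hℓ
    exact (evalIn_linForm _ _).trans (hx d)
  | zero => simp
  | add ℓ ℓ' _ _ h1 h2 => rw [map_add, map_add, h1, h2, add_zero]
  | smul a ℓ _ h1 => rw [map_smul, map_smul, h1, smul_zero]

/-- The equation `(x d) (x d)^* = (d^* x d) x` for elements `x` of rank one over an algebraic
closure and column vectors `d` over `C`. -/
lemma rankOne_equations {x : AlgebraicClosure k ⊗[k] symMatrices φ b}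
    (hx : IsRankLeOne (AlgebraicClosure k) φ b x) (d : Fin n → C) :
    veroneseIn φ b ((matIn φ b x).mulVec (fun i => 1 ⊗ₜ d i)) =
      hermVal φ b (fun i => 1 ⊗ₜ d i) (matIn φ b x) • matIn φ b x :=
  veroneseIn_mulVec_eq h (isHermitian_matIn hb x) _
    ((isRankLeOne_iff h hb x).mp hx _ (isHermitian_veroneseIn h _))

/-- Over an algebraically closed field, every traceless element of rank one is a value of the
Veronese map on the quadric `∑ b_i φ(c_i) = 0`. -/
lemma exists_veronesePt_eq {x : AlgebraicClosure k ⊗[k] symMatrices φ b}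
    (hx : IsRankLeOne (AlgebraicClosure k) φ b x) (hx' : IsTraceless (AlgebraicClosure k) φ b x) :
    ∃ w : AlgebraicClosure k ⊗[k] (Fin n → C), evalIn w (quadForm (hermForm φ b)) = 0 ∧
      veronesePt h hb w = x := by
  obtain ⟨w, hw⟩ : ∃ w : AlgebraicClosure k ⊗[k] (Fin n → C), veronesePt h hb w = x := by
    by_cases h0 : ∀ d, dualExt (AlgebraicClosure k) (hermLine φ b d) x = 0
    · refine ⟨0, ?_⟩
      rw [eq_zero_of_dualExt_hermLine h hb h0]
      refine matIn_injective h hb ?_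
      rw [matIn_veronesePt, matIn_zero]
      ext i j
      simp [veroneseIn_apply, vecIn]
    · push Not at h0
      obtain ⟨d, hd⟩ := h0
      obtain ⟨s, hs⟩ := IsAlgClosed.exists_pow_nat_eq
        (dualExt (AlgebraicClosure k) (hermLine φ b d) x) two_pos
      have hs0 : s ^ 2 ≠ 0 := hs ▸ hd
      obtain ⟨w, hw⟩ := exists_vecIn_eq (s⁻¹ • (matIn φ b x).mulVec (fun i => 1 ⊗ₜ d i))
      refine ⟨w, matIn_injective h hb ?_⟩
      rw [matIn_veronesePt, hw, veroneseIn_smul, rankOne_equations h hb hx, ← dualExt_hermLine,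
        ← hs, smul_smul, ← mul_pow, inv_mul_cancel₀ (by rintro rfl; simp at hs0), one_pow, one_smul]
  refine ⟨w, h.smul_one_injective ?_, hw⟩
  rw [← trace_veronesePt h hb, hw, zero_smul]
  exact (isTraceless_iff x).mp hx'

/-- The ideal of `X(J)` is the preimage of the ideal of the quadric under the Veronese map. -/
lemma mem_idealXJ_iff (hn : 2 ≤ Module.finrank k (Fin n → C))
    {f : CoordRing k (symMatrices φ b)} : f ∈ (idealXJ φ b).toIdeal ↔
      veroneseHom h hb f ∈ Ideal.span {quadForm (hermForm φ b)} := by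
  rw [mem_idealXJ]
  constructor
  · intro hf
    refine mem_span_of_vanishing
      (isRadical_span_quadForm (hermForm_nondegenerate h hb) hn) fun w hw => ?_
    rw [evalIn_veroneseHom]
    obtain ⟨h1, h2⟩ := veronesePt_mem h hb hw
    exact hf _ h1 h2
  · intro hf x h1 h2
    obtain ⟨w, hw, rfl⟩ := exists_veronesePt_eq h hb h1 h2
    rw [← evalIn_veroneseHom]
    obtain ⟨g, hg⟩ := Ideal.mem_span_singleton.mp hf
    rw [hg, map_mul, hw, zero_mul]

lemma isPrime_idealXJ (hn : 3 ≤ Module.finrank k (Fin n → C)) : (idealXJ φ b).toIdeal.IsPrime := by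
  have := isPrime_span_quadForm (hermForm_nondegenerate h hb) hn
  have h1 : (idealXJ φ b).toIdeal =
      (Ideal.span {quadForm (hermForm φ b)}).comap (veroneseHom h hb) := by
    ext f
    exact mem_idealXJ_iff h hb (by omega)
  rw [h1]
  exact Ideal.comap_isPrime _ _

/-- The equations `(x d) (x d)^* = (d^* x d) x` and `tr x = 0` of traceless elements of rank one
hold at every point of `X(J)` with values in a `k`-algebra. -/
lemma equations_of_idealXJ {x : B ⊗[k] symMatrices φ b}
    (hx : ∀ f ∈ (idealXJ φ b).toIdeal, evalIn x f = 0) :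
    (∀ d : Fin n → C, veroneseIn φ b ((matIn φ b x).mulVec (fun i => 1 ⊗ₜ d i)) =
      hermVal φ b (fun i => 1 ⊗ₜ d i) (matIn φ b x) • matIn φ b x) ∧
      ∑ i, matIn φ b x i i = 0 := by
  constructor
  · intro d
    ext i j
    rw [← sub_eq_zero]
    refine eq_zero_of_dualExt fun μ => ?_
    -- the coordinates of the equation are polynomials that vanish on `X(J)`
    set X := genericPt k (symMatrices φ b) with hX
    let p : CoordRing k (symMatrices φ b) :=
      dualExt _ μ (veroneseIn φ b ((matIn φ b X).mulVec (fun i => 1 ⊗ₜ d i)) i j) -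
        dualExt _ μ (hermVal φ b (fun i => 1 ⊗ₜ d i) (matIn φ b X) • matIn φ b X i j)
    have hp : p ∈ (idealXJ φ b).toIdeal := by
      rw [mem_idealXJ]
      intro y hy _
      rw [map_sub, map_dualExt, map_dualExt, mapPt_smul, mapPt_veronese_mulVec, map_hermVal_tmul,
        ← matIn_mapPt, hX, mapPt_evalIn_genericPt, rankOne_equations h hb hy d, Matrix.smul_apply,
        sub_self]
    have h1 := hx p hp
    rw [map_sub, map_dualExt, map_dualExt, mapPt_smul, mapPt_veronese_mulVec, map_hermVal_tmul,
      ← matIn_mapPt, hX, mapPt_evalIn_genericPt] at h1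
    rw [map_sub]
    exact h1
  · have h1 : linForm (∑ i, entryScalar φ b i) = ∑ i, linForm (entryScalar φ b i) :=
      map_sum (linFormₗ k _) _ _
    have h2 := hx _ (linForm_trace_mem h hb)
    simp only [h1, map_sum, evalIn_linForm] at h2
    simp only [diag_eq_dualExt h hb, ← Finset.sum_smul, h2, zero_smul]

end VeronesePoints

/-! ### Smoothness of `X(J)` -/

section Smooth

attribute [local instance] MvPolynomial.gradedAlgebra

variable {k : Type u} [Field k] [CharZero k] {C : Type v} [Ring C] [Module k C]
  [IsScalarTower k C C] [SMulCommClass k C C] [Nontrivial C] [Module.Finite k C]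
  {B : Type*} [CommRing B] [Algebra k B]
  {φ : QuadraticForm k C} (h : IsCompositionAlgebra φ) {n : ℕ} {b : Fin n → k}
  (hb : ∀ i, b i ≠ 0)

include h hb

/-- Polynomials in the ideal of `X(J)` vanish at the multiples of the values of the Veronese map
on the quadric `∑ b_i φ(c_i) = 0`. -/
lemma evalIn_smul_veronesePt_eq_zero (hn : 2 ≤ Module.finrank k (Fin n → C))
    {w : B ⊗[k] (Fin n → C)} (hw : evalIn w (quadForm (hermForm φ b)) = 0) (a : B)
    {f : CoordRing k (symMatrices φ b)} (hf : f ∈ (idealXJ φ b).toIdeal) :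
    evalIn (a • veronesePt h hb w) f = 0 := by
  have h1 : (idealXJ φ b).toIdeal ≤ RingHom.ker (evalIn (a • veronesePt h hb w)) := by
    refine Ideal.span_le.mpr fun g hg => ?_
    obtain ⟨d, hd⟩ := hg.1
    have h2 : g ∈ (idealXJ φ b).toIdeal := Ideal.subset_span hg
    rw [mem_idealXJ_iff h hb hn] at h2
    obtain ⟨q, hq⟩ := Ideal.mem_span_singleton.mp h2
    change evalIn (a • veronesePt h hb w) g = 0
    rw [evalIn_smul hd, ← evalIn_veroneseHom, hq, map_mul, hw, zero_mul, mul_zero]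
  exact h1 hf

lemma baseChange_polar_hermForm_mulVec (x : B ⊗[k] symMatrices φ b) (d : Fin n → C)
    {w : B ⊗[k] (Fin n → C)}
    (hw : vecIn k C n w = (matIn φ b x).mulVec (fun i => 1 ⊗ₜ d i)) :
    LinearMap.BilinForm.baseChange B (QuadraticMap.polarBilin (hermForm φ b)) w (1 ⊗ₜ d) =
      2 * hermVal φ b (fun i => 1 ⊗ₜ d i) (matIn φ b x) := by
  rw [baseChange_polar_hermForm]
  refine h.smul_one_injective ?_
  have hM := isHermitian_matIn hb x
  rw [← dagger_dotProduct_add h, hw, vecIn_tmul, dagger_mulVec h hM, ← Matrix.dotProduct_mulVec,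
    dagger_dotProduct_mulVec h hM, ← add_smul, two_mul]

/-- `X(J)` is smooth: where `d^* x d` is invertible, `x` is a multiple of the value of the Veronese
map at `x d`, and this vector can be lifted within the quadric by moving it in the direction
`d`. -/
lemma smooth_XJ (hn : 2 ≤ Module.finrank k (Fin n → C)) : Smooth (XJ φ b).hom := by
  refine smooth_projScheme_of_lift (span_hermLine_eq_top h hb) ?_
  rintro _ ⟨d, rfl⟩ R _ _ N hN x hx ⟨s, hs⟩
  rw [dualExt_hermLine] at hs
  obtain ⟨w, hw⟩ := exists_vecIn_eq ((matIn φ b x).mulVec (fun i => (1 : R) ⊗ₜ[k] d i))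
  set π := Ideal.Quotient.mkₐ k N with hπ
  have hπ0 : ∀ a ∈ N, π a = 0 := fun a ha => Ideal.Quotient.eq_zero_iff_mem.mpr ha
  obtain ⟨eq1, eq2⟩ := equations_of_idealXJ h hb (x := mapPt _ π x) fun f hf => by
    rw [← map_evalIn, hπ0 _ (hx f hf)]
  have hver : matIn φ b (veronesePt h hb (mapPt _ π w)) =
      π s • matIn φ b (mapPt _ π x) := by
    rw [hs, map_hermVal_tmul, ← eq1 d, matIn_veronesePt]
    congr 1
    ext i
    rw [vecIn_mapPt, hw, mapPt_mulVec, matIn_mapPt_eq_map]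
    simp only [mapPt_tmul, map_one]
  have hq : evalIn w (quadForm (hermForm φ b)) ∈ N := by
    refine Ideal.Quotient.eq_zero_iff_mem.mp ?_
    change π _ = 0
    refine h.smul_one_injective ?_
    rw [map_evalIn, ← trace_veronesePt h hb, hver, zero_smul]
    simp only [Matrix.smul_apply, ← Finset.smul_sum, eq2, smul_zero]
  set ε : R := (2⁻¹ : k) • (evalIn w (quadForm (hermForm φ b)) * ↑s⁻¹) with hε
  have hεN : ε ∈ N := Submodule.smul_of_tower_mem N _ (N.mul_mem_right _ hq)
  have hε2 : ε * ε = 0 := by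
    have := Ideal.mul_mem_mul hεN hεN
    rwa [← sq, ← sq, hN, Ideal.mem_bot, sq] at this
  have hw' : evalIn (w - ε • ((1 : R) ⊗ₜ[k] d)) (quadForm (hermForm φ b)) = 0 := by
    rw [evalIn_quadForm_sub _ _ _ hε2, baseChange_polar_hermForm_mulVec h hb x d hw, ← hs, hε]
    have h2 := algebraMap_inv_two_mul_two k R
    rw [Algebra.smul_def]
    linear_combination (-evalIn w (quadForm (hermForm φ b)) * ↑s⁻¹ * s) * h2 -
      evalIn w (quadForm (hermForm φ b)) * s.inv_mul
  refine ⟨(↑s⁻¹ : R) • veronesePt h hb (w - ε • (1 ⊗ₜ d)),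
    fun f hf => evalIn_smul_veronesePt_eq_zero h hb hn hw' _ hf, ?_⟩
  rw [mapPt_smul, mapPt_veronesePt, map_sub, mapPt_smul, hπ0 ε hεN, zero_smul, sub_zero]
  refine matIn_injective h hb ?_
  rw [matIn_smul, hver, smul_smul, ← map_mul, s.inv_mul, map_one, one_smul]

/-- Some coordinate does not vanish on `X(J)`: the quadric `∑ b_i φ(c_i) = 0` has a point
`(a, 1, 0, …, 0)` with `a ∈ k̄` non-zero. -/
lemma exists_linForm_notMem (hn : 2 ≤ n) :
    ∃ ℓ : Module.Dual k (symMatrices φ b), linForm ℓ ∉ (idealXJ φ b).toIdeal := by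
  obtain ⟨m, rfl⟩ : ∃ m, n = m + 2 := ⟨n - 2, by omega⟩
  obtain ⟨a, ha⟩ := IsAlgClosed.exists_pow_nat_eq
    (algebraMap k (AlgebraicClosure k) (-(b 1 / b 0))) two_pos
  have ha0 : a ≠ 0 := by
    rintro rfl
    have : algebraMap k (AlgebraicClosure k) (-(b 1 / b 0)) ≠ 0 := by
      rw [Ne, map_eq_zero]
      exact neg_ne_zero.mpr (div_ne_zero (hb 1) (hb 0))
    exact this (by rw [← ha]; simp)
  obtain ⟨w, hw⟩ := exists_vecIn_eq (k := k)
    (Fin.cons (a • (1 : AlgebraicClosure k ⊗[k] C)) (Fin.cons 1 0) :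
      Fin (m + 2) → AlgebraicClosure k ⊗[k] C)
  have hN : ∀ c : AlgebraicClosure k, normIn φ (c • (1 : AlgebraicClosure k ⊗[k] C)) = c ^ 2 := by
    intro c
    rw [normIn, map_smul, smul_comm, h.polarIn_smul_one, smul_eq_mul, sq]
  have hw0 : evalIn w (quadForm (hermForm φ b)) = 0 := by
    rw [evalIn_hermForm, hw, Fin.sum_univ_succ, Fin.sum_univ_succ]
    have h1 := hN 1
    rw [one_smul, one_pow] at h1
    have h0 : normIn φ (0 : AlgebraicClosure k ⊗[k] C) = 0 := by simp [normIn]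
    simp only [Fin.cons_zero, Fin.cons_succ, hN, h1, Pi.zero_apply, h0, mul_zero,
      Finset.sum_const_zero, add_zero, ha, Algebra.smul_def]
    rw [← map_mul, mul_one, ← map_add, mul_neg, mul_div_cancel₀ _ (hb 0), Fin.succ_zero_eq_one,
      neg_add_cancel, map_zero]
  obtain ⟨h1, h2⟩ := veronesePt_mem h hb hw0
  by_contra! hcon
  have h3 : veronesePt h hb w = 0 := eq_zero_of_dualExt fun ℓ => by
    rw [← evalIn_linForm]
    exact mem_idealXJ.mp (hcon ℓ) _ h1 h2
  have h4 := congrArg (fun x => matIn φ b x 0 (Fin.succ 0)) h3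
  simp only [matIn_veronesePt, veroneseIn_apply, hw, matIn_zero, Matrix.zero_apply, Fin.cons_zero,
    Fin.cons_succ, h.conjIn_one, mul_one, mul_smul_comm] at h4
  rw [smul_eq_zero_iff_right (hb _), smul_eq_zero_iff_right ha0] at h4
  have h5 : (1 : AlgebraicClosure k) = 0 := h.smul_one_injective (by rw [h4, smul_zero, smul_zero])
  exact one_ne_zero h5

end Smooth

/-! ### Block matrices and the base scheme -/

section Block

attribute [local instance] MvPolynomial.gradedAlgebra

variable {k : Type u} [Field k] [CharZero k] {C : Type v} [Ring C] [Module k C]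
  [IsScalarTower k C C] [SMulCommClass k C C] [Nontrivial C] [Module.Finite k C]
  {B : Type*} [CommRing B] [Algebra k B]
  {φ : QuadraticForm k C} (h : IsCompositionAlgebra φ) {m : ℕ} {b : Fin (m + 1) → k}
  (hb : ∀ i, b i ≠ 0)

variable (φ b) in
/-- The projection of `J_(m+1)` to `J_m` that deletes the last row and column. -/
def blockProj : symMatrices φ b →ₗ[k] symMatrices φ (fun i : Fin m => b i.castSucc) :=
  LinearMap.codRestrict _
    { toFun := fun x => x.1.submatrix Fin.castSucc Fin.castSucc
      map_add' := fun _ _ => rfl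
      map_smul' := fun _ _ => rfl }
    (fun x i j => x.2 i.castSucc j.castSucc)

variable (φ b) in
/-- The inclusion of `J_m` in `J_(m+1)` with last row and column zero. -/
def blockIncl : symMatrices φ (fun i : Fin m => b i.castSucc) →ₗ[k] symMatrices φ b :=
  LinearMap.codRestrict _
    { toFun := fun x => Matrix.of (Fin.snoc (fun i => Fin.snoc (x.1 i) 0) 0)
      map_add' := fun x y => by
        ext i j
        refine Fin.lastCases ?_ (fun i => ?_) i
        · simp
        · refine Fin.lastCases ?_ (fun j => ?_) j <;> simp
      map_smul' := fun a x => by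
        ext i j
        refine Fin.lastCases ?_ (fun i => ?_) i
        · simp
        · refine Fin.lastCases ?_ (fun j => ?_) j <;> simp }
    (fun x i j => by
      refine Fin.lastCases ?_ (fun i => ?_) i <;> refine Fin.lastCases ?_ (fun j => ?_) j
      any_goals simp
      exact x.2 i j)

lemma coe_blockIncl (x : symMatrices φ (fun i : Fin m => b i.castSucc)) :
    (blockIncl φ b x).1 = Matrix.of (Fin.snoc (fun i => Fin.snoc (x.1 i) 0) 0) := rfl

lemma blockIncl_castSucc (x : symMatrices φ (fun i : Fin m => b i.castSucc)) (i j : Fin m) :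
    (blockIncl φ b x).1 i.castSucc j.castSucc = x.1 i j := by
  simp [coe_blockIncl]

lemma blockIncl_last (x : symMatrices φ (fun i : Fin m => b i.castSucc)) (j : Fin (m + 1)) :
    (blockIncl φ b x).1 (Fin.last m) j = 0 := by
  simp [coe_blockIncl]

lemma blockProj_blockIncl (x : symMatrices φ (fun i : Fin m => b i.castSucc)) :
    blockProj φ b (blockIncl φ b x) = x := by
  ext i j
  exact blockIncl_castSucc x i j

lemma matIn_blockProj (x : B ⊗[k] symMatrices φ b) (i j : Fin m) :
    matIn φ (fun i : Fin m => b i.castSucc) ((blockProj φ b).baseChange B x) i j =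
      matIn φ b x i.castSucc j.castSucc := by
  rw [← baseChange_entry, ← baseChange_entry, ← LinearMap.comp_apply, ← LinearMap.baseChange_comp]
  rfl

lemma matIn_blockIncl_castSucc (x : B ⊗[k] symMatrices φ (fun i : Fin m => b i.castSucc))
    (i j : Fin m) : matIn φ b ((blockIncl φ b).baseChange B x) i.castSucc j.castSucc =
      matIn φ (fun i : Fin m => b i.castSucc) x i j := by
  rw [← baseChange_entry, ← baseChange_entry, ← LinearMap.comp_apply, ← LinearMap.baseChange_comp]
  congr 2
  ext x
  exact blockIncl_castSucc x i j

lemma matIn_blockIncl_last (x : B ⊗[k] symMatrices φ (fun i : Fin m => b i.castSucc))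
    (j : Fin (m + 1)) : matIn φ b ((blockIncl φ b).baseChange B x) (Fin.last m) j = 0 := by
  rw [← baseChange_entry, ← LinearMap.comp_apply, ← LinearMap.baseChange_comp]
  have : entry φ b (Fin.last m) j ∘ₗ blockIncl φ b = 0 := by
    ext x
    exact blockIncl_last x j
  rw [this, LinearMap.baseChange_zero, LinearMap.zero_apply]

lemma lastCol_eq_zero (hb : ∀ i, b i ≠ 0) {M : Matrix (Fin (m + 1)) (Fin (m + 1)) (B ⊗[k] C)}
    (hM : IsHermitian φ b M) (h0 : ∀ j, M (Fin.last m) j = 0) (i : Fin (m + 1)) :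
    M i (Fin.last m) = 0 := by
  have := hM i (Fin.last m)
  rw [h0, map_zero, smul_zero] at this
  exact (smul_eq_zero_iff_right (hb i)).mp this.symm

lemma blockIncl_blockProj {x : symMatrices φ b} (hx : ∀ j, x.1 (Fin.last m) j = 0) :
    blockIncl φ b (blockProj φ b x) = x := by
  have hcol : ∀ i, x.1 i (Fin.last m) = 0 := fun i => by
    rw [← x.2 i (Fin.last m), hx, map_zero, smul_zero, smul_zero]
  ext i j
  refine Fin.lastCases ?_ (fun i => ?_) i
  · rw [blockIncl_last, hx]
  · refine Fin.lastCases ?_ (fun j => ?_) j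
    · rw [hcol]
      simp [coe_blockIncl]
    · exact blockIncl_castSucc _ i j

/-- On `Z_2` every matrix agrees with its block without the last row and column. -/
lemma sub_pullback_block_mem (f : CoordRing k (symMatrices φ b)) :
    f - pullback (blockIncl φ b ∘ₗ blockProj φ b) f ∈ (idealZ2 φ b).toIdeal := by
  refine sub_pullback_mem _ _ (fun ℓ => linForm_mem_idealZ2 fun x hx => ?_) f
  change ℓ x - ℓ (blockIncl φ b (blockProj φ b x)) = 0
  rw [blockIncl_blockProj hx, sub_self]

section

include h hb

lemma pullback_blockIncl_mem (hn : 2 ≤ Module.finrank k (Fin m → C))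
    {f : CoordRing k (symMatrices φ b)} (hf : f ∈ (idealZ2 φ b).toIdeal) :
    pullback (blockIncl φ b) f ∈ (idealXJ φ (fun i : Fin m => b i.castSucc)).toIdeal := by
  have hb' : ∀ i : Fin m, b i.castSucc ≠ 0 := fun i => hb _
  refine map_mem_of_mem_idealZ2 (pullback (blockIncl φ b)) _ (fun f hf => ?_) (fun ℓ hℓ => ?_) hf
  · rw [mem_idealXJ_iff h hb' hn]
    refine mem_span_of_vanishing
      (isRadical_span_quadForm (hermForm_nondegenerate h hb') hn) fun w hw => ?_
    rw [evalIn_veroneseHom, evalIn_pullback]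
    obtain ⟨w₀, hw₀⟩ := exists_vecIn_eq (k := k) (C := C) (n := m + 1)
      (Fin.snoc (vecIn k C m w) 0)
    have hcs : ∀ i : Fin m, vecIn k C (m + 1) w₀ i.castSucc = vecIn k C m w i := fun i => by
      rw [hw₀, Fin.snoc_castSucc]
    have hlast : vecIn k C (m + 1) w₀ (Fin.last m) = 0 := by rw [hw₀, Fin.snoc_last]
    have h1 : (blockIncl φ b).baseChange (AlgebraicClosure k) (veronesePt h hb' w) =
        veronesePt h hb w₀ := by
      refine matIn_injective h hb ?_
      ext i j
      rw [matIn_veronesePt]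
      refine Fin.lastCases ?_ (fun i => ?_) i
      · rw [matIn_blockIncl_last, veroneseIn_apply, hlast, zero_mul]
      · refine Fin.lastCases ?_ (fun j => ?_) j
        · rw [lastCol_eq_zero hb (isHermitian_matIn hb _) (matIn_blockIncl_last _),
            veroneseIn_apply, hlast, map_zero, smul_zero, mul_zero]
        · rw [matIn_blockIncl_castSucc, matIn_veronesePt, veroneseIn_apply, veroneseIn_apply, hcs,
            hcs]
    have h2 : evalIn w₀ (quadForm (hermForm φ b)) = 0 := by
      rw [← hw, evalIn_hermForm, evalIn_hermForm, Fin.sum_univ_castSucc, hlast]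
      simp [hcs, normIn]
    obtain ⟨h3, h4⟩ := veronesePt_mem h hb h2
    rw [h1]
    exact mem_idealXJ.mp hf _ h3 h4
  · obtain ⟨j, μ, hμ⟩ := hℓ
    have h0 : ℓ ∘ₗ blockIncl φ b = 0 := by
      refine LinearMap.ext fun w => ?_
      rw [LinearMap.comp_apply, hμ, blockIncl_last, map_zero, LinearMap.zero_apply]
    rw [pullback_linForm, h0]
    change linFormₗ k _ 0 ∈ _
    rw [map_zero]
    exact zero_mem _

/-- The homogeneous coordinate rings of `Z_2` and `X(J_m)` agree up to torsion: at a point `y` of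
`Z_2`, regarded as a matrix of size `m`, the equations of `X(J_(m+1))` show that `(d^* y d) y` is
the value of the Veronese map at `y d`. -/
lemma map_pow_mul_eq_zero (hn : 2 ≤ Module.finrank k (Fin m → C)) (d : Fin m → C) {e : ℕ}
    {f : CoordRing k (symMatrices φ b)} (hf : f ∈ coordGrading k (symMatrices φ b) e)
    (hfJ : pullback (blockIncl φ b) f ∈ (idealXJ φ (fun i : Fin m => b i.castSucc)).toIdeal)
    (g : CoordRing k (symMatrices φ b) →ₐ[k] B) (hg0 : ∀ f ∈ (idealZ2 φ b).toIdeal, g f = 0) :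
    g (linForm (hermLine φ (fun i : Fin m => b i.castSucc) d ∘ₗ blockProj φ b) ^ e * f) = 0 := by
  have hb' : ∀ i : Fin m, b i.castSucc ≠ 0 := fun i => hb _
  obtain ⟨x, hev⟩ : ∃ x : B ⊗[k] symMatrices φ b, ∀ f, evalIn x f = g f :=
    ⟨mapPt _ g (genericPt k (symMatrices φ b)), fun f => by rw [evalIn_mapPt_genericPt]⟩
  set y := (blockProj φ b).baseChange _ x with hy
  obtain ⟨eq1, eq2⟩ := equations_of_idealXJ h hb (x := x) fun f hf => by
    rw [hev, hg0 _ (idealXJ_le_idealZ2 hf)]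
  have hrow : ∀ j, matIn φ b x (Fin.last m) j = 0 := fun j => eq_zero_of_dualExt fun μ => by
    rw [← baseChange_entry, ← dualExt_comp, ← evalIn_linForm, hev]
    refine hg0 _ (linForm_mem_idealZ2 fun x hx => ?_)
    rw [LinearMap.comp_apply, entry_apply, hx, map_zero]
  have hxy : ∀ i j, matIn φ b x (Fin.castSucc i) (Fin.castSucc j) = matIn φ _ y i j := fun i j => by
    rw [hy, matIn_blockProj]
  -- the vector `d`, extended by zero
  let d₀ : Fin (m + 1) → C := Fin.snoc d 0
  have hd₀ : ∀ i : Fin m, d₀ i.castSucc = d i := fun i => by simp [d₀]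
  have hd₁ : d₀ (Fin.last m) = 0 := by simp [d₀]
  have hmul : ∀ i : Fin m, (matIn φ b x).mulVec (fun i => 1 ⊗ₜ d₀ i) i.castSucc =
      (matIn φ _ y).mulVec (fun i => 1 ⊗ₜ d i) i := fun i => by
    simp only [Matrix.mulVec, dotProduct, Fin.sum_univ_castSucc, hd₀, hd₁, TensorProduct.tmul_zero,
      mul_zero, add_zero, hxy]
  have hval : hermVal φ b (fun i => 1 ⊗ₜ d₀ i) (matIn φ b x) =
      hermVal φ (fun i : Fin m => b i.castSucc) (fun i => 1 ⊗ₜ d i) (matIn φ _ y) := by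
    simp only [hermVal, dotProduct, Fin.sum_univ_castSucc, dagger, hmul, hd₀, hd₁,
      TensorProduct.tmul_zero, map_zero, smul_zero, zero_mul, add_zero]
  set s := hermVal φ (fun i : Fin m => b i.castSucc) (fun i => 1 ⊗ₜ d i) (matIn φ _ y) with hs
  obtain ⟨w, hw⟩ := exists_vecIn_eq ((matIn φ (fun i : Fin m => b i.castSucc) y).mulVec
    (fun i => 1 ⊗ₜ d i))
  have hwy : veronesePt h hb' w = s • y := by
    refine matIn_injective h hb' ?_
    rw [matIn_veronesePt, hw, matIn_smul]
    ext i j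
    have := congrFun (congrFun (eq1 d₀) i.castSucc) j.castSucc
    rw [veroneseIn_apply, hmul, hmul, hval, Matrix.smul_apply, hxy] at this
    exact this
  have hQ : evalIn w (quadForm (hermForm φ (fun i : Fin m => b i.castSucc))) = 0 := by
    refine h.smul_one_injective ?_
    rw [← trace_veronesePt h hb', hwy, zero_smul, matIn_smul]
    rw [Fin.sum_univ_castSucc, hrow, add_zero] at eq2
    simp only [Matrix.smul_apply, ← Finset.smul_sum, ← hxy, eq2, smul_zero]
  have hfy : g f = evalIn y (pullback (blockIncl φ b) f) := by
    have h1 := hg0 _ (sub_pullback_block_mem f)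
    rw [map_sub, sub_eq_zero] at h1
    rw [h1, ← hev, evalIn_pullback, evalIn_pullback, LinearMap.baseChange_comp,
      LinearMap.comp_apply]
  have hsd : g (linForm (hermLine φ (fun i : Fin m => b i.castSucc) d ∘ₗ blockProj φ b)) = s := by
    rw [← hev, evalIn_linForm, dualExt_comp, dualExt_hermLine]
  rw [map_mul, map_pow, hsd, hfy, ← evalIn_smul (pullback_mem _ hf), ← hwy]
  have := evalIn_smul_veronesePt_eq_zero h hb' hn hQ 1 hfJ
  rwa [one_smul] at this

/-- `Z_2` is `X(J_m)`: restriction of polynomial functions along `blockIncl` is surjective on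
homogeneous coordinate rings and injective up to torsion. -/
lemma nonempty_Z2_iso_XJ (hn : 2 ≤ Module.finrank k (Fin m → C)) :
    Nonempty (Z2 φ b ≅ XJ φ (fun i : Fin m => b i.castSucc)) := by
  have hb' : ∀ i : Fin m, b i.castSucc ≠ 0 := fun i => hb _
  let T : Set (Module.Dual k (symMatrices φ b)) :=
    (Set.range fun d => hermLine φ (fun i : Fin m => b i.castSucc) d ∘ₗ blockProj φ b) ∪
      lastRowForms φ b
  refine nonempty_projScheme_iso (idealZ2 φ b) _ (pullback (blockIncl φ b))
    (fun n f hf => pullback_mem _ hf) (fun n g hg => ⟨pullback (blockProj φ b) g,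
      pullback_mem _ hg, ?_⟩) (fun f hf => pullback_blockIncl_mem h hb hn hf)
    (T := fun ℓ : T => ℓ.1) ?_ ?_
  · rw [pullback_pullback]
    convert pullback_id g
    exact LinearMap.ext blockProj_blockIncl
  · rw [Subtype.range_coe]
    refine Submodule.span_eq_top_of_ne_zero fun x hx => ?_
    by_contra! hcon
    refine hx ?_
    have h1 : blockProj φ b x = 0 :=
      eq_zero_of_hermLine h hb' fun d => hcon _ (Or.inl ⟨d, rfl⟩)
    have h2 : ∀ j, x.1 (Fin.last m) j = 0 := fun j => h.nondegenerate.1 _ fun c =>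
      hcon ((QuadraticMap.polarBilin φ).flip c ∘ₗ entry φ b (Fin.last m) j)
        (Or.inr ⟨j, (QuadraticMap.polarBilin φ).flip c, fun _ => rfl⟩)
    rw [← blockIncl_blockProj h2, h1, map_zero]
  · rintro ⟨_, ⟨d, rfl⟩ | ⟨j, μ, hμ⟩⟩ e f hf hfJ
    · exact ⟨e, Ideal.Quotient.eq_zero_iff_mem.mp (map_pow_mul_eq_zero h hb hn d hf hfJ
        (Ideal.Quotient.mkₐ k _) fun f hf => Ideal.Quotient.eq_zero_iff_mem.mpr hf)⟩
    · refine ⟨1, ?_⟩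
      rw [pow_one]
      refine Ideal.mul_mem_right _ _ (linForm_mem_idealZ2 fun x hx => ?_)
      rw [hμ, hx, map_zero]

end

end Block

section Associative

attribute [local instance] MvPolynomial.gradedAlgebra

variable {k : Type u} [Field k] [CharZero k] {C : Type v} [NonAssocRing C] [Module k C]
  [IsScalarTower k C C] [SMulCommClass k C C] [Nontrivial C] [Module.Finite k C]
  {φ : QuadraticForm k C} (h : IsCompositionAlgebra φ) {m : ℕ} {b : Fin (m + 1) → k}
  (hb : ∀ i, b i ≠ 0)

include h hb

/-- The isomorphism of `Z_2` with `X(J_m)` and the geometry of `X(J_m)` when the composition algebra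
is associative. The multiplication is assumed to be associative as a hypothesis on a non-associative
ring, and the ring structure is built from it. -/
lemma Z2_of_assoc (hassoc : ∀ x y z : C, (x * y) * z = x * (y * z)) (hm : 2 ≤ m)
    (hn : 3 ≤ Module.finrank k (Fin m → C)) :
    IsReduced (XJ φ (fun i : Fin m => b i.castSucc)).left ∧
    Smooth (XJ φ (fun i : Fin m => b i.castSucc)).hom ∧
    IrreducibleSpace (XJ φ (fun i : Fin m => b i.castSucc)).left ∧
    Nonempty (Z2 φ b ≅ XJ φ (fun i : Fin m => b i.castSucc)) := by
  let R : Ring C := { (inferInstance : NonAssocRing C) with mul_assoc := hassoc }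
  have hb' : ∀ i : Fin m, b i.castSucc ≠ 0 := fun i => hb _
  have hp := isPrime_idealXJ (C := C) h hb' hn
  obtain ⟨ℓ, hℓ⟩ := exists_linForm_notMem (C := C) h hb' hm
  exact ⟨isReduced_projScheme hp.isRadical, smooth_XJ (C := C) h hb' (by omega),
    irreducibleSpace_projScheme hp hℓ, nonempty_Z2_iso_XJ (C := C) h hb (by omega)⟩

end Associative

end JordanVeronese

end

theorem lemma2p15 {k : Type*} [Field k] [CharZero k]
    {C : Type*} [NonAssocRing C] [Module k C] [IsScalarTower k C C] [SMulCommClass k C C]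
    [Module.Finite k C] (φ : QuadraticForm k C) (hφ : IsCompositionAlgebra φ)
    (r : ℕ) (hr : r ≤ 3) (hC : Module.finrank k C = 2 ^ r)
    -- the degree is `n = m + 1 ≥ 3`, and `n = 3` in the octonion case
    (m : ℕ) (hm : 2 ≤ m) (hrm : r = 3 → m = 2)
    (b : Fin (m + 1) → k) (hb : ∀ i, b i ≠ 0) :
    AlgebraicGeometry.IsReduced (Z2 φ b).left ∧
    AlgebraicGeometry.Smooth (Z2 φ b).hom ∧
    -- `Z2` is a variety, except possibly for the zero-dimensional quadric `b₁ x² + b₂ y² = 0`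
    ((r ≠ 0 ∨ m ≠ 2) → IrreducibleSpace (Z2 φ b).left) ∧
    (3 ≤ m → Nonempty (Z2 φ b ≅ XJ φ (fun i : Fin m => b i.castSucc))) ∧
    (m = 2 → Nonempty (Z2 φ b ≅
      quadric ((b 0 • φ).prod (b 1 • (QuadraticMap.sq : QuadraticForm k k))))) := by
  have hpos : 0 < 2 ^ r := by positivity
  have : Nontrivial C := Module.nontrivial_of_finrank_pos (R := k) (by omega)
  by_cases hm2 : m = 2
  · subst hm2
    have hdim : Module.finrank k (C × k) = 2 ^ r + 1 := by
      rw [Module.finrank_prod, Module.finrank_self, hC]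
    obtain ⟨e⟩ := nonempty_Z2_iso_quadric hφ hb (by omega)
    have hq := planeForm_nondegenerate hφ hb
    refine ⟨isReduced_of_iso e (isReduced_projScheme (isRadical_span_quadForm hq (by omega))),
      smooth_of_iso e (smooth_quadric hq), fun h => irreducibleSpace_of_iso e ?_,
      fun h => absurd h (by norm_num), fun _ => ⟨e⟩⟩
    have hr0 : r ≠ 0 := by simpa using h
    have hr2 : 2 ≤ 2 ^ r := by
      calc 2 = 2 ^ 1 := rfl
        _ ≤ 2 ^ r := Nat.pow_le_pow_right two_pos (by omega)
    exact irreducibleSpace_projScheme (isPrime_span_quadForm hq (by omega))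
      (linForm_notMem_span_quadForm hq (ℓ := LinearMap.snd k C k) (v := (0, 1)) one_ne_zero)
  · have hr2 : r ≤ 2 := by
      rcases Nat.lt_or_ge r 3 with h | h
      · omega
      · exact absurd (hrm (by omega)) hm2
    have hdim : Module.finrank k (Fin m → C) = m * 2 ^ r := by
      rw [Module.finrank_pi_fintype]; simp [hC]
    have hn : 3 ≤ Module.finrank k (Fin m → C) := by
      rw [hdim]
      nlinarith [hpos, (show 3 ≤ m by omega)]
    obtain ⟨h1, h2, h3, ⟨e⟩⟩ :=
      Z2_of_assoc hφ hb (hφ.mul_assoc_of_finrank hr2 hC) hm hn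
    exact ⟨isReduced_of_iso e h1, smooth_of_iso e h2, fun _ => irreducibleSpace_of_iso e h3,
      fun _ => ⟨e⟩, fun h => absurd h hm2⟩
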